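/- Conventions. On $\mathbb{R}^{2n}=\mathbb{R}^n\oplus i\mathbb{R}^n$ with coordinates $(x,y)$ let $\omega_{\mathrm{std}}=\sum_j dx_j\wedge dy_j$. For a $C^1$ path $\Lambda:[a,b]\to\mathrm{Lag}(E,\omega)$ of Lagrangian subspaces of a symplectic vector space $(E,\omega)$ and $V\in\mathrm{Lag}(E,\omega)$, the crossing form at $t$ is the quadratic form on $\Lambda(t)\cap V$ given by $\Gamma(\Lambda,V,t)(v)=\omega(v,\dot u(t))$, where $u$ is any $C^1$ curve with $u(s)\in\Lambda(s)$ and $u(t)=v$. If all crossing forms are nondegenerate, the Robbin–Salamon index is $$\mu_{\mathrm{RS}}(\Lambda,V)=\tfrac12\,\mathrm{sign}\,\Gamma(\Lambda,V,a)+\sum_{a<t<b}\mathrm{sign}\,\Gamma(\Lambda,V,t)+\tfrac12\,\mathrm{sign}\,\Gamma(\Lambda,V,b)\in\tfrac12\mathbb{Z},$$ and for an arbitrary continuous path $\Lambda$ it is the index of any $C^1$ path with nondegenerate crossing forms that is homotopic to $\Lambda$ with fixed end points. For a continuous path $\Psi:[0,T]\to\mathrm{Sp}(\mathbb{R}^{2n})$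 with $\Psi(0)=\mathbb{1}$ and $\det(\Psi(T)-\mathbb{1})\neq0$, the Conley–Zehnder index is $$\mu_{\mathrm{CZ}}(\Psi|_{[0,T]})=\mu_{\mathrm{RS}}\big(\{(x,-\Psi(t)x)\},\{(x,-x)\}\big)$$ in $(\mathbb{R}^{2n}\times\mathbb{R}^{2n},(-\omega_{\mathrm{std}})\oplus\omega_{\mathrm{std}})$. Proposition. Let $T>0$, let $I=\mathrm{diag}(1,-1)$ on $\mathbb{R}^2$, and let $\mathbb{R}=\mathrm{Fix}(I)\subset\mathbb{R}^2$ be the real axis. Let $\Psi:\mathbb{R}\to\mathrm{Sp}(\mathbb{R}^2)$ be a continuous path with $\Psi(0)=\mathbb{1}$, $\Psi(t+T)=\Psi(t)\Psi(T)$ and $\Psi(-t)=I\Psi(t)I$ for all $t\in\mathbb{R}$, which is nondegenerate, i.e. $\dim\ker(\Psi(T)-\mathbb{1})=0$. Then $$\big|\mu_{\mathrm{CZ}}(\Psi|_{[0,T]})-2\,\mu_{\mathrm{RS}}(\Psi|_{[0,T/2]}\mathbb{R},\mathbb{R})\big|\le 1 .$$ In consequence, if $\mu_{\mathrm{CZ}}(\Psi|_{[0,T]})\ge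 3$, then $\mu_{\mathrm{RS}}(\Psi|_{[0,T/2]}\mathbb{R},\mathbb{R})\ge\tfrac32$. -/

import Mathlib

namespace RobbinSalamon

noncomputable section

open Set

section General

variable {E : Type*} [NormedAddCommGroup E] [InnerProductSpace ℝ E] [FiniteDimensional ℝ E]

/-- `L` is a Lagrangian subspace for the (symplectic) form `ω`: it equals its own
`ω`-orthogonal complement. -/
def IsLagrangian (ω : LinearMap.BilinForm ℝ E) (L : Submodule ℝ E) : Prop :=
  ∀ x : E, x ∈ L ↔ ∀ y ∈ L, ω x y = 0

/-- The orthogonal projection onto `L`.  The map `L ↦ proj L` is the standard embedding of the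
Grassmannian as a smooth submanifold of the space of endomorphisms; continuity and
differentiability of families of subspaces are understood through it. -/
def proj (L : Submodule ℝ E) : E →L[ℝ] E := L.starProjection

/-- The bilinear form `(v, w) ↦ ω (v, d/ds|_{s=t} (P_s w))` with `P_s` the orthogonal projection
onto `Λ s`; the derivative is one-sided at the end points of `[a, b]`. -/
def velocityForm (ω : LinearMap.BilinForm ℝ E) (Λ : ℝ → Submodule ℝ E) (a b t : ℝ) :
    LinearMap.BilinForm ℝ E :=
  ω.compRight (derivWithin (fun s => proj (Λ s)) (Icc a b) t).toLinearMap

/-- The crossing form `Γ(Λ, V, t)`, a quadratic form on `Λ t ∩ V`.  Its value at `v` is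
`ω (v, u'(t))` for every differentiable `u` with `u s ∈ Λ s` and `u t = v`
(see `crossingForm_eq`), for instance `u s = v + w s` with `w s` in a fixed Lagrangian
complement of `Λ t`. -/
def crossingForm (ω : LinearMap.BilinForm ℝ E) (Λ : ℝ → Submodule ℝ E) (V : Submodule ℝ E)
    (a b t : ℝ) : QuadraticForm ℝ ↥(Λ t ⊓ V) :=
  ((velocityForm ω Λ a b t).restrict (Λ t ⊓ V)).toQuadraticMap

/-- The crossing form does not depend on the section used to compute it. -/
theorem crossingForm_eq (ω : LinearMap.BilinForm ℝ E) (Λ : ℝ → Submodule ℝ E)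
    (V : Submodule ℝ E) (a b t : ℝ) (hab : a < b) (ht : t ∈ Icc a b)
    (hL : IsLagrangian ω (Λ t))
    (hd : DifferentiableWithinAt ℝ (fun s => proj (Λ s)) (Icc a b) t)
    (v : ↥(Λ t ⊓ V)) (u : ℝ → E) (u' : E) (hu : ∀ s ∈ Icc a b, u s ∈ Λ s) (hut : u t = v)
    (hu' : HasDerivWithinAt u u' (Icc a b) t) :
    crossingForm ω Λ V a b t v = ω v u' := by
  have h1 := hd.hasDerivWithinAt.clm_apply hu'
  have h2 : HasDerivWithinAt u (derivWithin (fun s => proj (Λ s)) (Icc a b) t (u t)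
      + proj (Λ t) u') (Icc a b) t := by
    refine h1.congr (fun s hs => ?_) ?_
    · exact ((Λ s).starProjection_eq_self_iff.mpr (hu s hs)).symm
    · exact ((Λ t).starProjection_eq_self_iff.mpr (hu t ht)).symm
  have h3 := (uniqueDiffOn_Icc hab t ht).eq_deriv _ hu' h2
  have h4 : ω v (proj (Λ t) u') = 0 :=
    (hL v).1 v.2.1 _ ((Λ t).starProjection_apply_mem u')
  rw [h3, map_add, h4, add_zero, hut]
  rfl

/-- The signature of a real quadratic form on a finite-dimensional space. -/
def signature {M : Type*} [AddCommGroup M] [Module ℝ M] (Q : QuadraticForm ℝ M) : ℤ :=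
  (sigPos Q : ℤ) - (sigNeg Q : ℤ)

/-- `Λ : [a, b] → Lag(E, ω)` is continuously differentiable and has only regular crossings
with `V`, i.e. every crossing form is nondegenerate (for `Λ t ∩ V = 0` this is no condition). -/
structure IsRegularPath (ω : LinearMap.BilinForm ℝ E) (Λ : ℝ → Submodule ℝ E)
    (V : Submodule ℝ E) (a b : ℝ) : Prop where
  lagrangian : ∀ t ∈ Icc a b, IsLagrangian ω (Λ t)
  contDiffOn : ContDiffOn ℝ 1 (fun t => proj (Λ t)) (Icc a b)
  nondegenerate : ∀ t ∈ Icc a b, (crossingForm ω Λ V a b t).Nondegenerate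

/-- The crossing number
`½ sign Γ(a) + ∑_{a < t < b} sign Γ(t) + ½ sign Γ(b)` of a path with regular crossings.
Such a path has finitely many crossings, and the summand vanishes at every other time. -/
def crossingNumber (ω : LinearMap.BilinForm ℝ E) (Λ : ℝ → Submodule ℝ E)
    (V : Submodule ℝ E) (a b : ℝ) : ℚ :=
  (signature (crossingForm ω Λ V a b a) : ℚ) / 2
    + ∑ᶠ t ∈ Ioo a b, (signature (crossingForm ω Λ V a b t) : ℚ)
    + (signature (crossingForm ω Λ V a b b) : ℚ) / 2

/-- `Λ₀` and `Λ₁` are homotopic with fixed end points as paths `[a, b] → Lag(E, ω)`. -/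
def LagHomotopic (ω : LinearMap.BilinForm ℝ E) (Λ₀ Λ₁ : ℝ → Submodule ℝ E) (a b : ℝ) : Prop :=
  ∃ F : ℝ → ℝ → Submodule ℝ E,
    (∀ s ∈ Icc (0 : ℝ) 1, ∀ t ∈ Icc a b, IsLagrangian ω (F s t)) ∧
    ContinuousOn (fun p : ℝ × ℝ => proj (F p.1 p.2)) (Icc (0 : ℝ) 1 ×ˢ Icc a b) ∧
    (∀ t ∈ Icc a b, F 0 t = Λ₀ t) ∧
    (∀ t ∈ Icc a b, F 1 t = Λ₁ t) ∧
    (∀ s ∈ Icc (0 : ℝ) 1, F s a = Λ₀ a) ∧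
    (∀ s ∈ Icc (0 : ℝ) 1, F s b = Λ₀ b)

/-- `m` is the crossing number of a continuously differentiable path with only regular crossings
that is homotopic to `Λ` with fixed end points. -/
def HasRSIndex (ω : LinearMap.BilinForm ℝ E) (Λ : ℝ → Submodule ℝ E) (V : Submodule ℝ E)
    (a b : ℝ) (m : ℚ) : Prop :=
  ∃ Λ' : ℝ → Submodule ℝ E,
    LagHomotopic ω Λ Λ' a b ∧ IsRegularPath ω Λ' V a b ∧ crossingNumber ω Λ' V a b = m

open Classical in
/-- The Robbin–Salamon index `μ_RS(Λ, V)` of a continuous Lagrangian path `Λ` on `[a, b]`. -/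
def rsIndex (ω : LinearMap.BilinForm ℝ E) (Λ : ℝ → Submodule ℝ E) (V : Submodule ℝ E)
    (a b : ℝ) : ℚ :=
  if h : ∃ m : ℚ, HasRSIndex ω Λ V a b m then h.choose else 0

end General

section Standard

/-- `ℝ²ⁿ = ℝⁿ ⊕ iℝⁿ`, with coordinates `x j = v (inl j)` and `y j = v (inr j)`. -/
abbrev R2 (n : ℕ) : Type := EuclideanSpace ℝ (Fin n ⊕ Fin n)

/-- The standard symplectic form `ω_std = ∑ j, dx_j ∧ dy_j`. -/
def stdForm (n : ℕ) : LinearMap.BilinForm ℝ (R2 n) :=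
  LinearMap.mk₂ ℝ
    (fun v w => ∑ j, (v (Sum.inl j) * w (Sum.inr j) - v (Sum.inr j) * w (Sum.inl j)))
    (fun v v' w => by
      simp only [PiLp.add_apply, ← Finset.sum_add_distrib]
      exact Finset.sum_congr rfl fun _ _ => by ring)
    (fun c v w => by
      simp only [PiLp.smul_apply, smul_eq_mul, Finset.mul_sum]
      exact Finset.sum_congr rfl fun _ _ => by ring)
    (fun v w w' => by
      simp only [PiLp.add_apply, ← Finset.sum_add_distrib]
      exact Finset.sum_congr rfl fun _ _ => by ring)
    (fun c v w => by
      simp only [PiLp.smul_apply, smul_eq_mul, Finset.mul_sum]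
      exact Finset.sum_congr rfl fun _ _ => by ring)

/-- `Sp(ℝ²ⁿ)`. -/
abbrev Sp (n : ℕ) : Type := Matrix.symplecticGroup (Fin n) ℝ

/-- The linear map of `ℝ²ⁿ` given by a symplectic matrix. -/
def act {n : ℕ} (A : Sp n) : R2 n →ₗ[ℝ] R2 n := Matrix.toEuclideanLin A.1

/-- The antisymplectic involution `I = diag(1, -1)`, i.e. complex conjugation. -/
def conj (n : ℕ) : Matrix (Fin n ⊕ Fin n) (Fin n ⊕ Fin n) ℝ := Matrix.fromBlocks 1 0 0 (-1)

/-- The Lagrangian subspace `ℝⁿ = Fix I` of `ℝ²ⁿ`. -/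
def realSubspace (n : ℕ) : Submodule ℝ (R2 n) :=
  LinearMap.eqLocus (Matrix.toEuclideanLin (conj n)) LinearMap.id

/-- `ℝ²ⁿ × ℝ²ⁿ` with its Euclidean structure. -/
abbrev R2Prod (n : ℕ) : Type := WithLp 2 (R2 n × R2 n)

/-- The symplectic form `(-ω_std) ⊕ ω_std` on `ℝ²ⁿ × ℝ²ⁿ`. -/
def prodForm (n : ℕ) : LinearMap.BilinForm ℝ (R2Prod n) :=
  -((stdForm n).compl₁₂ (WithLp.fstₗ 2 ℝ (R2 n) (R2 n)) (WithLp.fstₗ 2 ℝ (R2 n) (R2 n)))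
    + (stdForm n).compl₁₂ (WithLp.sndₗ 2 ℝ (R2 n) (R2 n)) (WithLp.sndₗ 2 ℝ (R2 n) (R2 n))

/-- The subspace `{(x, -A x)}` of `ℝ²ⁿ × ℝ²ⁿ`. -/
def grBar {n : ℕ} (A : Sp n) : Submodule ℝ (R2Prod n) :=
  LinearMap.eqLocus (WithLp.sndₗ 2 ℝ (R2 n) (R2 n)) (-(act A ∘ₗ WithLp.fstₗ 2 ℝ (R2 n) (R2 n)))

/-- The antidiagonal `{(x, -x)}` of `ℝ²ⁿ × ℝ²ⁿ`. -/
def antidiag (n : ℕ) : Submodule ℝ (R2Prod n) :=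
  LinearMap.eqLocus (WithLp.sndₗ 2 ℝ (R2 n) (R2 n)) (-WithLp.fstₗ 2 ℝ (R2 n) (R2 n))

/-- `μ_RS(Ψ|_[a, b] V, V)`. -/
def rsIndexSp {n : ℕ} (Ψ : ℝ → Sp n) (V : Submodule ℝ (R2 n)) (a b : ℝ) : ℚ :=
  rsIndex (stdForm n) (fun t => V.map (act (Ψ t))) V a b

/-- The Conley–Zehnder index `μ_CZ(Ψ|_[0, T])` of a path with `Ψ 0 = 1` and
`det (Ψ T - 1) ≠ 0`. -/
def czIndex {n : ℕ} (Ψ : ℝ → Sp n) (T : ℝ) : ℚ :=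
  rsIndex (prodForm n) (fun t => grBar (Ψ t)) (antidiag n) 0 T

/-- The path `Ψ|_[0, T]` is nondegenerate: `dim ker (Ψ T - 1) = 0`. -/
def NondegeneratePath {n : ℕ} (Ψ : ℝ → Sp n) (T : ℝ) : Prop :=
  Module.finrank ℝ (LinearMap.ker (act (Ψ T) - LinearMap.id)) = 0

end Standard

end

end RobbinSalamon

/-! In unitary coordinates with `V = ℝⁿ`, the orthogonal reflection in a Lagrangian subspace is
conjugate linear, hence `z ↦ W z̄` with `W` symmetric and unitary. Crossings with `V` are the times
when `1` is an eigenvalue of `W`, and the crossing form is half the imaginary part of `W'` on the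
real fixed vectors. A regular crossing therefore pushes as many eigenvalues through `1`, counted
with direction, as its signature says. Writing the eigenvalues as `exp (i α j)` with continuous
angles, the Robbin–Salamon index is the change of `∑ j, halfFloor (α j)`. For `n = 1, 2` this is
`HasRSIndex.eq_angleIndex`: `jumpProperty_one` and `jumpProperty_two` treat the crossings,
`liftProperty_one` and `liftProperty_two` lift the angles along a homotopy. Explicit one-parameter
families give regular representatives, so `rsIndex_one` and `rsIndex_two` compute the index from end
point data.

For `Ψ ℝ` the angle is `2θ`, with `θ` the argument of the first column of `Ψ`. For the twisted graph
the angles are `φ ± β`, where `φ` is the argument of the complex linear part `ℓ` of `Ψ` and `cos β =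
1 / |ℓ|`.

Let `A = (a, b; c, d)` be `Ψ (T/2)`. Symmetry and periodicity give `Ψ T = (I A I)⁻¹ A`, whose linear
part is `(d + ic)(a - ib)`. Following arguments over the plane of pairs of times gives `φ T = p + q`
at half the period, with `p`, `q` the arguments of the two factors (`exists_linearPart_arg`). The
trace of `Ψ T` is `2 + 4bc`, so nondegeneracy means `bc ≠ 0`, and `cos (p + q) - cos β` has the sign
of `bc`. Moreover `θ`, `p` lie in one interval `(πk, π(k + 1))`, because both sines have the sign of
`c`, and `|p - q| < π`. Hence `2 μ_RS = 2k + 1`, while `μ_CZ` is `2k + 1` if `bc < 0` and `2k` or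
`2k + 2` if `bc > 0` (`halfFloor_comparison`).

The last claim uses integrality of `k`: the inequality alone would only give `μ_RS ≥ 1`. -/

namespace RobbinSalamon

open Set Filter Topology

set_option linter.unusedSectionVars false

/-! ### Lagrangian subspaces as symmetric unitary matrices -/

noncomputable section

variable {E : Type*} [NormedAddCommGroup E] [InnerProductSpace ℝ E] [FiniteDimensional ℝ E]

/-- An identification of `(E, ω)` with `ℂⁿ` that carries the inner product and `ω` to the real and
imaginary parts of the Hermitian product and `V` to `ℝⁿ`. -/
structure UnitaryCoordinates (ω : LinearMap.BilinForm ℝ E) (V : Submodule ℝ E) (n : ℕ) where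
  toEquiv : E ≃ₗ[ℝ] (Fin n → ℂ)
  inner_eq : ∀ v w, inner ℝ v w = (∑ j, star (toEquiv v j) * toEquiv w j).re
  form_eq : ∀ v w, ω v w = (∑ j, star (toEquiv v j) * toEquiv w j).im
  mem_iff : ∀ v, v ∈ V ↔ ∀ j, (toEquiv v j).im = 0

namespace UnitaryCoordinates

variable {ω : LinearMap.BilinForm ℝ E} {V : Submodule ℝ E} {n : ℕ}
  (c : UnitaryCoordinates ω V n)

/-- Multiplication by the imaginary unit. -/
def J (v : E) : E := c.toEquiv.symm (fun j => Complex.I * c.toEquiv v j)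

@[simp] lemma toEquiv_J (v : E) (j : Fin n) : c.toEquiv (c.J v) j = Complex.I * c.toEquiv v j := by
  simp [J]

lemma J_J (v : E) : c.J (c.J v) = -v := by
  apply c.toEquiv.injective
  ext j
  simp [← mul_assoc]

lemma J_sub (v w : E) : c.J (v - w) = c.J v - c.J w := by
  apply c.toEquiv.injective
  ext j
  simp [mul_sub]

lemma J_add (v w : E) : c.J (v + w) = c.J v + c.J w := by
  apply c.toEquiv.injective
  ext j
  simp [mul_add]

lemma form_eq_inner_J (v w : E) : ω v w = inner ℝ (c.J v) w := by
  rw [c.form_eq, c.inner_eq, Complex.re_sum, Complex.im_sum]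
  refine Finset.sum_congr rfl fun j _ => ?_
  simp
  ring

/-- The basis vectors of `V ≅ ℝⁿ`. -/
def e (j : Fin n) : E := c.toEquiv.symm (Pi.single j 1)

/-- The unitary matrix `W` with `L = {z | z = W z̄}`. -/
def souriau (L : Submodule ℝ E) : Fin n → Fin n → ℂ :=
  fun i j => c.toEquiv ((2 : ℝ) • proj L (c.e j) - c.e j) i

/-- Since `ω v w = ⟪J v, w⟫`, being Lagrangian says that `J` exchanges `L` and `Lᗮ`; hence `P J = J
(1 - P)`. -/
lemma proj_J {L : Submodule ℝ E} (hL : IsLagrangian ω L) (v : E) :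
    proj L (c.J v) = c.J v - c.J (proj L v) := by
  have key : ∀ x, x ∈ L ↔ c.J x ∈ Lᗮ := fun x => by
    rw [hL x, Submodule.mem_orthogonal']
    simp only [c.form_eq_inner_J]
  have h1 : proj L (c.J (proj L v)) = 0 := by
    have : c.J (proj L v) ∈ Lᗮ := (key _).1 (L.starProjection_apply_mem v)
    exact L.starProjection_apply_eq_zero_iff.mpr this
  have h2 : proj L (c.J (v - proj L v)) = c.J (v - proj L v) := by
    refine L.starProjection_eq_self_iff.mpr ?_
    rw [key, J_J]
    exact neg_mem (L.sub_starProjection_mem_orthogonal v)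
  rw [c.J_sub, map_sub, h1, sub_zero] at h2
  exact h2

lemma eq_sum (v : E) : v = ∑ j, ((c.toEquiv v j).re • c.e j + (c.toEquiv v j).im • c.J (c.e j)) := by
  apply c.toEquiv.injective
  ext i
  simp only [map_sum, map_add, map_smul, Finset.sum_apply, Pi.add_apply, Pi.smul_apply, e, J,
    LinearEquiv.apply_symm_apply]
  rw [Finset.sum_eq_single i]
  · apply Complex.ext <;> simp
  · intro j _ hj
    simp [hj.symm]
  · simp

/-- By `proj_J` the reflection `2P - 1` anticommutes with `J`. It is thus conjugate linear and
determined by its values on the real basis, which are the columns of `souriau`. -/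
lemma toEquiv_reflection {L : Submodule ℝ E} (hL : IsLagrangian ω L) (v : E) :
    c.toEquiv ((2 : ℝ) • proj L v - v) = (Matrix.of (c.souriau L)).mulVec (star (c.toEquiv v)) := by
  have hR : ∀ v, (2 : ℝ) • proj L (c.J v) - c.J v = - c.J ((2 : ℝ) • proj L v - v) := fun v => by
    rw [c.proj_J hL, c.J_sub, two_smul, two_smul, c.J_add]
    abel
  ext i
  conv_lhs => rw [c.eq_sum v]
  have : (2 : ℝ) • proj L (∑ j, ((c.toEquiv v j).re • c.e j + (c.toEquiv v j).im • c.J (c.e j)))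
      - (∑ j, ((c.toEquiv v j).re • c.e j + (c.toEquiv v j).im • c.J (c.e j)))
      = ∑ j, ((c.toEquiv v j).re • ((2 : ℝ) • proj L (c.e j) - c.e j)
        + (c.toEquiv v j).im • ((2 : ℝ) • proj L (c.J (c.e j)) - c.J (c.e j))) := by
    rw [map_sum, Finset.smul_sum, ← Finset.sum_sub_distrib]
    refine Finset.sum_congr rfl fun j _ => ?_
    simp only [map_add, map_smul]
    module
  rw [this, map_sum, Finset.sum_apply, Matrix.mulVec, dotProduct]
  refine Finset.sum_congr rfl fun j _ => ?_
  rw [hR, map_add, map_smul, map_smul, map_neg, Pi.add_apply, Pi.smul_apply, Pi.smul_apply,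
    Pi.neg_apply, toEquiv_J]
  simp only [souriau, Matrix.of_apply, Pi.star_apply]
  generalize c.toEquiv ((2 : ℝ) • proj L (c.e j) - c.e j) i = z
  apply Complex.ext <;> simp <;> ring

lemma toEquiv_e (j : Fin n) : c.toEquiv (c.e j) = Pi.single j 1 := by simp [e]

lemma star_toEquiv_e (j : Fin n) : star (c.toEquiv (c.e j)) = Pi.single j 1 := by
  rw [toEquiv_e, ← Pi.single_star, star_one]

/-- The reflection is an involution, which reads `W W̄ = 1`. Together with symmetry this is
unitarity. -/
lemma souriau_mul_conj {L : Submodule ℝ E} (hL : IsLagrangian ω L) :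
    ∀ i j, ∑ k, c.souriau L i k * star (c.souriau L k j) = if i = j then 1 else 0 := by
  have hP : ∀ v, proj L (proj L v) = proj L v := fun v =>
    L.starProjection_eq_self_iff.mpr (L.starProjection_apply_mem v)
  have h : ∀ v, c.toEquiv v = (Matrix.of (c.souriau L)).mulVec (star ((Matrix.of (c.souriau L)).mulVec
      (star (c.toEquiv v)))) := fun v => by
    rw [← c.toEquiv_reflection hL, ← c.toEquiv_reflection hL]
    congr 1
    rw [map_sub, map_smul, hP]
    module
  intro i j
  have := congrFun (h (c.e j)) i
  rw [star_toEquiv_e] at this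
  simp only [Matrix.mulVec_single, MulOpposite.op_one, one_smul] at this
  rw [toEquiv_e, Matrix.mulVec, dotProduct] at this
  simpa [Pi.single_apply] using this.symm

include c in
lemma form_antisymm (v w : E) : ω v w = -ω w v := by
  rw [c.form_eq, c.form_eq, Complex.im_sum, Complex.im_sum, ← Finset.sum_neg_distrib]
  refine Finset.sum_congr rfl fun j _ => ?_
  simp
  ring

lemma inner_e (i : Fin n) (v : E) : inner ℝ (c.e i) v = (c.toEquiv v i).re := by
  rw [c.inner_eq]
  have : ∀ j, star (c.toEquiv (c.e i) j) = (Pi.single i 1 : Fin n → ℂ) j :=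
    fun j => congrFun (c.star_toEquiv_e i) j
  simp [this, Pi.single_apply]

lemma form_e (i : Fin n) (v : E) : ω (c.e i) v = (c.toEquiv v i).im := by
  rw [c.form_eq]
  have : ∀ j, star (c.toEquiv (c.e i) j) = (Pi.single i 1 : Fin n → ℂ) j :=
    fun j => congrFun (c.star_toEquiv_e i) j
  simp [this, Pi.single_apply]

lemma inner_proj (L : Submodule ℝ E) (v w : E) : inner ℝ (proj L v) w = inner ℝ v (proj L w) :=
  L.inner_starProjection_left_eq_right v w

/-- The real parts are symmetric because `P` is self-adjoint. For the imaginary parts,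
self-adjointness is combined with `P J = J (1 - P)`. -/
lemma souriau_symm {L : Submodule ℝ E} (hL : IsLagrangian ω L) :
    ∀ i j, c.souriau L i j = c.souriau L j i := by
  intro i j
  apply Complex.ext
  · simp only [souriau]
    rw [← c.inner_e, ← c.inner_e, inner_sub_right, inner_sub_right, inner_smul_right,
      inner_smul_right, ← inner_proj, real_inner_comm, real_inner_comm (c.e i) (c.e j)]
  · simp only [souriau]
    rw [← c.form_e, ← c.form_e, map_sub, map_sub, map_smul, map_smul, c.form_antisymm (c.e i) (c.e j),
      c.form_eq_inner_J, c.form_eq_inner_J, c.form_eq_inner_J, ← inner_proj, c.proj_J hL,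
      inner_sub_left, ← c.form_eq_inner_J, ← c.form_eq_inner_J, ← c.form_eq_inner_J,
      c.form_antisymm (proj L _)]
    rw [c.form_antisymm (c.e j) (c.e i)]
    simp only [smul_eq_mul, c.form_eq_inner_J (c.e j)]
    ring

/-- The conjugate linear map `z ↦ w z̄`, as a function of `w`. -/
def reflection : (Fin n → Fin n → ℂ) →ₗ[ℝ] (E →L[ℝ] E) where
  toFun w := LinearMap.toContinuousLinearMap
    { toFun := fun v => c.toEquiv.symm ((Matrix.of w).mulVec (star (c.toEquiv v)))
      map_add' := fun v v' => by
        rw [map_add, star_add, Matrix.mulVec_add, map_add]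
      map_smul' := fun r v => by
        have : star (r • c.toEquiv v) = r • star (c.toEquiv v) := by
          ext j
          simp
        rw [map_smul, this, Matrix.mulVec_smul, map_smul, RingHom.id_apply] }
  map_add' w w' := by
    ext v
    simp [← Matrix.of_add_of, Matrix.add_mulVec]
  map_smul' r w := by
    ext v
    simp only [LinearMap.coe_toContinuousLinearMap', LinearMap.coe_mk, AddHom.coe_mk,
      RingHom.id_apply, smul_apply]
    rw [← Matrix.smul_of, Matrix.smul_mulVec, map_smul]

lemma toEquiv_reflection_apply (w : Fin n → Fin n → ℂ) (v : E) :
    c.toEquiv (c.reflection w v) = (Matrix.of w).mulVec (star (c.toEquiv v)) := by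
  simp [reflection]

/-- The subspace `{z | z = w z̄}`. -/
def ofSouriau (w : Fin n → Fin n → ℂ) : Submodule ℝ E :=
  LinearMap.eqLocus (c.reflection w).toLinearMap LinearMap.id

lemma mem_ofSouriau {w : Fin n → Fin n → ℂ} {v : E} :
    v ∈ c.ofSouriau w ↔ c.reflection w v = v := by
  simp [ofSouriau]

lemma ofSouriau_souriau {L : Submodule ℝ E} (hL : IsLagrangian ω L) :
    c.ofSouriau (c.souriau L) = L := by
  ext v
  have h := c.toEquiv_reflection hL v
  have h2 := c.toEquiv_reflection_apply (c.souriau L) v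
  rw [mem_ofSouriau, ← L.starProjection_eq_self_iff]
  have h3 : c.reflection (c.souriau L) v = (2 : ℝ) • proj L v - v := by
    apply c.toEquiv.injective
    rw [h, h2]
  rw [h3, sub_eq_iff_eq_add, ← two_smul ℝ v, smul_right_inj (two_ne_zero)]
  rfl

/-! ### From symmetric unitary matrices back to Lagrangian subspaces -/

section Construction

variable {w : Fin n → Fin n → ℂ} (hs : ∀ i j, w i j = w j i)
  (hu : ∀ i j, ∑ k, w i k * star (w k j) = if i = j then 1 else 0)

include hu in
lemma reflection_reflection (v : E) : c.reflection w (c.reflection w v) = v := by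
  apply c.toEquiv.injective
  have h1 : (Matrix.of w) * (Matrix.of w).map star = 1 := by
    ext i j
    simpa [Matrix.mul_apply, Matrix.one_apply] using hu i j
  have h2 : ∀ x, star ((Matrix.of w).mulVec (star x)) = ((Matrix.of w).map star).mulVec x :=
    fun x => by
      ext i
      simp [Matrix.mulVec, dotProduct]
  rw [toEquiv_reflection_apply, toEquiv_reflection_apply, h2, Matrix.mulVec_mulVec, h1,
    Matrix.one_mulVec]

include hs in
lemma inner_reflection (v v' : E) :
    inner ℝ (c.reflection w v) v' = inner ℝ v (c.reflection w v') := by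
  rw [c.inner_eq, c.inner_eq, toEquiv_reflection_apply, toEquiv_reflection_apply]
  simp only [Matrix.mulVec, dotProduct, Matrix.of_apply, Pi.star_apply, star_sum, star_mul',
    star_star, Finset.sum_mul, Finset.mul_sum]
  rw [Finset.sum_comm, Complex.re_sum, Complex.re_sum]
  refine Finset.sum_congr rfl fun i _ => ?_
  rw [Complex.re_sum, Complex.re_sum]
  refine Finset.sum_congr rfl fun j _ => ?_
  rw [hs i j]
  simp
  ring

lemma reflection_J (v : E) : c.reflection w (c.J v) = -c.J (c.reflection w v) := by
  apply c.toEquiv.injective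
  ext i
  rw [map_neg, Pi.neg_apply, toEquiv_J, toEquiv_reflection_apply, toEquiv_reflection_apply]
  simp only [Matrix.mulVec, dotProduct, Matrix.of_apply, Pi.star_apply, toEquiv_J, star_mul',
    Finset.mul_sum, ← Finset.sum_neg_distrib]
  refine Finset.sum_congr rfl fun j _ => ?_
  simp
  ring

-- A self-adjoint involution `R` has `(1 + R) / 2` as the orthogonal projection onto its fixed
-- space. Smoothness of `w` thereby passes to the projections.
include hs hu in
lemma proj_ofSouriau :
    proj (c.ofSouriau w) = (2⁻¹ : ℝ) • (ContinuousLinearMap.id ℝ E + c.reflection w) := by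
  ext v
  refine Submodule.eq_starProjection_of_mem_of_inner_eq_zero ?_ ?_
  · rw [mem_ofSouriau]
    simp [c.reflection_reflection hu, add_comm]
  · intro x hx
    rw [mem_ofSouriau] at hx
    have := c.inner_reflection hs v x
    rw [hx] at this
    simp only [smul_apply, add_apply,
      ContinuousLinearMap.id_apply, inner_sub_left, inner_smul_left, inner_add_left, this]
    simp
    ring

-- The reflection reverses the sign of `ω`, so `ω` vanishes on its fixed space. Maximality follows
-- by testing against the fixed vector `J x + R (J x)`.
include hs hu in
lemma isLagrangian_ofSouriau : IsLagrangian ω (c.ofSouriau w) := by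
  intro x
  constructor
  · intro hx y hy
    rw [mem_ofSouriau] at hx hy
    have h : ω x y = -ω x y := by
      conv_lhs => rw [← hx, ← hy]
      rw [c.form_eq_inner_J, c.form_eq_inner_J, ← c.inner_reflection hs, c.reflection_J,
        c.reflection_reflection hu, inner_neg_left]
    linarith
  · intro h
    -- The square norm of this vector is `2 ⟪J x, J x + R (J x)⟫ = 2 ω x (J x + R (J x)) = 0`, so `J
    -- x = -R (J x) = J (R x)`.
    have hy : c.J x + c.reflection w (c.J x) ∈ c.ofSouriau w := by
      rw [mem_ofSouriau, map_add, c.reflection_reflection hu, add_comm]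
    have h1 := h _ hy
    rw [c.form_eq_inner_J, inner_add_right] at h1
    have h2 : inner ℝ (c.J x + c.reflection w (c.J x)) (c.J x + c.reflection w (c.J x)) = 0 := by
      rw [inner_add_left, inner_add_right, inner_add_right, c.inner_reflection hs,
        c.inner_reflection hs, c.reflection_reflection hu]
      linarith
    rw [inner_self_eq_zero, c.reflection_J, ← sub_eq_add_neg, ← c.J_sub] at h2
    have h3 := congrArg c.J h2
    rw [c.J_J] at h3
    have h4 : c.J 0 = 0 := by
      apply c.toEquiv.injective
      ext j
      simp
    rw [h4, neg_eq_zero, sub_eq_zero] at h3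
    exact (c.mem_ofSouriau).2 h3.symm

include hs hu in
lemma souriau_ofSouriau : c.souriau (c.ofSouriau w) = w := by
  ext i j
  simp only [souriau, c.proj_ofSouriau hs hu]
  have : (2 : ℝ) • ((2⁻¹ : ℝ) • (ContinuousLinearMap.id ℝ E + c.reflection w)) (c.e j) - c.e j
      = c.reflection w (c.e j) := by
    simp
  rw [this, toEquiv_reflection_apply, star_toEquiv_e]
  simp

end Construction

/-- The entries of `souriau` as continuous affine functions of the projection. -/
def entry (i j : Fin n) : (E →L[ℝ] E) →L[ℝ] ℂ :=
  (LinearMap.toContinuousLinearMap ((LinearMap.proj i : (Fin n → ℂ) →ₗ[ℝ] ℂ) ∘ₗ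
    c.toEquiv.toLinearMap)) ∘L ContinuousLinearMap.apply ℝ E (c.e j)

lemma entry_apply (i j : Fin n) (P : E →L[ℝ] E) : c.entry i j P = c.toEquiv (P (c.e j)) i := by
  simp [entry]

lemma souriau_eq_entry (L : Submodule ℝ E) (i j : Fin n) :
    c.souriau L i j = 2 * c.entry i j (proj L) - c.toEquiv (c.e j) i := by
  simp [souriau, entry_apply]

/-- On the basis `W = 2P - 1`, so `W' = 2P'`; pairing with a real basis vector under `ω` extracts
the imaginary part. This is how crossing forms are read off from `W`. -/
lemma velocityForm_apply {Λ : ℝ → Submodule ℝ E} {a b t : ℝ} (hab : a < b) (ht : t ∈ Icc a b)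
    (hd : DifferentiableWithinAt ℝ (fun s => proj (Λ s)) (Icc a b) t) {w' : Fin n → Fin n → ℂ}
    (hw : ∀ i j, HasDerivWithinAt (fun s => c.souriau (Λ s) i j) (w' i j) (Icc a b) t)
    {v v' : E} (hv : v ∈ V) (hv' : v' ∈ V) :
    velocityForm ω Λ a b t v v'
      = 2⁻¹ * ∑ i, ∑ j, (c.toEquiv v i).re * (c.toEquiv v' j).re * (w' i j).im := by
  set P' := derivWithin (fun s => proj (Λ s)) (Icc a b) t with hP'
  have h1 : ∀ i j, w' i j = 2 * c.entry i j P' := fun i j => by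
    have h2 := ((((c.entry i j).hasFDerivAt.comp_hasDerivWithinAt t
      hd.hasDerivWithinAt).const_mul (2 : ℂ)).sub_const (c.toEquiv (c.e j) i))
    have h3 : HasDerivWithinAt (fun s => c.souriau (Λ s) i j) (2 * c.entry i j P') (Icc a b) t := by
      simp only [souriau_eq_entry]
      exact h2
    exact (uniqueDiffOn_Icc hab t ht).eq_deriv _ (hw i j) h3
  have hreal : ∀ v ∈ V, v = ∑ j, (c.toEquiv v j).re • c.e j := fun v hv => by
    conv_lhs => rw [c.eq_sum v]
    refine Finset.sum_congr rfl fun j _ => ?_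
    rw [(c.mem_iff v).1 hv j, zero_smul, add_zero]
  have h4 : velocityForm ω Λ a b t v v' = ω v (P' v') := rfl
  rw [h4, hreal v hv, hreal v' hv', map_sum, map_sum, LinearMap.sum_apply, Finset.mul_sum]
  have hV : ∀ x : Fin n → ℝ, ∀ i, (c.toEquiv (∑ j, x j • c.e j) i).re = x i := fun x i => by
    rw [map_sum, Finset.sum_apply]
    simp [toEquiv_e, Pi.single_apply]
  simp only [hV (fun j => (c.toEquiv v j).re), hV (fun j => (c.toEquiv v' j).re)]
  refine Finset.sum_congr rfl fun i _ => ?_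
  rw [map_sum, Finset.mul_sum]
  refine Finset.sum_congr rfl fun j _ => ?_
  rw [map_smul, map_smul, LinearMap.smul_apply, map_smul, c.form_e, h1, entry_apply]
  simp
  ring

end UnitaryCoordinates

end

/-! ### Step functions and the summation of jumps -/

noncomputable section

/-- The step function with value `k` at `2πk` and `k + 1/2` between `2πk` and `2π(k + 1)`. -/
def halfFloor (x : ℝ) : ℚ := ((⌊x / (2 * Real.pi)⌋ : ℚ) + (⌈x / (2 * Real.pi)⌉ : ℚ)) / 2

lemma halfFloor_of_eq {x : ℝ} (k : ℤ) (h : x = 2 * Real.pi * k) : halfFloor x = k := by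
  have : x / (2 * Real.pi) = k := by
    rw [h]
    field_simp
  simp [halfFloor, this]

lemma halfFloor_of_mem {x : ℝ} (k : ℤ) (h : x ∈ Ioo (2 * Real.pi * k) (2 * Real.pi * (k + 1))) :
    halfFloor x = k + 1 / 2 := by
  have hpi : 0 < 2 * Real.pi := Real.two_pi_pos
  have h1 : (k : ℝ) < x / (2 * Real.pi) := by
    rw [lt_div_iff₀ hpi]
    linarith [h.1]
  have h2 : x / (2 * Real.pi) < k + 1 := by
    rw [div_lt_iff₀ hpi]
    linarith [h.2]
  have h3 : ⌊x / (2 * Real.pi)⌋ = k := Int.floor_eq_iff.2 ⟨h1.le, h2⟩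
  have h4 : ⌈x / (2 * Real.pi)⌉ = k + 1 := Int.ceil_eq_iff.2 ⟨by push_cast; linarith, by
    push_cast; linarith⟩
  rw [halfFloor, h3, h4]
  push_cast
  ring

lemma halfFloor_add (x : ℝ) (k : ℤ) : halfFloor (x + 2 * Real.pi * k) = halfFloor x + k := by
  have : (x + 2 * Real.pi * k) / (2 * Real.pi) = x / (2 * Real.pi) + k := by
    have := Real.pi_ne_zero
    field_simp
  rw [halfFloor, halfFloor, this, Int.floor_add_intCast, Int.ceil_add_intCast]
  push_cast
  ring

lemma exists_mem_Ioo_two_pi {x : ℝ} (h : ∀ k : ℤ, x ≠ 2 * Real.pi * k) :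
    ∃ k : ℤ, x ∈ Ioo (2 * Real.pi * k) (2 * Real.pi * (k + 1)) := by
  have hpi : 0 < 2 * Real.pi := Real.two_pi_pos
  refine ⟨⌊x / (2 * Real.pi)⌋, lt_of_le_of_ne ?_ (h _).symm, ?_⟩
  · have := Int.floor_le (x / (2 * Real.pi))
    rw [le_div_iff₀ hpi] at this
    linarith
  · have := Int.lt_floor_add_one (x / (2 * Real.pi))
    rw [div_lt_iff₀ hpi] at this
    linarith

lemma eventually_halfFloor_eq {α : ℝ → ℝ} {S : Set ℝ} {t : ℝ} (hα : ContinuousWithinAt α S t)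
    (h : ∀ k : ℤ, α t ≠ 2 * Real.pi * k) :
    ∀ᶠ s in 𝓝[S] t, halfFloor (α s) = halfFloor (α t) := by
  obtain ⟨k, hk⟩ := exists_mem_Ioo_two_pi h
  filter_upwards [hα.eventually (isOpen_Ioo.mem_nhds hk)] with s hs
  rw [halfFloor_of_mem k hk, halfFloor_of_mem k hs]

/-- The sine of the half angle detects the side of `2πk` on a whole period in both directions. It is
used in place of `α - 2πk` because it is a factor of `exp (iα) - 1`. -/
lemma eventually_halfFloor_eq_sign {α : ℝ → ℝ} {S : Set ℝ} {t : ℝ}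
    (hα : ContinuousWithinAt α S t) (k : ℤ) (h : α t = 2 * Real.pi * k) :
    ∀ᶠ s in 𝓝[S] t, halfFloor (α s)
      = k + (SignType.sign (Real.sin ((α s - 2 * Real.pi * k) / 2)) : ℤ) / 2 := by
  have hpi : 0 < 2 * Real.pi := Real.two_pi_pos
  have hI : Ioo (α t - 2 * Real.pi) (α t + 2 * Real.pi) ∈ 𝓝 (α t) :=
    Ioo_mem_nhds (by linarith) (by linarith)
  filter_upwards [hα.eventually hI] with s hs
  rw [h] at hs
  rcases lt_trichotomy (α s) (2 * Real.pi * k) with h1 | h1 | h1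
  · have h2 : Real.sin ((α s - 2 * Real.pi * k) / 2) < 0 :=
      Real.sin_neg_of_neg_of_neg_pi_lt (by linarith) (by linarith [hs.1])
    rw [sign_neg h2, halfFloor_of_mem (k - 1) (by push_cast; constructor <;> linarith [hs.1])]
    push_cast [SignType.coe_one, SignType.coe_neg_one]
    ring
  · rw [halfFloor_of_eq k h1, h1]
    simp
  · have h2 : 0 < Real.sin ((α s - 2 * Real.pi * k) / 2) :=
      Real.sin_pos_of_pos_of_lt_pi (by linarith) (by linarith [hs.2])
    rw [sign_pos h2, halfFloor_of_mem k (by constructor <;> linarith [hs.2])]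
    push_cast [SignType.coe_one]
    ring

/-- A function that jumps by `½ σ` on both sides of every point, in the sense of crossing numbers. -/
def HasJumps (N : ℝ → ℚ) (σ : ℝ → ℤ) (a b : ℝ) : Prop :=
  ∀ t ∈ Icc a b, ∀ᶠ s in 𝓝[Icc a b] t, N s = N t + (SignType.sign (s - t) : ℤ) * σ t / 2

/-- On either side of `t` the function `N` is locally constant, which leaves no room for a jump at a
nearby `s ≠ t`. With compactness this makes the crossings finite in number. -/
lemma HasJumps.eventually_eq_zero {N : ℝ → ℚ} {σ : ℝ → ℤ} {a b : ℝ} (hab : a < b)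
    (h : HasJumps N σ a b) {t : ℝ} (ht : t ∈ Icc a b) :
    ∀ᶠ s in 𝓝[Icc a b \ {t}] t, σ s = 0 := by
  have h1 := eventually_eventually_nhdsWithin.2 (h t ht)
  have h2 : 𝓝[Icc a b \ {t}] t ≤ 𝓝[Icc a b] t := nhdsWithin_mono _ sdiff_subset
  filter_upwards [h2 h1, h2 (h t ht), self_mem_nhdsWithin] with s hs hs0 hsm
  have hst : s - t ≠ 0 := sub_ne_zero.2 hsm.2
  have h3 : ∀ᶠ r in 𝓝[Icc a b] s, SignType.sign (r - t) = SignType.sign (s - t) := by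
    refine nhdsWithin_le_nhds ?_
    have hc : Continuous fun r : ℝ => r - t := by fun_prop
    rcases lt_or_gt_of_ne hst with h4 | h4
    · filter_upwards [hc.continuousAt.eventually (gt_mem_nhds h4)] with r hr
      rw [sign_neg hr, sign_neg h4]
    · filter_upwards [hc.continuousAt.eventually (lt_mem_nhds h4)] with r hr
      rw [sign_pos hr, sign_pos h4]
  have h5 : ∀ᶠ r in 𝓝[Icc a b \ {s}] s, r ≠ s ∧ N r = N s ∧
      N r = N s + (SignType.sign (r - s) : ℤ) * σ s / 2 := by
    have h6 : 𝓝[Icc a b \ {s}] s ≤ 𝓝[Icc a b] s := nhdsWithin_mono _ sdiff_subset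
    filter_upwards [h6 hs, h6 h3, h6 (h s hsm.1), self_mem_nhdsWithin] with r h7 h8 h9 h10
    exact ⟨h10.2, by rw [h7, hs0, h8], h9⟩
  have hne : (𝓝[Icc a b \ {s}] s).NeBot := by
    have := (uniqueDiffOn_Icc hab s hsm.1).accPt
    rwa [accPt_principal_iff_nhdsWithin] at this
  obtain ⟨r, hr, h7, h8⟩ := h5.exists
  rw [h7] at h8
  have h9 : ((SignType.sign (r - s) : ℤ) : ℚ) * σ s = 0 := by linarith
  rcases mul_eq_zero.1 h9 with h10 | h10
  · exfalso
    rcases lt_or_gt_of_ne (sub_ne_zero.2 hr) with h4 | h4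
    · rw [sign_neg h4] at h10
      simp at h10
    · rw [sign_pos h4] at h10
      simp at h10
  · exact_mod_cast h10

lemma HasJumps.finite {N : ℝ → ℚ} {σ : ℝ → ℤ} {a b : ℝ} (hab : a < b) (h : HasJumps N σ a b) :
    {t ∈ Icc a b | σ t ≠ 0}.Finite := by
  by_contra hinf
  obtain ⟨t, ht, hacc⟩ := Set.Infinite.exists_accPt_of_subset_isCompact (K := Icc a b) hinf
    isCompact_Icc (fun x hx => hx.1)
  rw [accPt_principal_iff_nhdsWithin] at hacc
  have h1 : 𝓝[{t ∈ Icc a b | σ t ≠ 0} \ {t}] t ≤ 𝓝[Icc a b \ {t}] t :=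
    nhdsWithin_mono _ (sdiff_subset_sdiff_left fun x hx => hx.1)
  obtain ⟨s, hs, hs'⟩ := ((h.eventually_eq_zero hab ht).filter_mono h1 |>.and
    self_mem_nhdsWithin).exists
  exact hs'.1.2 hs

/-- An explicit step function with the same jumps differs from `N` by a constant. -/
lemma HasJumps.sub_eq {N : ℝ → ℚ} {σ : ℝ → ℤ} {a b : ℝ} (hab : a < b) (h : HasJumps N σ a b) :
    (σ a : ℚ) / 2 + ∑ᶠ t ∈ Ioo a b, (σ t : ℚ) + (σ b : ℚ) / 2 = N b - N a := by
  classical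
  set S := (h.finite hab).toFinset with hS
  have hmem : ∀ t, t ∈ S ↔ t ∈ Icc a b ∧ σ t ≠ 0 := fun t => by simp [hS]
  -- The model step function: `sign (c - t) σ / 2` has half jumps on both sides of `t`, exactly as
  -- `HasJumps` asks.
  let M : ℝ → ℚ := fun c => ∑ t ∈ S, (SignType.sign (c - t) : ℤ) * (σ t : ℚ) / 2
  have hM : ∀ t ∈ Icc a b, ∀ᶠ s in 𝓝[Icc a b] t,
      M s = M t + (SignType.sign (s - t) : ℤ) * σ t / 2 := by
    intro t ht
    have h1 : ∀ r ∈ S, ∀ᶠ s in 𝓝[Icc a b] t, (SignType.sign (s - r) : ℤ) * (σ r : ℚ) / 2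
        = (SignType.sign (t - r) : ℤ) * (σ r : ℚ) / 2
          + (if r = t then ((SignType.sign (s - t) : ℤ) : ℚ) * (σ t : ℚ) / 2 else 0 : ℚ) := by
      intro r _
      by_cases hrt : r = t
      · subst hrt
        simp
      · have hc : Continuous fun s : ℝ => s - r := by fun_prop
        refine nhdsWithin_le_nhds ?_
        rcases lt_or_gt_of_ne (sub_ne_zero.2 (Ne.symm hrt)) with h4 | h4
        · filter_upwards [hc.continuousAt.eventually (gt_mem_nhds h4)] with s hs
          rw [sign_neg hs, sign_neg h4, if_neg hrt, add_zero]
        · filter_upwards [hc.continuousAt.eventually (lt_mem_nhds h4)] with s hs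
          rw [sign_pos hs, sign_pos h4, if_neg hrt, add_zero]
    filter_upwards [(Filter.eventually_all_finset S).2 h1] with s hs
    simp only [M]
    rw [Finset.sum_congr rfl hs, Finset.sum_add_distrib, Finset.sum_ite_eq']
    congr 1
    split_ifs with htS
    · rfl
    · have : σ t = 0 := by
        by_contra h0
        exact htS ((hmem t).2 ⟨ht, h0⟩)
      simp [this]
  have hD : ∀ t ∈ Icc a b, ∀ᶠ s in 𝓝[Icc a b] t, N s - M s = N t - M t := fun t ht => by
    filter_upwards [h t ht, hM t ht] with s h1 h2
    rw [h1, h2]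
    ring
  -- `N - M` is locally constant on `[a, b]`; as a real function it has zero derivative, hence is
  -- constant.
  have hconst : N b - M b = N a - M a := by
    have h1 : ∀ t ∈ Icc a b, HasDerivWithinAt (fun s => ((N s - M s : ℚ) : ℝ)) 0 (Icc a b) t := by
      intro t ht
      refine (hasDerivWithinAt_const t (Icc a b) ((N t - M t : ℚ) : ℝ)).congr_of_eventuallyEq
        ?_ rfl
      filter_upwards [hD t ht] with s hs
      rw [hs]
    have h2 := constant_of_derivWithin_zero (f := fun s => ((N s - M s : ℚ) : ℝ)) (a := a) (b := b)
      (fun t ht => (h1 t ht).differentiableWithinAt) (fun t ht =>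
        (h1 t ⟨ht.1, ht.2.le⟩).derivWithin (uniqueDiffOn_Icc hab t ⟨ht.1, ht.2.le⟩)) b
      (right_mem_Icc.2 hab.le)
    exact_mod_cast h2
  have h3 : N b - N a = M b - M a := by linarith
  -- `sign (b - t) - sign (a - t)` is `2` inside the interval and `1` at either end, whence the
  -- weights of the crossing number.
  have h4 : M b - M a = ∑ t ∈ S, ((if t = a then (σ a : ℚ) / 2 else 0)
      + (if t ∈ Ioo a b then (σ t : ℚ) else 0) + (if t = b then (σ b : ℚ) / 2 else 0)) := by
    simp only [M]
    rw [← Finset.sum_sub_distrib]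
    refine Finset.sum_congr rfl fun t ht => ?_
    obtain ⟨ht, -⟩ := (hmem t).1 ht
    rcases eq_or_lt_of_le ht.1 with h5 | h5
    · subst h5
      simp [hab.ne, sign_pos (sub_pos.2 hab)]
    · rcases eq_or_lt_of_le ht.2 with h6 | h6
      · subst h6
        simp [hab.ne', sign_neg (sub_neg.2 hab)]
        ring
      · rw [if_neg h5.ne', if_neg h6.ne, if_pos ⟨h5, h6⟩, sign_pos (sub_pos.2 h6),
          sign_neg (sub_neg.2 h5)]
        push_cast [SignType.coe_one, SignType.coe_neg_one]
        ring
  rw [h3, h4, Finset.sum_add_distrib, Finset.sum_add_distrib, Finset.sum_ite_eq',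
    Finset.sum_ite_eq', ← Finset.sum_filter]
  have h5 : ∑ᶠ t ∈ Ioo a b, (σ t : ℚ) = ∑ t ∈ S with t ∈ Ioo a b, (σ t : ℚ) := by
    refine finsum_mem_eq_sum_of_inter_support_eq _ ?_
    ext t
    simp only [mem_inter_iff, Function.mem_support, ne_eq, Int.cast_eq_zero, Finset.coe_filter,
      mem_ofPred_eq, hmem]
    exact ⟨fun h => ⟨⟨⟨Ioo_subset_Icc_self h.1, h.2⟩, h.1⟩, h.2⟩, fun h => ⟨h.1.2, h.2⟩⟩
  have h6 : ∀ t ∈ Icc a b, (if t ∈ S then (σ t : ℚ) / 2 else 0) = (σ t : ℚ) / 2 := by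
    intro t ht
    split_ifs with h7
    · rfl
    · have : σ t = 0 := by
        by_contra h0
        exact h7 ((hmem t).2 ⟨ht, h0⟩)
      simp [this]
  rw [h5, h6 a (left_mem_Icc.2 hab.le), h6 b (right_mem_Icc.2 hab.le)]

/-! ### Signatures of real quadratic forms -/

section Signature

variable {M : Type*} [AddCommGroup M] [Module ℝ M] [FiniteDimensional ℝ M] {Q : QuadraticForm ℝ M}

lemma one_le_sigPos {v : M} (hv : 0 < Q v) : 1 ≤ sigPos Q := by
  have hv0 : v ≠ 0 := by
    rintro rfl
    simp at hv
  rw [← finrank_span_singleton (K := ℝ) hv0]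
  refine le_sigPos_of_posDef Q ?_
  rintro ⟨x, hx⟩ hx0
  obtain ⟨r, rfl⟩ := Submodule.mem_span_singleton.1 hx
  have hr : r ≠ 0 := by
    rintro rfl
    simp at hx0
  change 0 < Q (r • v)
  rw [QuadraticMap.map_smul, smul_eq_mul]
  exact mul_pos (mul_self_pos.2 hr) hv

lemma one_le_sigNeg {v : M} (hv : Q v < 0) : 1 ≤ sigNeg Q := by
  rw [← sigPos_neg]
  exact one_le_sigPos (v := v) (by simpa using hv)

lemma sigPos_add_sigNeg (h : Q.Nondegenerate) : sigPos Q + sigNeg Q = Module.finrank ℝ M := by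
  have := QuadraticForm.sigPos_add_sigNeg_add_radical (Q := Q)
  rw [h.radical_eq_bot, finrank_bot] at this
  exact this

lemma signature_of_finrank_zero (h : Module.finrank ℝ M = 0) : signature Q = 0 := by
  have h1 := sigPos_le_finrank Q
  have h2 := sigPos_le_finrank (-Q)
  rw [sigPos_neg] at h2
  rw [signature]
  omega

lemma signature_of_finrank_one (h : Module.finrank ℝ M = 1) (hQ : Q.Nondegenerate) {v : M}
    (hv : v ≠ 0) : Q v ≠ 0 ∧ signature Q = SignType.sign (Q v) := by
  have h1 := sigPos_add_sigNeg hQ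
  rw [signature]
  rcases lt_trichotomy (Q v) 0 with h2 | h2 | h2
  · have := one_le_sigNeg h2
    rw [sign_neg h2]
    refine ⟨h2.ne, ?_⟩
    simp only [SignType.coe_neg_one]
    omega
  · exfalso
    have hz : ∀ x, Q x = 0 := fun x => by
      obtain ⟨r, rfl⟩ := (finrank_eq_one_iff_of_nonzero' v hv).1 h x
      rw [QuadraticMap.map_smul, h2, smul_zero]
    have h3 : v ∈ Q.radical := by
      rw [QuadraticMap.mem_radical_iff']
      exact ⟨h2, fun x => by rw [hz, hz]⟩
    rw [hQ.radical_eq_bot] at h3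
    exact hv (by simpa using h3)
  · have := one_le_sigPos h2
    rw [sign_pos h2]
    refine ⟨h2.ne', ?_⟩
    simp only [SignType.coe_one]
    omega

lemma sigPos_of_posDef (h : ∀ v, v ≠ 0 → 0 < Q v) : sigPos Q = Module.finrank ℝ M := by
  refine le_antisymm (sigPos_le_finrank Q) ?_
  rw [← finrank_top ℝ M]
  refine le_sigPos_of_posDef Q fun x hx => h x ?_
  simpa using hx

end Signature

end

/-! ### Local behaviour of eigenangles at a crossing -/

noncomputable section

lemma eventually_sign_eq_of_hasDerivWithinAt {f : ℝ → ℝ} {g : ℝ} {S : Set ℝ} {t : ℝ}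
    (h : HasDerivWithinAt f g S t) (h0 : f t = 0) (hg : g ≠ 0) :
    ∀ᶠ s in 𝓝[S] t, SignType.sign (f s) = SignType.sign (s - t) * SignType.sign g := by
  have h1 := hasDerivWithinAt_iff_tendsto_slope.1 h
  have h2 : ∀ᶠ r in 𝓝 g, SignType.sign r = SignType.sign g := by
    rcases lt_or_gt_of_ne hg with h4 | h4
    · filter_upwards [gt_mem_nhds h4] with r hr
      rw [sign_neg hr, sign_neg h4]
    · filter_upwards [lt_mem_nhds h4] with r hr
      rw [sign_pos hr, sign_pos h4]
  have h3 := h1.eventually h2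
  rw [eventually_nhdsWithin_iff] at h3 ⊢
  filter_upwards [h3] with s hs hsS
  by_cases hst : s = t
  · simp [hst, h0]
  · rw [← hs ⟨hsS, hst⟩, ← sign_mul, slope_def_field, h0, sub_zero,
      mul_div_cancel₀ _ (sub_ne_zero.2 hst)]

lemma sin_sub_two_pi_mul (x : ℝ) (k : ℤ) : Real.sin (x - 2 * Real.pi * k) = Real.sin x := by
  rw [show x - 2 * Real.pi * k = x - k * (2 * Real.pi) by ring, Real.sin_sub_int_mul_two_pi]

lemma cexp_sub_two_pi_mul (x : ℝ) (k : ℤ) :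
    Complex.exp (((x - 2 * Real.pi * k : ℝ) : ℂ) * Complex.I) = Complex.exp (x * Complex.I) := by
  rw [Complex.exp_eq_exp_iff_exists_int]
  refine ⟨-k, ?_⟩
  push_cast
  ring

lemma cexp_eq_one_iff (x : ℝ) :
    Complex.exp (x * Complex.I) = 1 ↔ ∃ k : ℤ, x = 2 * Real.pi * k := by
  rw [Complex.exp_eq_one_iff]
  refine exists_congr fun k => ?_
  rw [← mul_assoc, mul_left_inj' Complex.I_ne_zero, mul_comm]
  exact_mod_cast Iff.rfl

lemma eventually_cos_half_pos {α : ℝ → ℝ} {S : Set ℝ} {t : ℝ} (hα : ContinuousWithinAt α S t)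
    (k : ℤ) (h : α t = 2 * Real.pi * k) :
    ∀ᶠ s in 𝓝[S] t, 0 < Real.cos ((α s - 2 * Real.pi * k) / 2) := by
  have hc : ContinuousWithinAt (fun s => Real.cos ((α s - 2 * Real.pi * k) / 2)) S t := by
    fun_prop
  refine hc.eventually (lt_mem_nhds ?_)
  simp [h]

/-- The angle is only known to be continuous, so the derivative is taken of `exp (iα)`, whose
imaginary part `sin α` is the half-angle sine times a positive factor. -/
lemma eventually_sign_sin_half {α : ℝ → ℝ} {S : Set ℝ} {t g : ℝ} (hα : ContinuousWithinAt α S t)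
    (k : ℤ) (h : α t = 2 * Real.pi * k) (hg : g ≠ 0)
    (hd : HasDerivWithinAt (fun s => Complex.exp (α s * Complex.I)) (g * Complex.I) S t) :
    ∀ᶠ s in 𝓝[S] t, SignType.sign (Real.sin ((α s - 2 * Real.pi * k) / 2))
      = SignType.sign (s - t) * SignType.sign g := by
  have h1 : HasDerivWithinAt (fun s => Real.sin (α s)) g S t := by
    have := Complex.imCLM.hasFDerivAt.comp_hasDerivWithinAt t hd
    have h2 : Complex.imCLM ∘ (fun s => Complex.exp (α s * Complex.I))
        = fun s => Real.sin (α s) := by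
      ext s
      simp [Complex.exp_ofReal_mul_I_im]
    rw [h2] at this
    simpa using this
  have h0 : Real.sin (α t) = 0 := by
    rw [← sin_sub_two_pi_mul _ k, h, sub_self, Real.sin_zero]
  filter_upwards [eventually_sign_eq_of_hasDerivWithinAt h1 h0 hg,
    eventually_cos_half_pos hα k h] with s hs hc
  have h3 : Real.sin (α s) = Real.sin ((α s - 2 * Real.pi * k) / 2)
      * (2 * Real.cos ((α s - 2 * Real.pi * k) / 2)) := by
    rw [← sin_sub_two_pi_mul _ k, show α s - 2 * Real.pi * k
      = 2 * ((α s - 2 * Real.pi * k) / 2) by ring, Real.sin_two_mul]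
    ring_nf
  rw [← hs, h3, sign_mul, sign_pos (mul_pos two_pos hc), mul_one]

/-- For a simple crossing of a `2 × 2` matrix only the product `χ` is known to be differentiable. As
`χ` vanishes at `t`, dividing its slope by the continuous nonzero factor `exp (iβ) - 1` recovers the
derivative of `exp (iα)`. -/
lemma eventually_sign_sin_half_of_mul {α β : ℝ → ℝ} {χ : ℝ → ℂ} {S : Set ℝ} {t g : ℝ}
    (ht : t ∈ S)
    (hα : ContinuousWithinAt α S t) (hβ : ContinuousWithinAt β S t)
    (k : ℤ) (h : α t = 2 * Real.pi * k) (hβt : ∀ k : ℤ, β t ≠ 2 * Real.pi * k) (hg : g ≠ 0)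
    (hχ : ∀ s ∈ S, χ s
      = (Complex.exp (α s * Complex.I) - 1) * (Complex.exp (β s * Complex.I) - 1))
    (hd : HasDerivWithinAt χ ((Complex.exp (β t * Complex.I) - 1) * (g * Complex.I)) S t) :
    ∀ᶠ s in 𝓝[S] t, SignType.sign (Real.sin ((α s - 2 * Real.pi * k) / 2))
      = SignType.sign (s - t) * SignType.sign g := by
  refine eventually_sign_sin_half hα k h hg ?_
  set B : ℝ → ℂ := fun s => Complex.exp (β s * Complex.I) - 1 with hB
  have hBt : B t ≠ 0 := by
    rw [hB]
    intro h0
    obtain ⟨m, hm⟩ := (cexp_eq_one_iff _).1 (sub_eq_zero.1 h0)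
    exact hβt m hm
  have hBc : ContinuousWithinAt B S t := by fun_prop
  have hA0 : Complex.exp (α t * Complex.I) = 1 := (cexp_eq_one_iff _).2 ⟨k, h⟩
  have hχ0 : χ t = 0 := by rw [hχ t ht, hA0]; ring
  rw [hasDerivWithinAt_iff_tendsto_slope] at hd ⊢
  have hB' : Tendsto B (𝓝[S \ {t}] t) (𝓝 (B t)) := hBc.mono sdiff_subset
  have h1 := hd.div hB' hBt
  rw [mul_div_cancel_left₀ _ hBt] at h1
  refine h1.congr' ?_
  filter_upwards [hB'.eventually_ne hBt, self_mem_nhdsWithin] with s hs hsS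
  simp only [Pi.div_apply, slope, vsub_eq_sub]
  rw [hχ0, hA0, sub_zero, hχ s hsS.1]
  change ((s - t)⁻¹ • (_ * B s)) / B s = _
  rw [smul_div_assoc, mul_div_cancel_right₀ _ hs]

lemma cexp_sub_one (x : ℝ) : Complex.exp (x * Complex.I) - 1
    = 2 * Complex.I * Real.sin (x / 2) * Complex.exp ((x / 2 : ℝ) * Complex.I) := by
  rw [Complex.exp_mul_I, Complex.exp_mul_I, ← Complex.ofReal_cos, ← Complex.ofReal_sin,
    ← Complex.ofReal_cos, ← Complex.ofReal_sin]
  have h1 : Real.sin x = 2 * Real.sin (x / 2) * Real.cos (x / 2) := by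
    rw [← Real.sin_two_mul]
    ring_nf
  have h2 : Real.cos x = 1 - 2 * Real.sin (x / 2) ^ 2 := by
    have := Real.cos_sq' (x / 2)
    have h3 := Real.cos_two_mul (x / 2)
    rw [show 2 * (x / 2) = x by ring] at h3
    rw [h3, this]
    ring
  rw [h1, h2]
  push_cast
  linear_combination (-2 * Complex.sin (x / 2) ^ 2) * Complex.I_sq

/-- The signs of two eigenangles near a common crossing, from the determinant `D` and the trace `T`
of the crossing form. -/
lemma eventually_sign_add_sign {α β : ℝ → ℝ} {χ δ : ℝ → ℂ} {S : Set ℝ} {t D T : ℝ}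
    (ht : t ∈ S)
    (hα : ContinuousWithinAt α S t) (hβ : ContinuousWithinAt β S t)
    (k l : ℤ) (hk : α t = 2 * Real.pi * k) (hl : β t = 2 * Real.pi * l)
    (hχ : ∀ s ∈ S, χ s
      = (Complex.exp (α s * Complex.I) - 1) * (Complex.exp (β s * Complex.I) - 1))
    (hδ : ∀ s ∈ S, δ s = Complex.exp (α s * Complex.I) * Complex.exp (β s * Complex.I))
    (hD : Tendsto (fun s => χ s / ((s - t : ℝ) : ℂ) ^ 2) (𝓝[S \ {t}] t) (𝓝 (-(D : ℂ))))
    (hT : HasDerivWithinAt δ (T * Complex.I) S t) (hD0 : D ≠ 0) (hT0 : 0 < D → T ≠ 0) :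
    ∀ᶠ s in 𝓝[S] t, (SignType.sign (Real.sin ((α s - 2 * Real.pi * k) / 2)) : ℤ)
      + (SignType.sign (Real.sin ((β s - 2 * Real.pi * l) / 2)) : ℤ)
      = (SignType.sign (s - t) : ℤ) * (if 0 < D then 2 * (SignType.sign T : ℤ) else 0) := by
  set x : ℝ → ℝ := fun s => (α s - 2 * Real.pi * k) / 2 with hx
  set y : ℝ → ℝ := fun s => (β s - 2 * Real.pi * l) / 2 with hy
  have hxc : ContinuousWithinAt x S t := by fun_prop
  have hyc : ContinuousWithinAt y S t := by fun_prop
  have hxt : x t = 0 := by simp [hx, hk]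
  have hyt : y t = 0 := by simp [hy, hl]
  have heα : ∀ s, Complex.exp (α s * Complex.I) = Complex.exp ((2 * x s : ℝ) * Complex.I) :=
    fun s => by rw [← cexp_sub_two_pi_mul _ k]; congr 3; simp only [hx]; ring
  have heβ : ∀ s, Complex.exp (β s * Complex.I) = Complex.exp ((2 * y s : ℝ) * Complex.I) :=
    fun s => by rw [← cexp_sub_two_pi_mul _ l]; congr 3; simp only [hy]; ring
  -- Each factor of `χ` is `2i sin` of the half angle times a phase; removing the phases leaves a
  -- real product of sines, whose sign will be that of `D`.
  have h1 : ∀ s ∈ S, -χ s * Complex.exp (-((x s + y s : ℝ) * Complex.I))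
      = ((4 * (Real.sin (x s) * Real.sin (y s)) : ℝ) : ℂ) := fun s hs => by
    rw [hχ s hs, heα, heβ, cexp_sub_one, cexp_sub_one, mul_div_cancel_left₀ _ two_ne_zero,
      mul_div_cancel_left₀ _ two_ne_zero, Complex.exp_neg]
    have h2 : Complex.exp ((x s + y s : ℝ) * Complex.I)
        = Complex.exp ((x s : ℝ) * Complex.I) * Complex.exp ((y s : ℝ) * Complex.I) := by
      rw [← Complex.exp_add]
      push_cast
      ring_nf
    rw [h2]
    have h3 := Complex.exp_ne_zero ((x s : ℝ) * Complex.I)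
    have h4 := Complex.exp_ne_zero ((y s : ℝ) * Complex.I)
    field_simp
    push_cast
    linear_combination (-4 * Complex.sin (x s) * Complex.sin (y s)) * Complex.I_sq
  have h2 : Tendsto (fun s => 4 * (Real.sin (x s) * Real.sin (y s)) / (s - t) ^ 2)
      (𝓝[S \ {t}] t) (𝓝 D) := by
    have h3 : Tendsto (fun s => Complex.exp (-((x s + y s : ℝ) * Complex.I))) (𝓝[S \ {t}] t)
        (𝓝 1) := by
      have : ContinuousWithinAt (fun s => Complex.exp (-((x s + y s : ℝ) * Complex.I))) S t := by
        fun_prop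
      have h4 := this.mono (sdiff_subset (t := {t}))
      rw [ContinuousWithinAt, hxt, hyt] at h4
      simpa using h4
    have h4 := (hD.neg.mul h3)
    rw [neg_neg, mul_one] at h4
    have h5 := (Complex.continuous_re.tendsto _).comp h4
    rw [Complex.ofReal_re] at h5
    refine h5.congr' ?_
    filter_upwards [self_mem_nhdsWithin] with s hs
    simp only [Function.comp_apply]
    rw [← neg_div, div_mul_eq_mul_div, h1 s hs.1, ← Complex.ofReal_pow, ← Complex.ofReal_div,
      Complex.ofReal_re]
  -- The argument of `δ` is `2x + 2y` modulo `2π`, and it moves with speed `T`. The case `T = 0` is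
  -- left open since it can only occur for `D < 0`, where the sum of the angles is not needed.
  have h3 : ∀ᶠ s in 𝓝[S] t, SignType.sign (Real.sin (2 * x s + 2 * y s))
      = SignType.sign (s - t) * SignType.sign T ∨ T = 0 := by
    by_cases hT' : T = 0
    · simp [hT']
    have h4 : HasDerivWithinAt (fun s => Real.sin (2 * x s + 2 * y s)) T S t := by
      have := Complex.imCLM.hasFDerivAt.comp_hasDerivWithinAt t hT
      have h5 := this.congr (f₁ := fun s => Real.sin (2 * x s + 2 * y s)) (fun s hs => ?_) ?_
      · simpa using h5
      all_goals
        simp only [Function.comp_apply]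
        rw [hδ _ (by assumption), heα, heβ, ← Complex.exp_add, ← add_mul, ← Complex.ofReal_add,
          Complex.imCLM_apply, Complex.exp_ofReal_mul_I_im]
    filter_upwards [eventually_sign_eq_of_hasDerivWithinAt h4 (by simp [hxt, hyt]) hT'] with s hs
    exact Or.inl hs
  have hsmall : ∀ z : ℝ → ℝ, ContinuousWithinAt z S t → z t = 0 →
      ∀ᶠ s in 𝓝[S] t, z s ∈ Ioo (-(Real.pi / 4)) (Real.pi / 4) := fun z hz h0 => by
    refine hz.eventually (isOpen_Ioo.mem_nhds ?_)
    rw [h0]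
    constructor <;> linarith [Real.pi_pos]
  have h5 : ∀ᶠ s in 𝓝[S] t, s ≠ t →
      SignType.sign (Real.sin (x s) * Real.sin (y s)) = SignType.sign D := by
    have h6 : ∀ᶠ r in 𝓝 D, SignType.sign r = SignType.sign D := by
      rcases lt_or_gt_of_ne hD0 with h4 | h4
      · filter_upwards [gt_mem_nhds h4] with r hr
        rw [sign_neg hr, sign_neg h4]
      · filter_upwards [lt_mem_nhds h4] with r hr
        rw [sign_pos hr, sign_pos h4]
    have h7 := h2.eventually h6
    rw [eventually_nhdsWithin_iff] at h7 ⊢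
    filter_upwards [h7] with s hs hsS hst
    rw [← hs ⟨hsS, hst⟩]
    have h8 : 0 < (s - t) ^ 2 := by
      have := sub_ne_zero.2 hst
      positivity
    have h9 : 4 * (Real.sin (x s) * Real.sin (y s)) / (s - t) ^ 2
        = (Real.sin (x s) * Real.sin (y s)) * (4 / (s - t) ^ 2) := by ring
    rw [h9, sign_mul (Real.sin (x s) * Real.sin (y s)), sign_pos (a := 4 / (s - t) ^ 2)
      (by positivity), mul_one]
  have hsgn : ∀ z : ℝ, z ∈ Ioo (-(Real.pi / 4)) (Real.pi / 4) →
      SignType.sign (Real.sin z) = SignType.sign z := fun z hz => by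
    rcases lt_trichotomy z 0 with h | h | h
    · rw [sign_neg h, sign_neg (Real.sin_neg_of_neg_of_neg_pi_lt h (by linarith [hz.1,
        Real.pi_pos]))]
    · simp [h]
    · rw [sign_pos h, sign_pos (Real.sin_pos_of_pos_of_lt_pi h (by linarith [hz.2,
        Real.pi_pos]))]
  filter_upwards [h3, h5, hsmall x hxc hxt, hsmall y hyc hyt] with s hs3 hs5 hsx hsy
  by_cases hst : s = t
  · subst hst
    simp [hk, hl]
  have hs6 := hs5 hst
  rw [sign_mul] at hs6
  rw [hsgn _ hsx, hsgn _ hsy] at hs6 ⊢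
  -- For `D > 0` the half angles have a common sign, which is that of their sum; for `D < 0` their
  -- signs are opposite and cancel.
  split_ifs with hDp
  · have hs7 : SignType.sign (2 * x s + 2 * y s) = SignType.sign (s - t) * SignType.sign T := by
      have := hs3.resolve_right (hT0 hDp)
      rw [← this]
      rcases lt_trichotomy (2 * x s + 2 * y s) 0 with h | h | h
      · rw [sign_neg h, sign_neg (Real.sin_neg_of_neg_of_neg_pi_lt h (by linarith [hsx.1, hsy.1]))]
      · simp [h]
      · rw [sign_pos h, sign_pos (Real.sin_pos_of_pos_of_lt_pi h (by linarith [hsx.2, hsy.2]))]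
    rw [sign_pos hDp] at hs6
    have h8 : ((SignType.sign (s - t) : ℤ)) * (2 * (SignType.sign T : ℤ))
        = 2 * ((SignType.sign (s - t) * SignType.sign T : SignType) : ℤ) := by
      rw [SignType.coe_mul]
      ring
    rw [h8, ← hs7]
    rcases lt_trichotomy (x s) 0 with hx0 | hx0 | hx0 <;>
      rcases lt_trichotomy (y s) 0 with hy0 | hy0 | hy0
    · rw [sign_neg hx0, sign_neg hy0, sign_neg (by linarith)]; rfl
    · rw [hy0] at hs6; simp at hs6
    · rw [sign_neg hx0, sign_pos hy0] at hs6; simp at hs6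
    · rw [hx0] at hs6; simp at hs6
    · rw [hx0] at hs6; simp at hs6
    · rw [hx0] at hs6; simp at hs6
    · rw [sign_pos hx0, sign_neg hy0] at hs6; simp at hs6
    · rw [hy0] at hs6; simp at hs6
    · rw [sign_pos hx0, sign_pos hy0, sign_pos (by linarith)]; rfl
  · rw [sign_neg (lt_of_le_of_ne (not_lt.1 hDp) hD0)] at hs6
    rw [mul_zero]
    revert hs6
    generalize SignType.sign (x s) = u
    generalize SignType.sign (y s) = v
    revert u v
    decide

end

/-! ### Crossings as real fixed vectors; the jumps for Lagrangian lines -/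

noncomputable section

/-- The `exp (i α j)` are the eigenvalues of `w`, with multiplicities. -/
def IsEigenangles {n : ℕ} (w : Fin n → Fin n → ℂ) (α : Fin n → ℝ) : Prop :=
  ∀ z : ℂ, (z • (1 : Matrix (Fin n) (Fin n) ℂ) - Matrix.of w).det
    = ∏ j, (z - Complex.exp (α j * Complex.I))

variable {E : Type*} [NormedAddCommGroup E] [InnerProductSpace ℝ E] [FiniteDimensional ℝ E]

namespace UnitaryCoordinates

variable {ω : LinearMap.BilinForm ℝ E} {V : Submodule ℝ E} {n : ℕ}
  (c : UnitaryCoordinates ω V n)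

lemma toEquiv_eq_ofReal {v : E} (hv : v ∈ V) (j : Fin n) :
    c.toEquiv v j = ((c.toEquiv v j).re : ℂ) := by
  apply Complex.ext
  · simp
  · simp [(c.mem_iff v).1 hv j]

lemma mem_inf_iff {L : Submodule ℝ E} (hL : IsLagrangian ω L) {v : E} (hv : v ∈ V) :
    v ∈ L ⊓ V ↔ ∀ i, ∑ j, c.souriau L i j * ((c.toEquiv v j).re : ℂ) = ((c.toEquiv v i).re : ℂ) := by
  have h1 : v ∈ L ↔ c.reflection (c.souriau L) v = v := by
    rw [← c.mem_ofSouriau, c.ofSouriau_souriau hL]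
  rw [Submodule.mem_inf, and_iff_left hv, h1, ← c.toEquiv.injective.eq_iff,
    toEquiv_reflection_apply, funext_iff]
  refine forall_congr' fun i => ?_
  rw [← c.toEquiv_eq_ofReal hv i]
  have h2 : ∀ j, star (c.toEquiv v) j = ((c.toEquiv v j).re : ℂ) := fun j => by
    rw [Pi.star_apply]
    conv_lhs => rw [c.toEquiv_eq_ofReal hv j]
    simp
  simp [Matrix.mulVec, dotProduct, h2]

/-- The vector of `V` with real coordinates `x`. -/
def ofReal (x : Fin n → ℝ) : E := c.toEquiv.symm (fun j => (x j : ℂ))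

lemma toEquiv_ofReal (x : Fin n → ℝ) (j : Fin n) : c.toEquiv (c.ofReal x) j = x j := by
  simp [ofReal]

lemma ofReal_mem (x : Fin n → ℝ) : c.ofReal x ∈ V := by
  rw [c.mem_iff]
  simp [toEquiv_ofReal]

/-- Because `W W̄ = 1`, the fixed space of `W` is stable under complex conjugation. A fixed `z ≠ 0`
thus yields a real one: `z + z̄`, or `i (z - z̄)` when the former vanishes. -/
lemma exists_mem_inf_of_det {L : Submodule ℝ E} (hL : IsLagrangian ω L)
    (h : (1 - Matrix.of (c.souriau L)).det = 0) : ∃ v ∈ L ⊓ V, v ≠ 0 := by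
  obtain ⟨z, hz, h1⟩ := Matrix.exists_mulVec_eq_zero_iff.2 h
  rw [Matrix.sub_mulVec, Matrix.one_mulVec, sub_eq_zero] at h1
  have h2 : (Matrix.of (c.souriau L)).mulVec (star z) = star z := by
    have h3 : star z = ((Matrix.of (c.souriau L)).map star).mulVec (star z) := by
      conv_lhs => rw [h1]
      ext i
      simp [Matrix.mulVec, dotProduct]
    have h4 : (Matrix.of (c.souriau L)) * (Matrix.of (c.souriau L)).map star = 1 := by
      ext i j
      simpa [Matrix.mul_apply, Matrix.one_apply] using c.souriau_mul_conj hL i j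
    conv_lhs => rw [h3]
    rw [Matrix.mulVec_mulVec, h4, Matrix.one_mulVec]
  have key : ∀ u : Fin n → ℂ, star u = u → (Matrix.of (c.souriau L)).mulVec u = u →
      c.toEquiv.symm u ∈ L ⊓ V := fun u hu hw => by
    refine ⟨?_, ?_⟩
    · change c.toEquiv.symm u ∈ L
      rw [← c.ofSouriau_souriau hL, mem_ofSouriau]
      apply c.toEquiv.injective
      rw [toEquiv_reflection_apply, LinearEquiv.apply_symm_apply, hu, hw]
    · change c.toEquiv.symm u ∈ V
      rw [c.mem_iff]
      intro j
      rw [LinearEquiv.apply_symm_apply]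
      exact Complex.conj_eq_iff_im.1 (congrFun hu j)
  by_cases h5 : z + star z = 0
  · refine ⟨_, key (Complex.I • (z - star z)) ?_ ?_, ?_⟩
    · ext j
      simp
      ring
    · rw [Matrix.mulVec_smul, Matrix.mulVec_sub, ← h1, h2]
    · rw [Ne, LinearEquiv.map_eq_zero_iff, smul_eq_zero, not_or]
      refine ⟨Complex.I_ne_zero, fun h6 => hz ?_⟩
      have : (2 : ℂ) • z = 0 := by
        rw [two_smul]
        calc z + z = (z + star z) + (z - star z) := by abel
          _ = 0 := by rw [h5, h6, add_zero]
      simpa using this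
  · refine ⟨_, key (z + star z) ?_ ?_, ?_⟩
    · rw [star_add, star_star, add_comm]
    · rw [Matrix.mulVec_add, ← h1, h2]
    · rwa [Ne, LinearEquiv.map_eq_zero_iff]

/-- The real coordinates on `V`. -/
def realEquiv : V ≃ₗ[ℝ] (Fin n → ℝ) where
  toFun v j := (c.toEquiv v j).re
  map_add' v v' := by
    ext j
    simp
  map_smul' r v := by
    ext j
    simp
  invFun x := ⟨c.ofReal x, c.ofReal_mem x⟩
  left_inv v := by
    apply Subtype.ext
    apply c.toEquiv.injective
    ext j
    rw [toEquiv_ofReal, ← c.toEquiv_eq_ofReal v.2]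
  right_inv x := by
    ext j
    simp [toEquiv_ofReal]

include c in
lemma finrank_V : Module.finrank ℝ V = n := by
  rw [c.realEquiv.finrank_eq, Module.finrank_fin_fun]

lemma crossingForm_apply {Λ : ℝ → Submodule ℝ E} {a b t : ℝ} (hab : a < b) (ht : t ∈ Icc a b)
    (hd : DifferentiableWithinAt ℝ (fun s => proj (Λ s)) (Icc a b) t) {w' : Fin n → Fin n → ℂ}
    (hw : ∀ i j, HasDerivWithinAt (fun s => c.souriau (Λ s) i j) (w' i j) (Icc a b) t)
    (v : ↥(Λ t ⊓ V)) :
    crossingForm ω Λ V a b t v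
      = 2⁻¹ * ∑ i, ∑ j, (c.toEquiv v i).re * (c.toEquiv v j).re * (w' i j).im :=
  c.velocityForm_apply hab ht hd hw v.2.2 v.2.2

lemma hasDerivWithinAt_souriau {Λ : ℝ → Submodule ℝ E} {a b t : ℝ}
    (hd : DifferentiableWithinAt ℝ (fun s => proj (Λ s)) (Icc a b) t) (i j : Fin n) :
    ∃ w', HasDerivWithinAt (fun s => c.souriau (Λ s) i j) w' (Icc a b) t := by
  have h2 := ((((c.entry i j).hasFDerivAt.comp_hasDerivWithinAt t
      hd.hasDerivWithinAt).const_mul (2 : ℂ)).sub_const (c.toEquiv (c.e j) i))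
  refine ⟨2 * c.entry i j (derivWithin (fun s => proj (Λ s)) (Icc a b) t), ?_⟩
  simp only [souriau_eq_entry]
  exact h2

/-- Differentiating `W W̄ = 1` and pairing with a real fixed vector `x` on both sides gives `q + q̄
= 0` for `q = xᵀ W' x`. So `q` is `i` times twice the crossing form, and the eigenvalue moves
tangentially to the circle. -/
lemma re_quadratic_eq_zero {Λ : ℝ → Submodule ℝ E} {a b t : ℝ} (hab : a < b) (ht : t ∈ Icc a b)
    (hL : ∀ s ∈ Icc a b, IsLagrangian ω (Λ s)) {w' : Fin n → Fin n → ℂ}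
    (hw : ∀ i j, HasDerivWithinAt (fun s => c.souriau (Λ s) i j) (w' i j) (Icc a b) t)
    (x : Fin n → ℝ) (hx : ∀ i, ∑ j, c.souriau (Λ t) i j * (x j : ℂ) = (x i : ℂ)) :
    ∑ i, ∑ j, x i * x j * (w' i j).re = 0 := by
  have h1 : ∀ i j, ∑ k, (w' i k * star (c.souriau (Λ t) k j)
      + c.souriau (Λ t) i k * star (w' k j)) = 0 := fun i j => by
    have h2 : HasDerivWithinAt (fun s => ∑ k, c.souriau (Λ s) i k * star (c.souriau (Λ s) k j))
        (∑ k, (w' i k * star (c.souriau (Λ t) k j) + c.souriau (Λ t) i k * star (w' k j)))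
        (Icc a b) t :=
      HasDerivWithinAt.fun_sum fun k _ => (hw i k).mul ((hw k j).star)
    have h3 : HasDerivWithinAt (fun s => ∑ k, c.souriau (Λ s) i k * star (c.souriau (Λ s) k j))
        0 (Icc a b) t :=
      (hasDerivWithinAt_const t (Icc a b) (if i = j then (1 : ℂ) else 0)).congr
        (fun s hs => c.souriau_mul_conj (hL s hs) i j) (c.souriau_mul_conj (hL t ht) i j)
    exact (uniqueDiffOn_Icc hab t ht).eq_deriv _ h2 h3
  have hx' : ∀ k, ∑ i, (x i : ℂ) * c.souriau (Λ t) i k = (x k : ℂ) := fun k => by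
    rw [← hx k]
    refine Finset.sum_congr rfl fun i _ => ?_
    rw [c.souriau_symm (hL t ht) i k, mul_comm]
  have hx'' : ∀ i, ∑ j, star (c.souriau (Λ t) i j) * (x j : ℂ) = (x i : ℂ) := fun i => by
    have := congrArg star (hx i)
    rw [star_sum] at this
    simpa using this
  set q : ℂ := ∑ i, ∑ j, (x i : ℂ) * x j * w' i j with hq
  have h4 : q + star q = 0 := by
    have h5 : q = ∑ i, ∑ j, ∑ k, (x i : ℂ) * x j * (w' i k * star (c.souriau (Λ t) k j)) := by
      rw [hq]
      refine Finset.sum_congr rfl fun i _ => ?_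
      rw [Finset.sum_comm]
      refine Finset.sum_congr rfl fun k _ => ?_
      rw [← hx'' k, Finset.mul_sum, Finset.sum_mul]
      refine Finset.sum_congr rfl fun j _ => ?_
      ring
    have h6 : star q = ∑ i, ∑ j, ∑ k, (x i : ℂ) * x j * (c.souriau (Λ t) i k * star (w' k j)) := by
      rw [hq, star_sum]
      have : ∀ k, star (∑ j, (x k : ℂ) * x j * w' k j) = ∑ j, (x k : ℂ) * x j * star (w' k j) :=
        fun k => by
          rw [star_sum]
          simp
      simp only [this]
      rw [Finset.sum_comm]
      conv_rhs => rw [Finset.sum_comm]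
      refine Finset.sum_congr rfl fun j _ => ?_
      rw [Finset.sum_comm]
      refine Finset.sum_congr rfl fun k _ => ?_
      rw [← hx' k, Finset.sum_mul, Finset.sum_mul]
      refine Finset.sum_congr rfl fun i _ => ?_
      ring
    rw [h6, h5, ← Finset.sum_add_distrib]
    refine Finset.sum_eq_zero fun i _ => ?_
    rw [← Finset.sum_add_distrib]
    refine Finset.sum_eq_zero fun j _ => ?_
    rw [← Finset.sum_add_distrib]
    simp only [← mul_add]
    rw [← Finset.mul_sum, h1, mul_zero]
  have h7 : q.re = 0 := by
    have := congrArg Complex.re h4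
    simp at this
    linarith
  rw [hq, Complex.re_sum] at h7
  rw [← h7]
  refine Finset.sum_congr rfl fun i _ => ?_
  rw [Complex.re_sum]
  refine Finset.sum_congr rfl fun j _ => ?_
  rw [← Complex.ofReal_mul, Complex.re_ofReal_mul]

end UnitaryCoordinates

/-- The signed count of the half turns of eigenangles through `2πℤ`. -/
def angleIndex {n : ℕ} (α : Fin n → ℝ) : ℚ := ∑ j, halfFloor (α j)

/-- Along regular paths, the eigenangles jump as prescribed by the crossing forms. -/
def JumpProperty {ω : LinearMap.BilinForm ℝ E} {V : Submodule ℝ E} {n : ℕ}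
    (c : UnitaryCoordinates ω V n) : Prop :=
  ∀ (Λ : ℝ → Submodule ℝ E) (a b : ℝ) (α : ℝ → Fin n → ℝ), a < b → IsRegularPath ω Λ V a b →
    ContinuousOn α (Icc a b) → (∀ t ∈ Icc a b, IsEigenangles (c.souriau (Λ t)) (α t)) →
    HasJumps (fun t => angleIndex (α t)) (fun t => signature (crossingForm ω Λ V a b t)) a b

/-- Here `W` is the scalar `exp (iα)`. At a crossing its derivative is `i` times twice the crossing
form at the unit vector, whose sign is the signature. -/
lemma jumpProperty_one {ω : LinearMap.BilinForm ℝ E} {V : Submodule ℝ E}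
    (c : UnitaryCoordinates ω V 1) : JumpProperty c := by
  intro Λ a b α hab hΛ hα hrep t ht
  have hd := (hΛ.contDiffOn.differentiableOn one_ne_zero) t ht
  obtain ⟨w', hw⟩ := c.hasDerivWithinAt_souriau hd 0 0
  have hw2 : ∀ i j, HasDerivWithinAt (fun s => c.souriau (Λ s) i j) w' (Icc a b) t := fun i j => by
    rw [Subsingleton.elim i 0, Subsingleton.elim j 0]
    exact hw
  have hL := hΛ.lagrangian t ht
  have hαc : ContinuousWithinAt (fun s => α s 0) (Icc a b) t :=
    (continuous_apply (0 : Fin 1)).continuousAt.comp_continuousWithinAt (hα t ht)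
  have hexp : ∀ s ∈ Icc a b, Complex.exp (α s 0 * Complex.I) = c.souriau (Λ s) 0 0 := fun s hs => by
    have := hrep s hs 0
    simp at this
    exact this.symm
  simp only [angleIndex, Fin.sum_univ_one]
  by_cases hcross : ∃ k : ℤ, α t 0 = 2 * Real.pi * k
  · obtain ⟨k, hk⟩ := hcross
    have hw1 : c.souriau (Λ t) 0 0 = 1 := by
      rw [← hexp t ht]
      exact (cexp_eq_one_iff _).2 ⟨k, hk⟩
    have hfix : ∀ x : Fin 1 → ℝ, ∀ i, ∑ j, c.souriau (Λ t) i j * (x j : ℂ) = (x i : ℂ) :=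
      fun x i => by
        rw [Subsingleton.elim i 0]
        simp [hw1]
    have hmem : c.ofReal (fun _ => 1) ∈ Λ t ⊓ V := by
      rw [c.mem_inf_iff hL (c.ofReal_mem _)]
      intro i
      simp only [c.toEquiv_ofReal, Complex.ofReal_re]
      exact hfix _ i
    have hne : (⟨_, hmem⟩ : ↥(Λ t ⊓ V)) ≠ 0 := by
      intro h0
      have h1 : c.ofReal (fun _ => 1) = 0 := congrArg Subtype.val h0
      have h2 := c.toEquiv_ofReal (fun _ => 1) 0
      rw [h1] at h2
      simp at h2
    have hrank : Module.finrank ℝ ↥(Λ t ⊓ V) = 1 := by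
      refine le_antisymm ?_ ?_
      · rw [← c.finrank_V]
        exact Submodule.finrank_mono inf_le_right
      · have : Nontrivial ↥(Λ t ⊓ V) := ⟨⟨_, _, hne⟩⟩
        exact Module.finrank_pos
    obtain ⟨hQ, hsig⟩ := signature_of_finrank_one hrank (hΛ.nondegenerate t ht) hne
    have hQv : crossingForm ω Λ V a b t ⟨_, hmem⟩ = 2⁻¹ * w'.im := by
      rw [c.crossingForm_apply hab ht hd hw2]
      simp [c.toEquiv_ofReal]
    have hre : w'.re = 0 := by
      have := c.re_quadratic_eq_zero hab ht hΛ.lagrangian hw2 (fun _ => 1) (hfix _)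
      simpa using this
    rw [hQv] at hQ hsig
    have hg : w'.im ≠ 0 := by
      intro h0
      rw [h0, mul_zero] at hQ
      exact hQ rfl
    rw [sign_mul, sign_pos (by norm_num : (0 : ℝ) < 2⁻¹), one_mul] at hsig
    have hdexp : HasDerivWithinAt (fun s => Complex.exp (α s 0 * Complex.I)) (w'.im * Complex.I)
        (Icc a b) t := by
      have : (w'.im : ℂ) * Complex.I = w' := by
        apply Complex.ext <;> simp [hre]
      rw [this]
      exact hw.congr hexp (hexp t ht)
    filter_upwards [eventually_sign_sin_half hαc k hk hg hdexp,
      eventually_halfFloor_eq_sign hαc k hk] with s h1 h2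
    rw [h2, h1, halfFloor_of_eq k hk, hsig, SignType.coe_mul]
    push_cast
    ring
  · push Not at hcross
    have hzero : Module.finrank ℝ ↥(Λ t ⊓ V) = 0 := by
      rw [Submodule.finrank_eq_zero, Submodule.eq_bot_iff]
      intro v hv
      have h1 := (c.mem_inf_iff hL hv.2).1 hv 0
      rw [Fin.sum_univ_one] at h1
      have h2 : c.souriau (Λ t) 0 0 ≠ 1 := by
        rw [← hexp t ht]
        intro h3
        obtain ⟨k, hk⟩ := (cexp_eq_one_iff _).1 h3
        exact hcross k hk
      have h3 : ((c.toEquiv v 0).re : ℂ) = 0 := by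
        by_contra h4
        exact h2 (mul_right_cancel₀ h4 (by rw [h1, one_mul]))
      apply c.toEquiv.injective
      ext j
      rw [Subsingleton.elim j 0, c.toEquiv_eq_ofReal hv.2, h3]
      simp
    filter_upwards [eventually_halfFloor_eq hαc hcross] with s hs
    rw [hs, signature_of_finrank_zero hzero]
    simp

end

/-! ### The jumps for Lagrangian planes -/

noncomputable section

variable {E : Type*} [NormedAddCommGroup E] [InnerProductSpace ℝ E] [FiniteDimensional ℝ E]

lemma IsEigenangles.det_one_sub {w : Fin 2 → Fin 2 → ℂ} {α : Fin 2 → ℝ} (h : IsEigenangles w α) :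
    (w 0 0 - 1) * (w 1 1 - 1) - w 0 1 * w 1 0
      = (Complex.exp (α 0 * Complex.I) - 1) * (Complex.exp (α 1 * Complex.I) - 1) := by
  have := h 1
  rw [Matrix.det_fin_two] at this
  simp at this
  linear_combination this

lemma IsEigenangles.det_eq {w : Fin 2 → Fin 2 → ℂ} {α : Fin 2 → ℝ} (h : IsEigenangles w α) :
    w 0 0 * w 1 1 - w 0 1 * w 1 0
      = Complex.exp (α 0 * Complex.I) * Complex.exp (α 1 * Complex.I) := by
  have := h 0
  rw [Matrix.det_fin_two] at this
  simp at this
  linear_combination this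

/-- A symmetric unitary `2 × 2` matrix with a real fixed vector `(x, y)` has the form
`1 + (δ - 1) u uᵀ` with `u = (-y, x)`. -/
lemma eq_of_fixed_vector {w00 w01 w11 δ x y : ℂ} (hxy : x ^ 2 + y ^ 2 = 1)
    (h0 : w00 * x + w01 * y = x) (h1 : w01 * x + w11 * y = y) (hδ : w00 * w11 - w01 ^ 2 = δ) :
    w00 = 1 + (δ - 1) * y ^ 2 ∧ w01 = -((δ - 1) * (x * y)) ∧ w11 = 1 + (δ - 1) * x ^ 2 := by
  set l : ℂ := y ^ 2 * w00 - 2 * x * y * w01 + x ^ 2 * w11 with hl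
  have e00 : w00 = x ^ 2 + l * y ^ 2 := by
    rw [hl]
    linear_combination (x ^ 3 + 2 * x * y ^ 2) * h0 + (x ^ 2 * y - 2 * x ^ 2 * y) * h1
      + (-w00 * (1 + x ^ 2 + y ^ 2) + x ^ 2) * hxy
  have e01 : w01 = x * y - l * (x * y) := by
    rw [hl]
    linear_combination (x ^ 2 * y - y * (x ^ 2 - y ^ 2)) * h0
      + (x * y ^ 2 + x * (x ^ 2 - y ^ 2)) * h1 + (-w01 * (1 + x ^ 2 + y ^ 2) + x * y) * hxy
  have e11 : w11 = y ^ 2 + l * x ^ 2 := by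
    rw [hl]
    linear_combination (x * y ^ 2 - 2 * x * y ^ 2) * h0 + (y ^ 3 + 2 * x ^ 2 * y) * h1
      + (-w11 * (1 + x ^ 2 + y ^ 2) + y ^ 2) * hxy
  clear_value l
  have hd : δ = l := by
    rw [← hδ, e00, e01, e11]
    linear_combination l * (1 + x ^ 2 + y ^ 2) * hxy
  rw [hd]
  refine ⟨?_, ?_, ?_⟩
  · rw [e00]
    linear_combination hxy
  · rw [e01]
    ring
  · rw [e11]
    linear_combination hxy

lemma signature_of_det_neg {M : Type*} [AddCommGroup M] [Module ℝ M] [FiniteDimensional ℝ M]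
    {Q : QuadraticForm ℝ M} (hr : Module.finrank ℝ M = 2) (hQ : Q.Nondegenerate)
    {v w : M} (hv : 0 < Q v) (hw : Q w < 0) : signature Q = 0 := by
  have h1 := one_le_sigPos hv
  have h2 := one_le_sigNeg hw
  have h3 := sigPos_add_sigNeg hQ
  rw [signature]
  omega

/-- Signature of a nondegenerate binary quadratic form. -/
lemma signature_binary {M : Type*} [AddCommGroup M] [Module ℝ M] [FiniteDimensional ℝ M]
    {Q : QuadraticForm ℝ M} (hQ : Q.Nondegenerate) (e : M ≃ₗ[ℝ] (Fin 2 → ℝ)) {p q r : ℝ}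
    (h : ∀ v, Q v = p * e v 0 ^ 2 + 2 * q * (e v 0 * e v 1) + r * e v 1 ^ 2) :
    p * r - q ^ 2 ≠ 0 ∧ (0 < p * r - q ^ 2 → p + r ≠ 0) ∧
      signature Q = if 0 < p * r - q ^ 2 then 2 * (SignType.sign (p + r) : ℤ) else 0 := by
  have hrank : Module.finrank ℝ M = 2 := by rw [e.finrank_eq, Module.finrank_fin_fun]
  have hval : ∀ x y : ℝ, Q (e.symm ![x, y]) = p * x ^ 2 + 2 * q * (x * y) + r * y ^ 2 :=
    fun x y => by rw [h]; simp
  have hD : p * r - q ^ 2 ≠ 0 := by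
    intro hD
    have key : ∀ x y : ℝ, p * x + q * y = 0 → q * x + r * y = 0 → x = 0 ∧ y = 0 := by
      intro x y h1 h2
      have hmem : e.symm ![x, y] ∈ Q.radical := by
        rw [QuadraticMap.mem_radical_iff']
        refine ⟨?_, fun v => ?_⟩
        · rw [hval]
          linear_combination x * h1 + y * h2
        · rw [h, h v, map_add, LinearEquiv.apply_symm_apply]
          simp only [Pi.add_apply, Matrix.cons_val_zero, Matrix.cons_val_one]
          linear_combination (x + 2 * e v 0) * h1 + (y + 2 * e v 1) * h2
      rw [hQ.radical_eq_bot, Submodule.mem_bot, LinearEquiv.map_eq_zero_iff] at hmem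
      exact ⟨congrFun hmem 0, congrFun hmem 1⟩
    -- `(r, -q)` is a column of the adjugate, in the kernel when the determinant vanishes. If it is
    -- zero, then `(0, 1)` is in the kernel instead.
    obtain ⟨hr0, hq0⟩ := key r (-q) (by linear_combination hD) (by ring)
    have hq1 : q = 0 := by linarith
    obtain ⟨-, h3⟩ := key 0 1 (by rw [hq1]; ring) (by rw [hr0]; ring)
    exact one_ne_zero h3
  have hT : 0 < p * r - q ^ 2 → p + r ≠ 0 := by
    intro h1 h2
    have : r = -p := by linarith
    rw [this] at h1
    nlinarith [sq_nonneg p, sq_nonneg q]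
  refine ⟨hD, hT, ?_⟩
  split_ifs with hpos
  · have hne : ∀ v : M, v ≠ 0 → ¬ (e v 0 = 0 ∧ e v 1 = 0) := fun v hv h0 => by
      apply hv
      rw [← e.map_eq_zero_iff]
      ext j
      fin_cases j
      · exact h0.1
      · exact h0.2
    have hpr : 0 < p * r := by nlinarith [sq_nonneg q]
    have hpd : ∀ p q r : ℝ, 0 < p → 0 < p * r - q ^ 2 → ∀ x y : ℝ, ¬ (x = 0 ∧ y = 0) →
        0 < p * x ^ 2 + 2 * q * (x * y) + r * y ^ 2 := fun p q r hp hD x y hxy => by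
      have h1 : p * (p * x ^ 2 + 2 * q * (x * y) + r * y ^ 2)
          = (p * x + q * y) ^ 2 + (p * r - q ^ 2) * y ^ 2 := by ring
      by_cases hy : y = 0
      · have hx : x ≠ 0 := fun hx => hxy ⟨hx, hy⟩
        rw [hy]
        have : 0 < x ^ 2 := by positivity
        nlinarith
      · have : 0 < (p * r - q ^ 2) * y ^ 2 := by positivity
        nlinarith [sq_nonneg (p * x + q * y)]
    have hsum := sigPos_add_sigNeg hQ
    rcases lt_or_gt_of_ne (show p ≠ 0 by rintro rfl; simp at hpr) with hp | hp
    · have hr : r < 0 := by nlinarith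
      have : sigPos (-Q) = Module.finrank ℝ M := sigPos_of_posDef fun v hv => by
        have := hpd (-p) (-q) (-r) (by linarith) (by linarith) _ _ (hne v hv)
        rw [neg_apply, h]
        linarith
      rw [sigPos_neg] at this
      rw [signature, sign_neg (by linarith), SignType.coe_neg_one]
      omega
    · have hr : 0 < r := by nlinarith
      have : sigPos Q = Module.finrank ℝ M := sigPos_of_posDef fun v hv => by
        rw [h]
        exact hpd p q r hp hpos _ _ (hne v hv)
      rw [signature, sign_pos (by linarith), SignType.coe_one]
      omega
  · have hneg : p * r - q ^ 2 < 0 := lt_of_le_of_ne (not_lt.1 hpos) hD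
    have key : ∀ p q r : ℝ, p * r - q ^ 2 < 0 →
        ∃ x y : ℝ, 0 < p * x ^ 2 + 2 * q * (x * y) + r * y ^ 2 := fun p q r h => by
      by_cases hp : 0 < p
      · exact ⟨1, 0, by nlinarith⟩
      by_cases hr : 0 < r
      · exact ⟨0, 1, by nlinarith⟩
      by_cases hp0 : p = 0
      · have hq : q ≠ 0 := by
          rintro rfl
          rw [hp0] at h
          simp at h
        refine ⟨(1 - r) / (2 * q), 1, ?_⟩
        have : 0 * ((1 - r) / (2 * q)) ^ 2 + 2 * q * ((1 - r) / (2 * q) * 1) + r * 1 ^ 2 = 1 := by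
          field_simp
          ring
        rw [hp0, this]
        exact one_pos
      · have hp' : p < 0 := lt_of_le_of_ne (not_lt.1 hp) hp0
        refine ⟨q, -p, ?_⟩
        have : p * q ^ 2 + 2 * q * (q * -p) + r * (-p) ^ 2 = p * (p * r - q ^ 2) := by ring
        rw [this]
        exact mul_pos_of_neg_of_neg hp' h
    obtain ⟨x, y, hxy⟩ := key p q r hneg
    obtain ⟨x', y', hxy'⟩ := key (-p) (-q) (-r) (by linarith)
    refine signature_of_det_neg hrank hQ (v := e.symm ![x, y]) (w := e.symm ![x', y']) ?_ ?_
    · rw [hval]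
      exact hxy
    · rw [hval]
      linarith

/-- The angles are merely continuous, so their motion is extracted from `χ = det (1 - W)` and `δ =
det W`, which are differentiable. The cases are the dimensions `0`, `2` and `1` of the intersection
with `V`. -/
lemma jumpProperty_two {ω : LinearMap.BilinForm ℝ E} {V : Submodule ℝ E}
    (c : UnitaryCoordinates ω V 2) : JumpProperty c := by
  intro Λ a b α hab hΛ hα hrep t ht
  have hd := (hΛ.contDiffOn.differentiableOn one_ne_zero) t ht
  choose w' hw using c.hasDerivWithinAt_souriau hd
  have hL := hΛ.lagrangian t ht
  have hαc : ∀ j, ContinuousWithinAt (fun s => α s j) (Icc a b) t := fun j =>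
    (continuous_apply j).continuousAt.comp_continuousWithinAt (hα t ht)
  have hsymm : ∀ s ∈ Icc a b, c.souriau (Λ s) 1 0 = c.souriau (Λ s) 0 1 := fun s hs =>
    c.souriau_symm (hΛ.lagrangian s hs) 1 0
  have hw10 : w' 1 0 = w' 0 1 := by
    refine (uniqueDiffOn_Icc hab t ht).eq_deriv _ (hw 1 0) ?_
    exact (hw 0 1).congr hsymm (hsymm t ht)
  set χ : ℝ → ℂ := fun s => (c.souriau (Λ s) 0 0 - 1) * (c.souriau (Λ s) 1 1 - 1)
    - c.souriau (Λ s) 0 1 * c.souriau (Λ s) 0 1 with hχdef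
  set δ : ℝ → ℂ := fun s => c.souriau (Λ s) 0 0 * c.souriau (Λ s) 1 1
    - c.souriau (Λ s) 0 1 * c.souriau (Λ s) 0 1 with hδdef
  have hχ : ∀ s ∈ Icc a b, χ s = (Complex.exp (α s 0 * Complex.I) - 1)
      * (Complex.exp (α s 1 * Complex.I) - 1) := fun s hs => by
    rw [← (hrep s hs).det_one_sub, hsymm s hs]
  have hδ : ∀ s ∈ Icc a b, δ s = Complex.exp (α s 0 * Complex.I)
      * Complex.exp (α s 1 * Complex.I) := fun s hs => by
    rw [← (hrep s hs).det_eq, hsymm s hs]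
  have hQ : ∀ v : ↥(Λ t ⊓ V), crossingForm ω Λ V a b t v
      = 2⁻¹ * ((w' 0 0).im * (c.toEquiv v 0).re ^ 2
        + 2 * (w' 0 1).im * ((c.toEquiv v 0).re * (c.toEquiv v 1).re)
        + (w' 1 1).im * (c.toEquiv v 1).re ^ 2) := fun v => by
    rw [c.crossingForm_apply hab ht hd hw]
    simp only [Fin.sum_univ_two, hw10]
    ring
  simp only [angleIndex, Fin.sum_univ_two]
  by_cases hχt : χ t = 0
  swap
  · -- no crossing
    have hne : ∀ j, ∀ k : ℤ, α t j ≠ 2 * Real.pi * k := by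
      intro j k hk
      apply hχt
      have h1 := (cexp_eq_one_iff _).2 ⟨k, hk⟩
      rw [hχ t ht]
      fin_cases j
      · simp only [Fin.zero_eta] at h1
        rw [h1, sub_self, zero_mul]
      · simp only [Fin.mk_one] at h1
        rw [h1, sub_self, mul_zero]
    have hzero : Module.finrank ℝ ↥(Λ t ⊓ V) = 0 := by
      rw [Submodule.finrank_eq_zero, Submodule.eq_bot_iff]
      intro v hv
      have h1 := (c.mem_inf_iff hL hv.2).1 hv
      have h10 := h1 0
      have h11 := h1 1
      rw [Fin.sum_univ_two] at h10 h11
      rw [hsymm t ht] at h11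
      have h2 : χ t * ((c.toEquiv v 0).re : ℂ) = 0 := by
        simp only [hχdef]
        linear_combination (c.souriau (Λ t) 1 1 - 1) * h10 - c.souriau (Λ t) 0 1 * h11
      have h3 : χ t * ((c.toEquiv v 1).re : ℂ) = 0 := by
        simp only [hχdef]
        linear_combination (c.souriau (Λ t) 0 0 - 1) * h11 - c.souriau (Λ t) 0 1 * h10
      apply c.toEquiv.injective
      ext j
      rw [c.toEquiv_eq_ofReal hv.2, map_zero, Pi.zero_apply]
      fin_cases j
      · exact (mul_eq_zero.1 h2).resolve_left hχt
      · exact (mul_eq_zero.1 h3).resolve_left hχt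
    filter_upwards [eventually_halfFloor_eq (hαc 0) (hne 0),
      eventually_halfFloor_eq (hαc 1) (hne 1)] with s h1 h2
    rw [h1, h2, signature_of_finrank_zero hzero]
    simp
  by_cases hW : c.souriau (Λ t) 0 0 = 1 ∧ c.souriau (Λ t) 0 1 = 0 ∧ c.souriau (Λ t) 1 1 = 1
  · -- double crossing
    obtain ⟨hW00, hW01, hW11⟩ := hW
    have hfix : ∀ x : Fin 2 → ℝ, ∀ i, ∑ j, c.souriau (Λ t) i j * (x j : ℂ) = (x i : ℂ) := by
      intro x i
      rw [Fin.sum_univ_two]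
      fin_cases i
      · simp [hW00, hW01]
      · simp [hsymm t ht, hW01, hW11]
    have hK : Λ t ⊓ V = V := by
      refine le_antisymm inf_le_right fun v hv => ?_
      rw [c.mem_inf_iff hL hv]
      exact hfix _
    have hre := fun x => c.re_quadratic_eq_zero hab ht hΛ.lagrangian hw x (hfix x)
    simp only [Fin.sum_univ_two, hw10] at hre
    have hre00 : (w' 0 0).re = 0 := by simpa using hre ![1, 0]
    have hre11 : (w' 1 1).re = 0 := by simpa using hre ![0, 1]
    have hre01 : (w' 0 1).re = 0 := by
      have := hre ![1, 1]
      simp [hre00, hre11] at this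
      linarith
    have him : ∀ z : ℂ, z.re = 0 → z = z.im * Complex.I := fun z hz => by
      apply Complex.ext <;> simp [hz]
    set e : ↥(Λ t ⊓ V) ≃ₗ[ℝ] (Fin 2 → ℝ) :=
      (LinearEquiv.ofEq (Λ t ⊓ V) V hK).trans c.realEquiv with he
    obtain ⟨hD, hT, hsig⟩ := signature_binary (hΛ.nondegenerate t ht) e
      (p := 2⁻¹ * (w' 0 0).im) (q := 2⁻¹ * (w' 0 1).im) (r := 2⁻¹ * (w' 1 1).im) (fun v => by
        have h0 : ∀ j, e v j = (c.toEquiv v j).re := fun j => rfl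
        rw [hQ v, h0, h0]
        ring)
    -- Determinant and trace of `Im W'`; the crossing form carries a factor `1/2`, hence the `D / 4`
    -- and `T / 2` below.
    set D := (w' 0 0).im * (w' 1 1).im - (w' 0 1).im ^ 2 with hDdef
    set T := (w' 0 0).im + (w' 1 1).im with hTdef
    have hDD : 2⁻¹ * (w' 0 0).im * (2⁻¹ * (w' 1 1).im) - (2⁻¹ * (w' 0 1).im) ^ 2 = D / 4 := by
      rw [hDdef]
      ring
    have hTT : 2⁻¹ * (w' 0 0).im + 2⁻¹ * (w' 1 1).im = T / 2 := by
      rw [hTdef]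
      ring
    rw [hDD] at hD hT hsig
    rw [hTT] at hT hsig
    have hposiff : 0 < D / 4 ↔ 0 < D := by constructor <;> intro h <;> linarith
    have hsT : SignType.sign (T / 2) = SignType.sign T := by
      rw [div_eq_mul_inv, sign_mul, sign_pos (by norm_num : (0 : ℝ) < 2⁻¹), mul_one]
    rw [hsT] at hsig
    simp only [hposiff] at hsig hT
    have hexp : ∀ j, Complex.exp (α t j * Complex.I) = 1 := by
      have h1 := hχ t ht
      have h2 := hδ t ht
      rw [hχt] at h1
      simp only [hδdef, hW00, hW01, hW11] at h2
      have h3 : (Complex.exp (α t 0 * Complex.I) - 1) ^ 2 = 0 := by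
        linear_combination (1 - Complex.exp (α t 0 * Complex.I)) * h2
          + Complex.exp (α t 0 * Complex.I) * h1
      have h4 : Complex.exp (α t 0 * Complex.I) = 1 := by
        rw [← sub_eq_zero]
        exact pow_eq_zero_iff two_ne_zero |>.1 h3
      have h5 : Complex.exp (α t 1 * Complex.I) = 1 := by
        rw [h4] at h2
        linear_combination -h2
      intro j
      fin_cases j
      · exact h4
      · exact h5
    obtain ⟨k, hk⟩ := (cexp_eq_one_iff _).1 (hexp 0)
    obtain ⟨l, hl⟩ := (cexp_eq_one_iff _).1 (hexp 1)
    -- As `W t = 1`, the quotient is the determinant of the difference quotient of `W`, with limit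
    -- `det W' = det (i Im W') = -D`.
    have hlim : Tendsto (fun s => χ s / ((s - t : ℝ) : ℂ) ^ 2) (𝓝[Icc a b \ {t}] t)
        (𝓝 (-(D : ℂ))) := by
      have s00 := hasDerivWithinAt_iff_tendsto_slope.1 (hw 0 0)
      have s01 := hasDerivWithinAt_iff_tendsto_slope.1 (hw 0 1)
      have s11 := hasDerivWithinAt_iff_tendsto_slope.1 (hw 1 1)
      have h1 := (s00.mul s11).sub (s01.mul s01)
      have h2 : w' 0 0 * w' 1 1 - w' 0 1 * w' 0 1 = -(D : ℂ) := by
        rw [him _ hre00, him _ hre01, him _ hre11, hDdef]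
        push_cast
        linear_combination (((w' 0 0).im : ℂ) * (w' 1 1).im - ((w' 0 1).im : ℂ) ^ 2) * Complex.I_sq
      rw [h2] at h1
      refine h1.congr' ?_
      filter_upwards [self_mem_nhdsWithin] with s hs
      have hst : ((s - t : ℝ) : ℂ) ≠ 0 := by
        exact_mod_cast sub_ne_zero.2 hs.2
      simp only [slope, vsub_eq_sub, hW00, hW01, hW11, hχdef, Complex.real_smul, Complex.ofReal_inv]
      field_simp
      ring
    have hder : HasDerivWithinAt δ (T * Complex.I) (Icc a b) t := by
      have h1 := ((hw 0 0).mul (hw 1 1)).sub ((hw 0 1).mul (hw 0 1))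
      refine h1.congr_deriv ?_
      rw [hW00, hW01, hW11]
      conv_lhs => rw [him _ hre00, him _ hre11]
      rw [hTdef]
      push_cast
      ring
    have hD' : D ≠ 0 := by
      rintro h
      rw [h] at hD
      simp at hD
    have hT' : 0 < D → T ≠ 0 := fun h1 h2 => hT h1 (by rw [h2]; simp)
    filter_upwards [eventually_sign_add_sign ht (hαc 0) (hαc 1) k l hk hl hχ hδ hlim hder hD' hT',
      eventually_halfFloor_eq_sign (hαc 0) k hk, eventually_halfFloor_eq_sign (hαc 1) l hl]
      with s h1 h2 h3
    rw [h2, h3, hsig, halfFloor_of_eq k hk, halfFloor_of_eq l hl]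
    have h4 := congrArg (Int.cast : ℤ → ℚ) h1
    push_cast at h4 ⊢
    linear_combination h4 / 2
  · -- simple crossing
    have hdet : (1 - Matrix.of (c.souriau (Λ t))).det = 0 := by
      rw [Matrix.det_fin_two]
      simp [hsymm t ht]
      simp only [hχdef] at hχt
      linear_combination hχt
    obtain ⟨v, hv, hv0⟩ := c.exists_mem_inf_of_det hL hdet
    have hrank : Module.finrank ℝ ↥(Λ t ⊓ V) = 1 := by
      refine le_antisymm ?_ ?_
      · have : Λ t ⊓ V < V := by
          refine lt_of_le_of_ne inf_le_right fun hK => hW ?_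
          have h1 : ∀ x : Fin 2 → ℝ, ∀ i, ∑ j, c.souriau (Λ t) i j * (x j : ℂ) = (x i : ℂ) := by
            intro x
            have h2 : c.ofReal x ∈ Λ t ⊓ V := by
              rw [hK]
              exact c.ofReal_mem x
            have h3 := (c.mem_inf_iff hL (c.ofReal_mem x)).1 h2
            simpa [c.toEquiv_ofReal] using h3
          simp only [Fin.sum_univ_two] at h1
          refine ⟨?_, ?_, ?_⟩
          · simpa using h1 ![1, 0] 0
          · simpa using h1 ![0, 1] 0
          · simpa using h1 ![0, 1] 1
        have h2 := Submodule.finrank_lt_finrank_of_lt this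
        rw [c.finrank_V] at h2
        omega
      · have : Nontrivial ↥(Λ t ⊓ V) := ⟨⟨⟨v, hv⟩, 0, fun h => hv0 (congrArg Subtype.val h)⟩⟩
        exact Module.finrank_pos
    obtain ⟨hQv, hsig⟩ := signature_of_finrank_one hrank (hΛ.nondegenerate t ht) (v := ⟨v, hv⟩)
      (fun h => hv0 (congrArg Subtype.val h))
    set p := (c.toEquiv v 0).re with hp
    set q := (c.toEquiv v 1).re with hq
    have hr : 0 < p ^ 2 + q ^ 2 := by
      by_contra h
      have h1 : p = 0 := by nlinarith [sq_nonneg p, sq_nonneg q]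
      have h2 : q = 0 := by nlinarith [sq_nonneg p, sq_nonneg q]
      apply hv0
      apply c.toEquiv.injective
      ext j
      rw [c.toEquiv_eq_ofReal hv.2]
      fin_cases j
      · simpa using h1
      · simpa using h2
    set r := Real.sqrt (p ^ 2 + q ^ 2) with hrdef
    have hr0 : 0 < r := Real.sqrt_pos.2 hr
    have hr2 : r ^ 2 = p ^ 2 + q ^ 2 := Real.sq_sqrt hr.le
    have hfix := (c.mem_inf_iff hL hv.2).1 hv
    have hre := c.re_quadratic_eq_zero hab ht hΛ.lagrangian hw (fun j => (c.toEquiv v j).re) hfix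
    have hf0 := hfix 0
    have hf1 := hfix 1
    rw [Fin.sum_univ_two, ← hp, ← hq] at hf0 hf1
    rw [hsymm t ht] at hf1
    simp only [Fin.sum_univ_two, hw10, ← hp, ← hq] at hre
    set g := ((w' 0 0).im * p ^ 2 + 2 * (w' 0 1).im * (p * q) + (w' 1 1).im * q ^ 2) / r ^ 2 with hg
    have hQg : crossingForm ω Λ V a b t ⟨v, hv⟩ = 2⁻¹ * r ^ 2 * g := by
      rw [hQ, hg, ← hp, ← hq]
      field_simp
    have hg0 : g ≠ 0 := by
      intro h
      rw [hQg, h, mul_zero] at hQv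
      exact hQv rfl
    rw [hQg, sign_mul, sign_pos (by positivity : 0 < 2⁻¹ * r ^ 2), one_mul] at hsig
    have hrC : (r : ℂ) ≠ 0 := by exact_mod_cast hr0.ne'
    have hr2C : (r : ℂ) ^ 2 = (p : ℂ) ^ 2 + (q : ℂ) ^ 2 := by exact_mod_cast hr2
    -- The normalised fixed vector determines `W t`, with second eigenvalue `δ t`. It is not `1`,
    -- since otherwise `W t = 1`.
    obtain ⟨e00, e01, e11⟩ := eq_of_fixed_vector (w00 := c.souriau (Λ t) 0 0)
      (w01 := c.souriau (Λ t) 0 1) (w11 := c.souriau (Λ t) 1 1) (δ := δ t) (x := p / r) (y := q / r)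
      (by field_simp; rw [hr2C]) (by field_simp; linear_combination hf0)
      (by field_simp; linear_combination hf1) (by simp only [hδdef]; ring)
    have hδ1 : δ t ≠ 1 := by
      intro h
      rw [h] at e00 e01 e11
      exact hW ⟨by simpa using e00, by simpa using e01, by simpa using e11⟩
    have hqf : (w' 0 0 * (p : ℂ) ^ 2 + 2 * w' 0 1 * (p * q) + w' 1 1 * (q : ℂ) ^ 2) / (r : ℂ) ^ 2
        = g * Complex.I := by
      have h1 : w' 0 0 * (p : ℂ) ^ 2 + 2 * w' 0 1 * (p * q) + w' 1 1 * (q : ℂ) ^ 2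
          = (((w' 0 0).im * p ^ 2 + 2 * (w' 0 1).im * (p * q) + (w' 1 1).im * q ^ 2 : ℝ) : ℂ)
            * Complex.I := by
        conv_lhs => rw [← Complex.re_add_im (w' 0 0), ← Complex.re_add_im (w' 0 1),
          ← Complex.re_add_im (w' 1 1)]
        have := congrArg (Complex.ofReal) hre
        push_cast at this ⊢
        linear_combination this
      rw [h1, hg]
      push_cast
      ring
    -- Differentiating the determinant at a matrix of rank one: the other eigenvalue of `W - 1`
    -- times the normalised value of `W'` on the fixed vector, which is `i g`.
    have hχd : HasDerivWithinAt χ ((δ t - 1) * (g * Complex.I)) (Icc a b) t := by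
      have h1 := (((hw 0 0).sub_const 1).mul ((hw 1 1).sub_const 1)).sub ((hw 0 1).mul (hw 0 1))
      refine h1.congr_deriv ?_
      rw [← hqf, e00, e01, e11]
      field_simp
      ring
    -- the case where the crossing angle is the first or the second one
    have key : ∀ x y : ℝ → ℝ, ContinuousWithinAt x (Icc a b) t → ContinuousWithinAt y (Icc a b) t →
        (∀ s ∈ Icc a b, χ s = (Complex.exp (x s * Complex.I) - 1)
          * (Complex.exp (y s * Complex.I) - 1)) →
        (∀ s ∈ Icc a b, δ s = Complex.exp (x s * Complex.I) * Complex.exp (y s * Complex.I)) →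
        Complex.exp (x t * Complex.I) = 1 →
        ∀ᶠ s in 𝓝[Icc a b] t, halfFloor (x s) + halfFloor (y s)
          = halfFloor (x t) + halfFloor (y t)
            + (SignType.sign (s - t) : ℤ) * (signature (crossingForm ω Λ V a b t) : ℚ) / 2 := by
      intro x y hx hy h1 h2 h3
      obtain ⟨k, hk⟩ := (cexp_eq_one_iff _).1 h3
      have h4 : Complex.exp (y t * Complex.I) = δ t := by
        rw [h2 t ht, h3, one_mul]
      have h5 : ∀ k : ℤ, y t ≠ 2 * Real.pi * k := fun m hm =>
        hδ1 (h4.symm.trans ((cexp_eq_one_iff _).2 ⟨m, hm⟩))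
      rw [← h4] at hχd
      filter_upwards [eventually_halfFloor_eq hy h5, eventually_halfFloor_eq_sign hx k hk,
        eventually_sign_sin_half_of_mul ht hx hy k hk h5 hg0 h1 hχd] with s h6 h7 h8
      rw [h6, h7, h8, halfFloor_of_eq k hk, hsig, SignType.coe_mul]
      push_cast
      ring
    rcases mul_eq_zero.1 ((hχ t ht).symm.trans hχt) with h | h
    · exact key _ _ (hαc 0) (hαc 1) hχ hδ (sub_eq_zero.1 h)
    · have h1 := key _ _ (hαc 1) (hαc 0) (fun s hs => by rw [hχ s hs, mul_comm])
        (fun s hs => by rw [hδ s hs, mul_comm]) (sub_eq_zero.1 h)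
      filter_upwards [h1] with s hs
      rw [add_comm, hs]
      ring

end

/-! ### Lifting eigenangles and homotopy invariance of the index -/

noncomputable section

/-- A nonvanishing continuous function on a simply connected space has a continuous argument. -/
lemma exists_continuous_arg {X : Type*} [TopologicalSpace X] [SimplyConnectedSpace X]
    [LocallyPathConnectedSpace X] {z : X → ℂ} (hz : Continuous z) (h0 : ∀ x, z x ≠ 0) (x₀ : X)
    (φ₀ : ℝ) (hφ₀ : z x₀ = ‖z x₀‖ * Complex.exp (φ₀ * Complex.I)) :
    ∃ φ : X → ℝ, Continuous φ ∧ φ x₀ = φ₀ ∧ ∀ x, z x = ‖z x‖ * Complex.exp (φ x * Complex.I) := by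
  have hn : ((‖z x₀‖ : ℝ) : ℂ) = Complex.exp (Real.log ‖z x₀‖ : ℝ) := by
    rw [← Complex.ofReal_exp, Real.exp_log (norm_pos_iff.2 (h0 x₀))]
  obtain ⟨f, ⟨hf0, hf⟩, -⟩ := Complex.isCoveringMap_exp.existsUnique_continuousMap_lifts
    (⟨fun x => (⟨z x, h0 x⟩ : {z : ℂ // z ≠ 0}), by fun_prop⟩ : C(X, {z : ℂ // z ≠ 0})) x₀
    ((Real.log ‖z x₀‖ : ℝ) + φ₀ * Complex.I) (by
      apply Subtype.ext
      change Complex.exp _ = z x₀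
      conv_rhs => rw [hφ₀]
      rw [Complex.exp_add, hn])
  have hf' : ∀ x, Complex.exp (f x) = z x := fun x => congrArg Subtype.val (congrFun hf x)
  refine ⟨fun x => (f x).im, by fun_prop, ?_, fun x => ?_⟩
  · simp [hf0]
  · rw [← hf' x, Complex.norm_exp, Complex.ofReal_exp, ← Complex.exp_add, Complex.re_add_im]

lemma IsPreconnected.eq_of_int_valued {X : Type*} [TopologicalSpace X] {S : Set X}
    (hS : IsPreconnected S) {f : X → ℝ} (hf : ContinuousOn f S) (hint : ∀ x ∈ S, ∃ k : ℤ, f x = k)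
    {x y : X} (hx : x ∈ S) (hy : y ∈ S) : f x = f y := by
  have : DiscreteTopology (Set.range ((↑) : ℤ → ℝ)) :=
    (Int.isClosedEmbedding_coe_real.isEmbedding.toHomeomorph).symm.isEmbedding.discreteTopology
  refine hS.constant_of_mapsTo (T := Set.range ((↑) : ℤ → ℝ)) ⟨this⟩ hf (fun z hz => ?_) hx hy
  obtain ⟨k, hk⟩ := hint z hz
  exact ⟨k, hk.symm⟩

/-- `halfFloor x - x / 2π` is `2π`-periodic, hence a function of `exp (ix)` alone. -/
lemma halfFloor_sub_eq_of_cexp_eq {x y : ℝ}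
    (h : Complex.exp (x * Complex.I) = Complex.exp (y * Complex.I)) :
    (halfFloor x : ℝ) - x / (2 * Real.pi) = halfFloor y - y / (2 * Real.pi) := by
  obtain ⟨k, hk⟩ := Complex.exp_eq_exp_iff_exists_int.1 h
  have h1 : x = y + 2 * Real.pi * k := by
    have h2 : (x : ℂ) = y + 2 * Real.pi * k := by
      apply mul_right_cancel₀ Complex.I_ne_zero
      rw [hk]
      ring
    exact_mod_cast h2
  have := Real.pi_ne_zero
  rw [h1, halfFloor_add]
  push_cast
  field_simp
  ring

/-- Both sides sum one function over the multiset of eigenvalues, the roots of the characteristic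
polynomial, so the two lists of angles need not be matched. -/
lemma IsEigenangles.angleIndex_sub {n : ℕ} {w : Fin n → Fin n → ℂ} {α α' : Fin n → ℝ}
    (h : IsEigenangles w α) (h' : IsEigenangles w α') :
    (angleIndex α : ℝ) - (∑ j, α j) / (2 * Real.pi)
      = angleIndex α' - (∑ j, α' j) / (2 * Real.pi) := by
  classical
  set p : (Fin n → ℝ) → Polynomial ℂ := fun α =>
    ((Finset.univ.val.map fun j => Complex.exp (α j * Complex.I)).map
      fun a => Polynomial.X - Polynomial.C a).prod with hp
  have heval : ∀ α : Fin n → ℝ, ∀ z, (p α).eval z = ∏ j, (z - Complex.exp (α j * Complex.I)) := by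
    intro α z
    simp only [hp, Multiset.map_map, Function.comp_def]
    change (∏ j, (Polynomial.X - Polynomial.C (Complex.exp (α j * Complex.I)))).eval z = _
    rw [Polynomial.eval_prod]
    simp
  have hpp : p α = p α' := Polynomial.funext fun z => by rw [heval, heval, ← h z, ← h' z]
  have hroots := congrArg Polynomial.roots hpp
  simp only [hp, Polynomial.roots_multiset_prod_X_sub_C] at hroots
  set g : ℂ → ℝ := fun u => if hu : ∃ x : ℝ, Complex.exp (x * Complex.I) = u
    then (halfFloor hu.choose : ℝ) - hu.choose / (2 * Real.pi) else 0 with hg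
  have hgx : ∀ x : ℝ, g (Complex.exp (x * Complex.I))
      = (halfFloor x : ℝ) - x / (2 * Real.pi) := fun x => by
    have hu : ∃ y : ℝ, Complex.exp (y * Complex.I) = Complex.exp (x * Complex.I) := ⟨x, rfl⟩
    simp only [hg]
    rw [dif_pos hu]
    exact halfFloor_sub_eq_of_cexp_eq hu.choose_spec
  have hsum := congrArg (fun m : Multiset ℂ => (m.map g).sum) hroots
  simp only [Multiset.map_map, Function.comp_def, hgx] at hsum
  change ∑ j, ((halfFloor (α j) : ℝ) - α j / (2 * Real.pi))
    = ∑ j, ((halfFloor (α' j) : ℝ) - α' j / (2 * Real.pi)) at hsum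
  rw [Finset.sum_sub_distrib, Finset.sum_sub_distrib, ← Finset.sum_div, ← Finset.sum_div] at hsum
  simpa [angleIndex] using hsum

lemma two_mul_angleIndex {n : ℕ} (α : Fin n → ℝ) : ∃ k : ℤ, 2 * (angleIndex α : ℝ) = k := by
  refine ⟨∑ j, (⌊α j / (2 * Real.pi)⌋ + ⌈α j / (2 * Real.pi)⌉), ?_⟩
  rw [angleIndex]
  push_cast
  rw [Finset.mul_sum]
  refine Finset.sum_congr rfl fun j _ => ?_
  rw [halfFloor]
  push_cast
  ring

/-- Two continuous choices of eigenangles of the same matrices have the same index change. -/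
lemma angleIndex_sub_eq {X : Type*} [TopologicalSpace X] {S : Set X} (hS : IsPreconnected S)
    {n : ℕ} {w : X → Fin n → Fin n → ℂ} {α α' : X → Fin n → ℝ} (hα : ContinuousOn α S)
    (hα' : ContinuousOn α' S) (h : ∀ x ∈ S, IsEigenangles (w x) (α x))
    (h' : ∀ x ∈ S, IsEigenangles (w x) (α' x)) {x y : X} (hx : x ∈ S) (hy : y ∈ S) :
    angleIndex (α y) - angleIndex (α x) = angleIndex (α' y) - angleIndex (α' x) := by
  -- The left side is continuous and the right side is an integer, so both are constant on the
  -- preconnected set.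
  have key : ∀ x ∈ S, 2 * (((∑ j, α x j) - ∑ j, α' x j) / (2 * Real.pi))
      = 2 * ((angleIndex (α x) : ℝ) - angleIndex (α' x)) := fun x hx => by
    have := (h x hx).angleIndex_sub (h' x hx)
    rw [sub_div]
    linarith
  have hc : ∀ β : X → Fin n → ℝ, ContinuousOn β S → ContinuousOn (fun x => ∑ j, β x j) S :=
    fun β hβ => continuousOn_finsetSum _ fun j _ =>
      (continuous_apply j).comp_continuousOn hβ
  have h1 := IsPreconnected.eq_of_int_valued hS
    (f := fun x => 2 * (((∑ j, α x j) - ∑ j, α' x j) / (2 * Real.pi)))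
    (continuousOn_const.mul (((hc α hα).sub (hc α' hα')).div_const _)) (fun x hx => by
      obtain ⟨k, hk⟩ := two_mul_angleIndex (α x)
      obtain ⟨l, hl⟩ := two_mul_angleIndex (α' x)
      refine ⟨k - l, ?_⟩
      rw [key x hx, mul_sub, hk, hl]
      push_cast
      ring) hx hy
  simp only [key x hx, key y hy] at h1
  have h2 : ((angleIndex (α y) - angleIndex (α x) : ℚ) : ℝ)
      = ((angleIndex (α' y) - angleIndex (α' x) : ℚ) : ℝ) := by
    push_cast
    linarith
  exact_mod_cast h2

lemma isEigenangles_two {w : Fin 2 → Fin 2 → ℂ} {ψ β : ℝ}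
    (htr : w 0 0 + w 1 1 = 2 * Real.cos β * Complex.exp (ψ * Complex.I))
    (hdet : w 0 0 * w 1 1 - w 0 1 * w 1 0 = Complex.exp (ψ * Complex.I) ^ 2) :
    IsEigenangles w ![ψ + β, ψ - β] := by
  intro z
  rw [Matrix.det_fin_two, Fin.prod_univ_two]
  have h1 : Complex.exp (((ψ + β : ℝ) : ℂ) * Complex.I)
      = Complex.exp (ψ * Complex.I) * Complex.exp (β * Complex.I) := by
    rw [← Complex.exp_add]
    push_cast
    ring_nf
  have h2 : Complex.exp (((ψ - β : ℝ) : ℂ) * Complex.I)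
      = Complex.exp (ψ * Complex.I) * Complex.exp (-β * Complex.I) := by
    rw [← Complex.exp_add]
    push_cast
    ring_nf
  have h3 : Complex.exp (β * Complex.I) + Complex.exp (-β * Complex.I) = 2 * Real.cos β := by
    rw [Complex.ofReal_cos, Complex.cos]
    ring
  have h4 : Complex.exp (β * Complex.I) * Complex.exp (-β * Complex.I) = 1 := by
    rw [← Complex.exp_add]
    simp
  simp only [Matrix.cons_val_zero, Matrix.cons_val_one, h1, h2]
  generalize Complex.exp (-β * Complex.I) = B at *
  simp
  linear_combination (-z) * htr + hdet + z * Complex.exp (ψ * Complex.I) * h3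
    - Complex.exp (ψ * Complex.I) ^ 2 * h4

variable {E : Type*} [NormedAddCommGroup E] [InnerProductSpace ℝ E] [FiniteDimensional ℝ E]
  {ω : LinearMap.BilinForm ℝ E} {V : Submodule ℝ E} {n : ℕ}

/-- Two-parameter families of Lagrangian subspaces have continuous eigenangles. -/
def LiftProperty (c : UnitaryCoordinates ω V n) : Prop :=
  ∀ G : ℝ × ℝ → Submodule ℝ E, (∀ p, IsLagrangian ω (G p)) → Continuous (fun p => proj (G p)) →
    ∃ α : ℝ × ℝ → Fin n → ℝ, Continuous α ∧ ∀ p, IsEigenangles (c.souriau (G p)) (α p)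

lemma UnitaryCoordinates.continuous_souriau (c : UnitaryCoordinates ω V n) {X : Type*}
    [TopologicalSpace X] {G : X → Submodule ℝ E} (h : Continuous fun p => proj (G p))
    (i j : Fin n) : Continuous fun p => c.souriau (G p) i j := by
  simp only [c.souriau_eq_entry]
  have := (c.entry i j).continuous.comp h
  exact (continuous_const.mul this).sub continuous_const

lemma liftProperty_one (c : UnitaryCoordinates ω V 1) : LiftProperty c := by
  intro G hG hc
  have hw := c.continuous_souriau hc 0 0
  have hn : ∀ p, ‖c.souriau (G p) 0 0‖ = 1 := fun p => by
    have := c.souriau_mul_conj (hG p) 0 0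
    rw [Fin.sum_univ_one, if_pos rfl] at this
    have h1 := congrArg norm this
    rw [norm_mul, norm_star, norm_one] at h1
    nlinarith [norm_nonneg (c.souriau (G p) 0 0)]
  have h0 : ∀ p, c.souriau (G p) 0 0 ≠ 0 := fun p => by
    rw [← norm_ne_zero_iff, hn]
    exact one_ne_zero
  obtain ⟨φ, hφ, -, h⟩ := exists_continuous_arg hw h0 0 _
    (Complex.norm_mul_exp_arg_mul_I _).symm
  refine ⟨fun p _ => φ p, by fun_prop, fun p z => ?_⟩
  have h1 := h p
  rw [hn, Complex.ofReal_one, one_mul] at h1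
  simp [← h1]

/-- The determinant `δ` has modulus one and lifts to an argument `φ`. Unitarity gives `δ τ̄ = τ` and
`‖τ‖ ≤ 2` for the trace `τ`, so `τ exp (-iφ/2) = 2x` is real with `|x| ≤ 1`. The angles `φ/2 ±
arccos x` stay continuous where eigenvalues collide. -/
lemma liftProperty_two (c : UnitaryCoordinates ω V 2) : LiftProperty c := by
  intro G hG hc
  set τ : ℝ × ℝ → ℂ := fun p => c.souriau (G p) 0 0 + c.souriau (G p) 1 1 with hτ
  set δ : ℝ × ℝ → ℂ := fun p => c.souriau (G p) 0 0 * c.souriau (G p) 1 1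
    - c.souriau (G p) 0 1 * c.souriau (G p) 1 0 with hδ
  have hτc : Continuous τ := (c.continuous_souriau hc 0 0).add (c.continuous_souriau hc 1 1)
  have hδc : Continuous δ := ((c.continuous_souriau hc 0 0).mul (c.continuous_souriau hc 1 1)).sub
    ((c.continuous_souriau hc 0 1).mul (c.continuous_souriau hc 1 0))
  have hrel : ∀ p, δ p * star (δ p) = 1 ∧ δ p * star (τ p) = τ p ∧ ‖τ p‖ ≤ 2 := by
    intro p
    have hs := c.souriau_symm (hG p) 1 0
    have h00 := c.souriau_mul_conj (hG p) 0 0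
    have h01 := c.souriau_mul_conj (hG p) 0 1
    have h10 := c.souriau_mul_conj (hG p) 1 0
    have h11 := c.souriau_mul_conj (hG p) 1 1
    simp only [Fin.sum_univ_two, hs] at h00 h01 h10 h11
    simp only [hδ, hτ, hs, star_sub, star_add, star_mul']
    rw [if_pos trivial] at h00 h11
    rw [if_neg (by decide)] at h01 h10
    have hnorm : ∀ u v : ℂ, u * star u + v * star v = 1 → ‖u‖ ≤ 1 := fun u v h => by
      have h1 : ∀ u : ℂ, u * star u = ((‖u‖ ^ 2 : ℝ) : ℂ) := fun u => by
        rw [Complex.star_def, Complex.mul_conj, Complex.normSq_eq_norm_sq]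
      rw [h1, h1, ← Complex.ofReal_add, Complex.ofReal_eq_one] at h
      nlinarith [norm_nonneg u, sq_nonneg ‖v‖]
    refine ⟨?_, ?_, ?_⟩
    · generalize c.souriau (G p) 0 0 = x at *
      generalize c.souriau (G p) 0 1 = y at *
      generalize c.souriau (G p) 1 1 = z at *
      linear_combination z * star z * h00 - z * star y * h01 + y * star y * h11
         - y * star z * h10 + h11
    · generalize c.souriau (G p) 0 0 = x at *
      generalize c.souriau (G p) 0 1 = y at *
      generalize c.souriau (G p) 1 1 = z at *
      linear_combination z * h00 + x * h11 - y * h10 - y * h01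
    · refine (norm_add_le _ _).trans ?_
      have h1 := hnorm _ _ h00
      have h2 := hnorm _ (c.souriau (G p) 0 1) (by rw [add_comm]; exact h11)
      linarith
  have hδn : ∀ p, ‖δ p‖ = 1 := fun p => by
    have h1 := congrArg norm (hrel p).1
    rw [norm_mul, norm_star, norm_one] at h1
    nlinarith [norm_nonneg (δ p)]
  have hδ0 : ∀ p, δ p ≠ 0 := fun p => by
    rw [← norm_ne_zero_iff, hδn]
    exact one_ne_zero
  obtain ⟨φ, hφ, -, h⟩ := exists_continuous_arg hδc hδ0 0 _
    (Complex.norm_mul_exp_arg_mul_I _).symm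
  have hexp : ∀ p, δ p = Complex.exp ((φ p / 2 : ℝ) * Complex.I) ^ 2 := fun p => by
    rw [h p, hδn, Complex.ofReal_one, one_mul, ← Complex.exp_nat_mul]
    push_cast
    ring_nf
  set x : ℝ × ℝ → ℝ := fun p => (τ p * Complex.exp (-((φ p / 2 : ℝ) * Complex.I))).re / 2 with hx
  have hxc : Continuous x := by fun_prop
  have hτx : ∀ p, τ p = 2 * x p * Complex.exp ((φ p / 2 : ℝ) * Complex.I) := fun p => by
    set u := Complex.exp ((φ p / 2 : ℝ) * Complex.I) with hu
    have hu0 : u ≠ 0 := Complex.exp_ne_zero _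
    have hustar : star u = u⁻¹ := by
      rw [hu, ← Complex.exp_neg, Complex.star_def, ← Complex.exp_conj, map_mul,
        Complex.conj_ofReal, Complex.conj_I, mul_neg]
    have h1 : star (τ p * u⁻¹) = τ p * u⁻¹ := by
      rw [star_mul', star_inv₀, hustar, inv_inv]
      have h2 := (hrel p).2.1
      rw [hexp p, ← hu] at h2
      rw [eq_mul_inv_iff_mul_eq₀ hu0]
      linear_combination h2
    have h2 : (((τ p * u⁻¹).re : ℝ) : ℂ) = τ p * u⁻¹ := by
      exact Complex.conj_eq_iff_re.1 h1
    simp only [hx, Complex.exp_neg, ← hu]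
    push_cast
    rw [h2]
    field_simp
  have hx1 : ∀ p, x p ∈ Icc (-1 : ℝ) 1 := fun p => by
    have h1 := (hrel p).2.2
    rw [hτx, norm_mul, Complex.norm_exp_ofReal_mul_I, mul_one, norm_mul, Complex.norm_real] at h1
    have h2 : |x p| ≤ 1 := by
      simp at h1
      exact h1
    exact abs_le.1 h2
  refine ⟨fun p => ![φ p / 2 + Real.arccos (x p), φ p / 2 - Real.arccos (x p)], ?_, fun p => ?_⟩
  · have h3 := Real.continuous_arccos.comp hxc
    refine continuous_pi fun j => ?_
    fin_cases j
    · exact (hφ.div_const 2).add h3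
    · exact (hφ.div_const 2).sub h3
  · refine isEigenangles_two ?_ (hexp p)
    rw [Real.cos_arccos (hx1 p).1 (hx1 p).2]
    exact hτx p

/-- The Robbin–Salamon index is the change of the index of the eigenangles. -/
theorem HasRSIndex.eq_angleIndex {c : UnitaryCoordinates ω V n} (hJ : JumpProperty c)
    (hLift : LiftProperty c) {Λ : ℝ → Submodule ℝ E} {a b : ℝ} (hab : a < b) {m : ℚ}
    (h : HasRSIndex ω Λ V a b m) {α : ℝ → Fin n → ℝ} (hα : ContinuousOn α (Icc a b))
    (hrep : ∀ t ∈ Icc a b, IsEigenangles (c.souriau (Λ t)) (α t)) :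
    m = angleIndex (α b) - angleIndex (α a) := by
  obtain ⟨Λ', ⟨F, hF, hFc, hF0, hF1, hFa, hFb⟩, hreg, hm⟩ := h
  -- Clamping both parameters extends the homotopy to all of `ℝ × ℝ`, where the angles lift
  -- globally.
  set u : ℝ → ℝ := fun s => (Set.projIcc (0 : ℝ) 1 zero_le_one s : ℝ) with hu
  set v : ℝ → ℝ := fun t => (Set.projIcc a b hab.le t : ℝ) with hv
  have hum : ∀ s, u s ∈ Icc (0 : ℝ) 1 := fun s => (Set.projIcc (0 : ℝ) 1 zero_le_one s).2
  have hvm : ∀ t, v t ∈ Icc a b := fun t => (Set.projIcc a b hab.le t).2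
  have hue : ∀ s ∈ Icc (0 : ℝ) 1, u s = s := fun s hs => by
    simp only [hu, Set.projIcc_of_mem zero_le_one hs]
  have hve : ∀ t ∈ Icc a b, v t = t := fun t ht => by
    simp only [hv, Set.projIcc_of_mem hab.le ht]
  have huc : Continuous u := continuous_subtype_val.comp continuous_projIcc
  have hvc : Continuous v := continuous_subtype_val.comp continuous_projIcc
  have hGc : Continuous fun p : ℝ × ℝ => proj (F (u p.1) (v p.2)) :=
    hFc.comp_continuous (f := fun p : ℝ × ℝ => (u p.1, v p.2)) (by fun_prop)
      fun p => ⟨hum _, hvm _⟩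
  obtain ⟨A, hA, hAe⟩ := hLift (fun p => F (u p.1) (v p.2)) (fun p => hF _ (hum _) _ (hvm _)) hGc
  have ha := left_mem_Icc.2 hab.le
  have hb := right_mem_Icc.2 hab.le
  have h0 : (0 : ℝ) ∈ Icc (0 : ℝ) 1 := left_mem_Icc.2 zero_le_one
  have h1 : (1 : ℝ) ∈ Icc (0 : ℝ) 1 := right_mem_Icc.2 zero_le_one
  have hrow : ∀ s, Continuous fun t => A (s, t) := fun s => by fun_prop
  have hcol : ∀ t, Continuous fun s => A (s, t) := fun t => by fun_prop
  have key1 : m = angleIndex (A (1, b)) - angleIndex (A (1, a)) := by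
    rw [← hm, crossingNumber]
    refine (hJ Λ' a b (fun t => A (1, t)) hab hreg (hrow 1).continuousOn
      fun t ht => ?_).sub_eq hab
    have := hAe (1, t)
    simpa only [hue 1 h1, hve t ht, hF1 t ht] using this
  have key2 : angleIndex (α b) - angleIndex (α a)
      = angleIndex (A (0, b)) - angleIndex (A (0, a)) := by
    refine angleIndex_sub_eq isPreconnected_Icc (w := fun t => c.souriau (Λ t)) hα
      (α' := fun t => A (0, t)) (hrow 0).continuousOn hrep (fun t ht => ?_) ha hb
    have := hAe (0, t)
    simpa only [hue 0 h0, hve t ht, hF0 t ht] using this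
  -- The end points stay fixed, so along `s` the matrix is constant, and comparison with constant
  -- angles shows that the index does not change.
  have key3 : ∀ t ∈ Icc a b, (∀ s ∈ Icc (0 : ℝ) 1, F s t = Λ t) →
      angleIndex (A (1, t)) - angleIndex (A (0, t)) = 0 := fun t ht hFt => by
    have h2 : ∀ s ∈ Icc (0 : ℝ) 1, IsEigenangles (c.souriau (Λ t)) (A (s, t)) := fun s hs => by
      have := hAe (s, t)
      simpa only [hue s hs, hve t ht, hFt s hs] using this
    have := angleIndex_sub_eq isPreconnected_Icc (w := fun _ => c.souriau (Λ t))
      (α := fun s => A (s, t)) (α' := fun _ => A (0, t)) (hcol t).continuousOn continuousOn_const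
      h2 (fun s _ => h2 0 h0) h0 h1
    rw [this, sub_self]
  have := key3 a ha hFa
  have := key3 b hb hFb
  linarith

/-- A regular representative has to be supplied, since `rsIndex` is `0` by default without one;
whichever value is then chosen is the angle count. -/
theorem rsIndex_eq_angleIndex {c : UnitaryCoordinates ω V n} (hJ : JumpProperty c)
    (hLift : LiftProperty c) {Λ Λ' : ℝ → Submodule ℝ E} {a b : ℝ} (hab : a < b)
    (hΛ : LagHomotopic ω Λ Λ' a b) (hΛ' : IsRegularPath ω Λ' V a b)
    {α : ℝ → Fin n → ℝ} (hα : ContinuousOn α (Icc a b))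
    (hrep : ∀ t ∈ Icc a b, IsEigenangles (c.souriau (Λ t)) (α t)) :
    rsIndex ω Λ V a b = angleIndex (α b) - angleIndex (α a) := by
  have h : ∃ m : ℚ, HasRSIndex ω Λ V a b m := ⟨_, Λ', hΛ, hΛ', rfl⟩
  rw [rsIndex, dif_pos h]
  exact h.choose_spec.eq_angleIndex hJ hLift hab hα hrep

end

/-! ### Explicit regular representatives and index formulas -/

noncomputable section

variable {E : Type*} [NormedAddCommGroup E] [InnerProductSpace ℝ E] [FiniteDimensional ℝ E]
  {ω : LinearMap.BilinForm ℝ E} {V : Submodule ℝ E} {n : ℕ}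

/-- Symmetric unitary matrices. -/
structure IsSymmUnitary (w : Fin n → Fin n → ℂ) : Prop where
  symm : ∀ i j, w i j = w j i
  unitary : ∀ i j, ∑ k, w i k * star (w k j) = if i = j then 1 else 0

namespace UnitaryCoordinates

variable (c : UnitaryCoordinates ω V n)

/-- The reflection as a continuous linear function of the matrix. -/
def reflectionCLM : (Fin n → Fin n → ℂ) →L[ℝ] (E →L[ℝ] E) :=
  LinearMap.toContinuousLinearMap c.reflection

lemma proj_ofSouriau_eq {w : Fin n → Fin n → ℂ} (hw : IsSymmUnitary w) :
    proj (c.ofSouriau w) = (2⁻¹ : ℝ) • (ContinuousLinearMap.id ℝ E + c.reflectionCLM w) :=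
  c.proj_ofSouriau hw.symm hw.unitary

lemma lagHomotopic_ofSouriau {Λ : ℝ → Submodule ℝ E} {a b : ℝ}
    (hΛ : ∀ t ∈ Icc a b, IsLagrangian ω (Λ t)) {w : ℝ → Fin n → Fin n → ℂ}
    {W : ℝ → ℝ → Fin n → Fin n → ℂ}
    (hW : ∀ s ∈ Icc (0 : ℝ) 1, ∀ t ∈ Icc a b, IsSymmUnitary (W s t))
    (hc : ContinuousOn (fun p : ℝ × ℝ => W p.1 p.2) (Icc (0 : ℝ) 1 ×ˢ Icc a b))
    (h0 : ∀ t ∈ Icc a b, W 0 t = c.souriau (Λ t)) (h1 : ∀ t ∈ Icc a b, W 1 t = w t)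
    (ha : ∀ s ∈ Icc (0 : ℝ) 1, W s a = W 0 a) (hb : ∀ s ∈ Icc (0 : ℝ) 1, W s b = W 0 b)
    (hab : a ≤ b) :
    LagHomotopic ω Λ (fun t => c.ofSouriau (w t)) a b := by
  have e0 : ∀ t ∈ Icc a b, c.ofSouriau (W 0 t) = Λ t := fun t ht => by
    rw [h0 t ht, c.ofSouriau_souriau (hΛ t ht)]
  refine ⟨fun s t => c.ofSouriau (W s t), fun s hs t ht =>
    c.isLagrangian_ofSouriau (hW s hs t ht).symm (hW s hs t ht).unitary, ?_, e0,
    fun t ht => by simp only [h1 t ht], fun s hs => ?_, fun s hs => ?_⟩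
  · have h2 : ContinuousOn (fun p : ℝ × ℝ => (2⁻¹ : ℝ) • (ContinuousLinearMap.id ℝ E
        + c.reflectionCLM (W p.1 p.2))) (Icc (0 : ℝ) 1 ×ˢ Icc a b) :=
      (show Continuous fun P : E →L[ℝ] E => (2⁻¹ : ℝ) • (ContinuousLinearMap.id ℝ E + P) by
        fun_prop).comp_continuousOn (c.reflectionCLM.continuous.comp_continuousOn hc)
    exact h2.congr fun p hp => c.proj_ofSouriau_eq (hW _ hp.1 _ hp.2)
  · simp only [ha s hs, e0 a (left_mem_Icc.2 hab)]
  · simp only [hb s hs, e0 b (right_mem_Icc.2 hab)]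

/-- Nondegeneracy is tested by a partner: by polarisation, a radical vector pairs to zero under `Im
w'` with every real fixed vector. -/
lemma isRegularPath_ofSouriau {w : ℝ → Fin n → Fin n → ℂ} {a b : ℝ} (hab : a < b)
    (hw : ContDiff ℝ 1 w) (hu : ∀ t, IsSymmUnitary (w t)) {w' : ℝ → Fin n → Fin n → ℂ}
    (hd : ∀ t i j, HasDerivAt (fun s => w s i j) (w' t i j) t)
    (hnd : ∀ t, ∀ x : Fin n → ℝ, x ≠ 0 → (∀ i, ∑ j, w t i j * (x j : ℂ) = x i) →
      ∃ y : Fin n → ℝ, (∀ i, ∑ j, w t i j * (y j : ℂ) = y i) ∧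
        ∑ i, ∑ j, x i * y j * (w' t i j).im ≠ 0) :
    IsRegularPath ω (fun t => c.ofSouriau (w t)) V a b := by
  have hproj : (fun t => proj (c.ofSouriau (w t)))
      = fun t => (2⁻¹ : ℝ) • (ContinuousLinearMap.id ℝ E + c.reflectionCLM (w t)) :=
    funext fun t => c.proj_ofSouriau_eq (hu t)
  have hcd : ContDiff ℝ 1 (fun t => proj (c.ofSouriau (w t))) := by
    rw [hproj]
    exact (contDiff_const.add (c.reflectionCLM.contDiff.comp hw)).const_smul _
  have hL : ∀ t, IsLagrangian ω (c.ofSouriau (w t)) := fun t =>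
    c.isLagrangian_ofSouriau (hu t).symm (hu t).unitary
  have hsou : ∀ t, c.souriau (c.ofSouriau (w t)) = w t := fun t =>
    c.souriau_ofSouriau (hu t).symm (hu t).unitary
  refine ⟨fun t _ => hL t, hcd.contDiffOn, fun t ht => ?_⟩
  have hdw : DifferentiableWithinAt ℝ (fun s => proj (c.ofSouriau (w s))) (Icc a b) t :=
    (hcd.differentiable one_ne_zero t).differentiableWithinAt
  have hdw' : ∀ i j, HasDerivWithinAt (fun s => c.souriau (c.ofSouriau (w s)) i j) (w' t i j)
      (Icc a b) t := fun i j => by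
    simp only [hsou]
    exact (hd t i j).hasDerivWithinAt
  have hsymm' : ∀ i j, w' t i j = w' t j i := fun i j => by
    refine (hd t i j).unique ?_
    have := hd t j i
    simp only [(hu _).symm j i] at this
    exact this
  have hQ := fun v => c.crossingForm_apply (Λ := fun t => c.ofSouriau (w t)) hab ht hdw hdw' v
  rw [QuadraticMap.nondegenerate_iff_radical_eq_bot, Submodule.eq_bot_iff]
  intro v hv
  by_contra hv0
  rw [QuadraticMap.mem_radical_iff'] at hv
  set x : Fin n → ℝ := fun j => (c.toEquiv v j).re with hx
  have hx0 : x ≠ 0 := by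
    intro h
    apply hv0
    apply Subtype.ext
    apply c.toEquiv.injective
    ext j
    rw [c.toEquiv_eq_ofReal v.2.2]
    have : (c.toEquiv v j).re = 0 := congrFun h j
    rw [this]
    simp
  have hxf := (c.mem_inf_iff (hL t) v.2.2).1 v.2
  rw [hsou] at hxf
  obtain ⟨y, hyf, hy⟩ := hnd t x hx0 hxf
  have hym : c.ofReal y ∈ c.ofSouriau (w t) ⊓ V := by
    rw [c.mem_inf_iff (hL t) (c.ofReal_mem y), hsou]
    simpa [c.toEquiv_ofReal] using hyf
  have h1 := hv.2 ⟨c.ofReal y, hym⟩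
  have h0 := hv.1
  rw [hQ] at h0
  rw [hQ, hQ] at h1
  have hadd : ∀ j, (c.toEquiv ((v + ⟨c.ofReal y, hym⟩ : ↥(c.ofSouriau (w t) ⊓ V)) : E) j).re
      = x j + y j := fun j => by
    rw [Submodule.coe_add, map_add, Pi.add_apply, Complex.add_re, c.toEquiv_ofReal]
    simp [hx]
  simp only [hadd, c.toEquiv_ofReal, Complex.ofReal_re] at h1
  apply hy
  have hswap : ∑ i, ∑ j, y i * x j * (w' t i j).im = ∑ i, ∑ j, x i * y j * (w' t i j).im := by
    rw [Finset.sum_comm]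
    refine Finset.sum_congr rfl fun i _ => Finset.sum_congr rfl fun j _ => ?_
    rw [hsymm' j i]
    ring
  have hexpand : ∑ i, ∑ j, (x i + y i) * (x j + y j) * (w' t i j).im
      = ∑ i, ∑ j, x i * x j * (w' t i j).im + ∑ i, ∑ j, x i * y j * (w' t i j).im
        + ∑ i, ∑ j, y i * x j * (w' t i j).im + ∑ i, ∑ j, y i * y j * (w' t i j).im := by
    simp only [← Finset.sum_add_distrib]
    refine Finset.sum_congr rfl fun i _ => Finset.sum_congr rfl fun j _ => ?_
    ring
  rw [hexpand, hswap] at h1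
  change 2⁻¹ * ∑ i, ∑ j, x i * x j * (w' t i j).im = 0 at h0
  linarith

end UnitaryCoordinates

lemma star_cexp (x : ℝ) :
    star (Complex.exp (x * Complex.I)) = (Complex.exp (x * Complex.I))⁻¹ := by
  rw [← Complex.exp_neg, Complex.star_def, ← Complex.exp_conj, map_mul, Complex.conj_ofReal,
    Complex.conj_I, mul_neg]

lemma hasDerivAt_cexp_mul (p t : ℝ) : HasDerivAt (fun s : ℝ => Complex.exp ((p * s : ℝ) * Complex.I))
    (p * Complex.I * Complex.exp ((p * t : ℝ) * Complex.I)) t := by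
  have h1 : HasDerivAt (fun s : ℝ => ((p * s : ℝ) : ℂ)) p t := by
    have := ((hasDerivAt_id t).const_mul p).ofReal_comp
    simpa using this
  have h2 := (h1.mul_const Complex.I).cexp
  refine h2.congr_deriv ?_
  ring

/-- The index of a path of Lagrangian lines is read off from the angle. -/
theorem rsIndex_one (c : UnitaryCoordinates ω V 1) {Λ : ℝ → Submodule ℝ E} {b : ℝ} (hb : 0 < b)
    (hΛ : ∀ t ∈ Icc 0 b, IsLagrangian ω (Λ t)) {φ : ℝ → ℝ} (hφ : ContinuousOn φ (Icc 0 b))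
    (hw : ∀ t ∈ Icc 0 b, c.souriau (Λ t) 0 0 = Complex.exp (φ t * Complex.I))
    (h0 : φ 0 = 0) (hne : φ b ≠ 0) :
    rsIndex ω Λ V 0 b = halfFloor (φ b) := by
  -- The representative is the linear angle path with the same ends; its slope is nonzero because `φ
  -- b ≠ 0`, so every crossing is regular.
  set p : ℝ := φ b / b with hp
  have hp0 : p ≠ 0 := div_ne_zero hne hb.ne'
  have hpb : p * b = φ b := div_mul_cancel₀ _ hb.ne'
  have hsu : ∀ x : ℝ, IsSymmUnitary (fun _ _ : Fin 1 => Complex.exp (x * Complex.I)) := fun x => by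
    refine ⟨fun _ _ => rfl, fun i j => ?_⟩
    rw [Subsingleton.elim i j, if_pos rfl, Fin.sum_univ_one, star_cexp,
      mul_inv_cancel₀ (Complex.exp_ne_zero _)]
  have hhom : LagHomotopic ω Λ
      (fun t => c.ofSouriau (fun _ _ => Complex.exp ((p * t : ℝ) * Complex.I))) 0 b := by
    refine c.lagHomotopic_ofSouriau hΛ (W := fun s t _ _ =>
      Complex.exp (((1 - s) * φ t + s * (p * t) : ℝ) * Complex.I)) (fun s _ t _ => hsu _) ?_ ?_ ?_
      ?_ ?_ hb.le
    · have h1 : ContinuousOn (fun q : ℝ × ℝ => φ q.2) (Icc (0 : ℝ) 1 ×ˢ Icc 0 b) :=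
        hφ.comp continuousOn_snd fun q hq => hq.2
      refine continuousOn_pi.2 fun _ => continuousOn_pi.2 fun _ => ?_
      refine Complex.continuous_exp.comp_continuousOn (ContinuousOn.mul ?_ continuousOn_const)
      refine Complex.continuous_ofReal.comp_continuousOn ?_
      exact ((continuousOn_const.sub continuousOn_fst).mul h1).add
        (continuousOn_fst.mul (continuousOn_const.mul continuousOn_snd))
    · intro t ht
      funext i j
      rw [Subsingleton.elim i 0, Subsingleton.elim j 0, hw t ht]
      simp
    · intro t _
      simp
    · intro s _
      simp [h0]
    · intro s _
      funext i j
      rw [hpb]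
      ring_nf
  have hreg : IsRegularPath ω
      (fun t => c.ofSouriau (fun _ _ => Complex.exp ((p * t : ℝ) * Complex.I))) V 0 b := by
    refine c.isRegularPath_ofSouriau hb ?_ (fun t => hsu _)
      (w' := fun t _ _ => p * Complex.I * Complex.exp ((p * t : ℝ) * Complex.I))
      (fun t i j => hasDerivAt_cexp_mul p t) ?_
    · refine contDiff_pi.2 fun _ => contDiff_pi.2 fun _ => ?_
      refine Complex.contDiff_exp.comp (ContDiff.mul ?_ contDiff_const)
      exact Complex.ofRealCLM.contDiff.comp (contDiff_const.mul contDiff_id)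
    · intro t x hx hfix
      refine ⟨x, hfix, ?_⟩
      have hx0 : x 0 ≠ 0 := by
        intro h
        apply hx
        ext j
        rw [Subsingleton.elim j 0, h]
        rfl
      have h1 := hfix 0
      rw [Fin.sum_univ_one] at h1
      have h2 : Complex.exp ((p * t : ℝ) * Complex.I) = 1 := by
        apply mul_right_cancel₀ (b := ((x 0 : ℝ) : ℂ)) (by exact_mod_cast hx0)
        rw [h1, one_mul]
      simp only [Fin.sum_univ_one, h2]
      simp [hx0, hp0]
  rw [rsIndex_eq_angleIndex (c := c) (jumpProperty_one c) (liftProperty_one c) hb hhom hreg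
    (α := fun t _ => φ t) (continuousOn_pi.2 fun _ => hφ) ?_]
  · simp only [angleIndex, Fin.sum_univ_one]
    rw [h0, halfFloor_of_eq (x := 0) 0 (by simp)]
    simp
  · intro t ht z
    simp [hw t ht]

/-- The matrix `exp (iψ) (√(1 - x² - y²) + i (x, y; y, -x))`. -/
def planeMatrix (ψ x y : ℝ) : Fin 2 → Fin 2 → ℂ :=
  ![![Complex.exp (ψ * Complex.I) * (Real.sqrt (1 - x ^ 2 - y ^ 2) + x * Complex.I),
      Complex.exp (ψ * Complex.I) * (y * Complex.I)],
    ![Complex.exp (ψ * Complex.I) * (y * Complex.I),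
      Complex.exp (ψ * Complex.I) * (Real.sqrt (1 - x ^ 2 - y ^ 2) - x * Complex.I)]]

lemma isSymmUnitary_planeMatrix {ψ x y : ℝ} (h : x ^ 2 + y ^ 2 ≤ 1) :
    IsSymmUnitary (planeMatrix ψ x y) := by
  have hs : (Real.sqrt (1 - x ^ 2 - y ^ 2) : ℂ) ^ 2 = 1 - x ^ 2 - y ^ 2 := by
    have := Real.sq_sqrt (show 0 ≤ 1 - x ^ 2 - y ^ 2 by linarith)
    exact_mod_cast this
  have hI := Complex.I_sq
  have hU := mul_inv_cancel₀ (Complex.exp_ne_zero (ψ * Complex.I))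
  constructor
  · intro i j
    fin_cases i <;> fin_cases j <;> rfl
  · intro i j
    rw [Fin.sum_univ_two]
    have hstar : ∀ r : ℝ, star (r : ℂ) = r := Complex.conj_ofReal
    have hstarI : star Complex.I = -Complex.I := Complex.conj_I
    fin_cases i <;> fin_cases j <;>
      simp only [planeMatrix, Fin.zero_eta, Fin.mk_one, Matrix.cons_val_zero, Matrix.cons_val_one,
        star_mul', star_add, star_sub, star_cexp, hstar, hstarI] <;>
      generalize (Real.sqrt (1 - x ^ 2 - y ^ 2) : ℂ) = r at * <;>
      generalize hu : Complex.exp (ψ * Complex.I) = U at *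
    · simp only [if_true]
      linear_combination (r ^ 2 - (x ^ 2 + y ^ 2) * Complex.I ^ 2) * hU + hs
        - (x ^ 2 + y ^ 2 : ℂ) * hI
    · simp only [zero_ne_one, if_false]
      ring
    · simp only [one_ne_zero, if_false]
      ring
    · simp only [if_true]
      linear_combination (r ^ 2 - (x ^ 2 + y ^ 2) * Complex.I ^ 2) * hU + hs
        - (x ^ 2 + y ^ 2 : ℂ) * hI

lemma continuous_planeMatrix :
    Continuous fun v : ℝ × ℝ × ℝ => planeMatrix v.1 v.2.1 v.2.2 := by
  refine continuous_pi fun i => continuous_pi fun j => ?_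
  fin_cases i <;> fin_cases j <;>
    simp only [planeMatrix, Fin.zero_eta, Fin.mk_one, Matrix.cons_val_zero, Matrix.cons_val_one] <;>
    fun_prop

lemma isEigenangles_planeMatrix {ψ x y : ℝ} (h : x ^ 2 + y ^ 2 ≤ 1) :
    IsEigenangles (planeMatrix ψ x y) ![ψ + Real.arccos (Real.sqrt (1 - x ^ 2 - y ^ 2)),
      ψ - Real.arccos (Real.sqrt (1 - x ^ 2 - y ^ 2))] := by
  have h1 : Real.sqrt (1 - x ^ 2 - y ^ 2) ≤ 1 := Real.sqrt_le_one.2 (by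
    nlinarith [sq_nonneg x, sq_nonneg y])
  have hs : (Real.sqrt (1 - x ^ 2 - y ^ 2) : ℂ) ^ 2 = 1 - x ^ 2 - y ^ 2 := by
    have := Real.sq_sqrt (show 0 ≤ 1 - x ^ 2 - y ^ 2 by linarith)
    exact_mod_cast this
  have h2 := Real.sqrt_nonneg (1 - x ^ 2 - y ^ 2)
  refine isEigenangles_two ?_ ?_
  · rw [Real.cos_arccos (by linarith) h1]
    simp [planeMatrix]
    ring
  · simp [planeMatrix]
    linear_combination Complex.exp (ψ * Complex.I) ^ 2 * hs
      - (x ^ 2 + y ^ 2 : ℂ) * Complex.exp (ψ * Complex.I) ^ 2 * Complex.I_sq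

/-- The matrix `exp (it(p + q (k, l; l, -k)))`, for `k² + l² = 1`. -/
def expMatrix (p q k l t : ℝ) : Fin 2 → Fin 2 → ℂ :=
  ![![Complex.exp ((p * t : ℝ) * Complex.I)
        * (Real.cos (q * t) + ((Real.sin (q * t) * k : ℝ) : ℂ) * Complex.I),
      Complex.exp ((p * t : ℝ) * Complex.I) * (((Real.sin (q * t) * l : ℝ) : ℂ) * Complex.I)],
    ![Complex.exp ((p * t : ℝ) * Complex.I) * (((Real.sin (q * t) * l : ℝ) : ℂ) * Complex.I),
      Complex.exp ((p * t : ℝ) * Complex.I)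
        * (Real.cos (q * t) - ((Real.sin (q * t) * k : ℝ) : ℂ) * Complex.I)]]

lemma isSymmUnitary_expMatrix (p q t : ℝ) {k l : ℝ} (hkl : k ^ 2 + l ^ 2 = 1) :
    IsSymmUnitary (expMatrix p q k l t) := by
  have hs : (Real.cos (q * t) : ℂ) ^ 2 + (Real.sin (q * t) : ℂ) ^ 2 = 1 := by
    exact_mod_cast Real.cos_sq_add_sin_sq (q * t)
  have hkl' : (k : ℂ) ^ 2 + (l : ℂ) ^ 2 = 1 := by exact_mod_cast hkl
  have hI := Complex.I_sq
  have hU := mul_inv_cancel₀ (Complex.exp_ne_zero ((p * t : ℝ) * Complex.I))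
  constructor
  · intro i j
    fin_cases i <;> fin_cases j <;> rfl
  · intro i j
    rw [Fin.sum_univ_two]
    have hstar : ∀ r : ℝ, star (r : ℂ) = r := Complex.conj_ofReal
    have hstarI : star Complex.I = -Complex.I := Complex.conj_I
    fin_cases i <;> fin_cases j <;>
      simp only [expMatrix, Fin.zero_eta, Fin.mk_one, Matrix.cons_val_zero, Matrix.cons_val_one,
        star_mul', star_add, star_sub, star_cexp, hstar, hstarI, Complex.ofReal_mul _ k,
        Complex.ofReal_mul _ l] <;>
      generalize (Real.cos (q * t) : ℂ) = C at * <;>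
      generalize (Real.sin (q * t) : ℂ) = S at * <;>
      generalize Complex.exp ((p * t : ℝ) * Complex.I) = U at *
    · simp only [if_true]
      linear_combination (C ^ 2 - S ^ 2 * (k ^ 2 + l ^ 2) * Complex.I ^ 2) * hU + hs
        - S ^ 2 * (k ^ 2 + l ^ 2) * hI + S ^ 2 * hkl'
    · simp only [zero_ne_one, if_false]
      ring
    · simp only [one_ne_zero, if_false]
      ring
    · simp only [if_true]
      linear_combination (C ^ 2 - S ^ 2 * (k ^ 2 + l ^ 2) * Complex.I ^ 2) * hU + hs
        - S ^ 2 * (k ^ 2 + l ^ 2) * hI + S ^ 2 * hkl'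

lemma contDiff_expMatrix (p q k l : ℝ) : ContDiff ℝ 1 (expMatrix p q k l) := by
  have h1 : ∀ f : ℝ → ℝ, ContDiff ℝ 1 f → ContDiff ℝ 1 (fun t => (f t : ℂ)) := fun f hf =>
    Complex.ofRealCLM.contDiff.comp hf
  have hU : ContDiff ℝ 1 fun t : ℝ => Complex.exp ((p * t : ℝ) * Complex.I) :=
    Complex.contDiff_exp.comp ((h1 _ (by fun_prop)).mul contDiff_const)
  have hC : ContDiff ℝ 1 fun t : ℝ => (Real.cos (q * t) : ℂ) := h1 _ (by fun_prop)
  have hS : ∀ r : ℝ, ContDiff ℝ 1 fun t : ℝ => ((Real.sin (q * t) * r : ℝ) : ℂ) * Complex.I :=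
    fun r => (h1 _ (by fun_prop)).mul contDiff_const
  refine contDiff_pi.2 fun i => contDiff_pi.2 fun j => ?_
  fin_cases i <;> fin_cases j
  · exact hU.mul (hC.add (hS k))
  · exact hU.mul (hS l)
  · exact hU.mul (hS l)
  · exact hU.mul (hC.sub (hS k))

/-- The derivative of `expMatrix`. -/
def expMatrixDeriv (p q k l t : ℝ) : Fin 2 → Fin 2 → ℂ := fun i j =>
  p * Complex.I * expMatrix p q k l t i j + Complex.exp ((p * t : ℝ) * Complex.I) *
    (![![-Real.sin (q * t) * q + Real.cos (q * t) * q * k * Complex.I,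
        Real.cos (q * t) * q * l * Complex.I],
      ![Real.cos (q * t) * q * l * Complex.I,
        -Real.sin (q * t) * q - Real.cos (q * t) * q * k * Complex.I]] : Fin 2 → Fin 2 → ℂ) i j

lemma hasDerivAt_expMatrix (p q k l t : ℝ) (i j : Fin 2) :
    HasDerivAt (fun s => expMatrix p q k l s i j) (expMatrixDeriv p q k l t i j) t := by
  have hU := hasDerivAt_cexp_mul p t
  have hq : HasDerivAt (fun s : ℝ => q * s) q t := by
    simpa using (hasDerivAt_id t).const_mul q
  have hC := (hq.cos).ofReal_comp
  have hS := fun r : ℝ => ((hq.sin.mul_const r).ofReal_comp).mul_const Complex.I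
  fin_cases i <;> fin_cases j
  · refine (hU.mul (hC.add (hS k))).congr_deriv ?_
    simp [expMatrixDeriv, expMatrix]
    ring
  · refine (hU.mul (hS l)).congr_deriv ?_
    simp [expMatrixDeriv, expMatrix]
    ring
  · refine (hU.mul (hS l)).congr_deriv ?_
    simp [expMatrixDeriv, expMatrix]
    ring
  · refine (hU.mul (hC.sub (hS k))).congr_deriv ?_
    simp [expMatrixDeriv, expMatrix]
    ring

/-- The matrix is `exp (itH)` with `H` real symmetric of determinant `p² - q² ≠ 0`. `H` preserves
the fixed vectors, and on them `W'` acts as `iH`, so pairing `x` with `y = H x` gives `|H x|² ≠ 0`.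
-/
lemma isRegularPath_expMatrix (c : UnitaryCoordinates ω V 2) {p q k l b : ℝ} (hb : 0 < b)
    (hkl : k ^ 2 + l ^ 2 = 1) (hpq : p ^ 2 ≠ q ^ 2) :
    IsRegularPath ω (fun t => c.ofSouriau (expMatrix p q k l t)) V 0 b := by
  refine c.isRegularPath_ofSouriau hb (contDiff_expMatrix p q k l)
    (fun t => isSymmUnitary_expMatrix p q t hkl) (fun t => hasDerivAt_expMatrix p q k l t) ?_
  intro t x hx hfix
  set y : Fin 2 → ℝ := ![(p + q * k) * x 0 + q * l * x 1, q * l * x 0 + (p - q * k) * x 1] with hy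
  have h0 := hfix 0
  have h1 := hfix 1
  rw [Fin.sum_univ_two] at h0 h1
  have hkl' : (k : ℂ) ^ 2 + (l : ℂ) ^ 2 = 1 := by exact_mod_cast hkl
  have e0 : (y 0 : ℂ) = (p + q * k) * x 0 + q * l * x 1 := by simp [hy]
  have e1 : (y 1 : ℂ) = q * l * x 0 + (p - q * k) * x 1 := by simp [hy]
  refine ⟨y, fun i => ?_, ?_⟩
  · rw [Fin.sum_univ_two, e0, e1]
    fin_cases i
    · simp only [Fin.zero_eta, e0]
      simp only [expMatrix, Matrix.cons_val_zero, Matrix.cons_val_one] at h0 h1 ⊢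
      push_cast at h0 h1 ⊢
      linear_combination (p + q * k) * h0 + q * l * h1
    · simp only [Fin.mk_one, e1]
      simp only [expMatrix, Matrix.cons_val_zero, Matrix.cons_val_one] at h0 h1 ⊢
      push_cast at h0 h1 ⊢
      linear_combination q * l * h0 + (p - q * k) * h1
  · have hd0 : expMatrixDeriv p q k l t 0 0 * x 0 + expMatrixDeriv p q k l t 1 0 * x 1
        = y 0 * Complex.I := by
      rw [e0]
      simp only [expMatrixDeriv, expMatrix, Matrix.cons_val_zero, Matrix.cons_val_one] at h0 h1 ⊢
      push_cast at h0 h1 ⊢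
      linear_combination (p + q * k) * Complex.I * h0 + q * l * Complex.I * h1
        - Complex.exp (p * t * Complex.I) * Complex.sin (q * t) * q * x 0 * Complex.I ^ 2 * hkl'
        - Complex.exp (p * t * Complex.I) * Complex.sin (q * t) * q * x 0 * Complex.I_sq
    have hd1 : expMatrixDeriv p q k l t 0 1 * x 0 + expMatrixDeriv p q k l t 1 1 * x 1
        = y 1 * Complex.I := by
      rw [e1]
      simp only [expMatrixDeriv, expMatrix, Matrix.cons_val_zero, Matrix.cons_val_one] at h0 h1 ⊢
      push_cast at h0 h1 ⊢
      linear_combination q * l * Complex.I * h0 + (p - q * k) * Complex.I * h1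
        - Complex.exp (p * t * Complex.I) * Complex.sin (q * t) * q * x 1 * Complex.I ^ 2 * hkl'
        - Complex.exp (p * t * Complex.I) * Complex.sin (q * t) * q * x 1 * Complex.I_sq
    have hi0 := congrArg Complex.im hd0
    have hi1 := congrArg Complex.im hd1
    simp only [Complex.add_im, Complex.im_mul_ofReal, Complex.im_ofReal_mul, Complex.I_im,
      mul_one] at hi0 hi1
    have hsum : ∑ i, ∑ j, x i * y j * (expMatrixDeriv p q k l t i j).im = y 0 ^ 2 + y 1 ^ 2 := by
      simp only [Fin.sum_univ_two]
      linear_combination y 0 * hi0 + y 1 * hi1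
    rw [hsum]
    intro hzero
    have hy0 : y 0 = 0 := by nlinarith [sq_nonneg (y 0), sq_nonneg (y 1)]
    have hy1 : y 1 = 0 := by nlinarith [sq_nonneg (y 0), sq_nonneg (y 1)]
    have hdet : p ^ 2 - q ^ 2 ≠ 0 := sub_ne_zero.2 hpq
    have f0 : (p + q * k) * x 0 + q * l * x 1 = 0 := hy0
    have f1 : q * l * x 0 + (p - q * k) * x 1 = 0 := hy1
    apply hx
    ext j
    apply mul_left_cancel₀ hdet
    fin_cases j
    · change (p ^ 2 - q ^ 2) * x 0 = (p ^ 2 - q ^ 2) * 0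
      linear_combination (p - q * k) * f0 - q * l * f1 + q ^ 2 * x 0 * hkl
    · change (p ^ 2 - q ^ 2) * x 1 = (p ^ 2 - q ^ 2) * 0
      linear_combination (p + q * k) * f1 - q * l * f0 + q ^ 2 * x 1 * hkl

/-- On `[0, π/2]` the cosine is nonnegative and so equals the square root in `planeMatrix`. -/
lemma planeMatrix_eq_expMatrix {p q k l t : ℝ} (hkl : k ^ 2 + l ^ 2 = 1)
    (hq : q * t ∈ Icc 0 (Real.pi / 2)) :
    planeMatrix (p * t) (Real.sin (q * t) * k) (Real.sin (q * t) * l) = expMatrix p q k l t := by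
  have h1 : Real.sqrt (1 - (Real.sin (q * t) * k) ^ 2 - (Real.sin (q * t) * l) ^ 2)
      = Real.cos (q * t) := by
    have h2 : 1 - (Real.sin (q * t) * k) ^ 2 - (Real.sin (q * t) * l) ^ 2
        = Real.cos (q * t) ^ 2 := by
      linear_combination (-Real.sin (q * t) ^ 2) * hkl - Real.cos_sq_add_sin_sq (q * t)
    rw [h2, Real.sqrt_sq]
    exact Real.cos_nonneg_of_mem_Icc ⟨by linarith [hq.1, Real.pi_pos], hq.2⟩
  simp only [planeMatrix, expMatrix, h1]

lemma sq_add_sq_le_one_of_convex {x y x' y' s : ℝ} (hs : s ∈ Icc (0 : ℝ) 1) (h : x ^ 2 + y ^ 2 ≤ 1)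
    (h' : x' ^ 2 + y' ^ 2 ≤ 1) :
    ((1 - s) * x + s * x') ^ 2 + ((1 - s) * y + s * y') ^ 2 ≤ 1 := by
  have h3 : 0 ≤ s * (1 - s) := mul_nonneg hs.1 (by linarith [hs.2])
  have h4 : ((1 - s) * x + s * x') ^ 2 + ((1 - s) * y + s * y') ^ 2 = (1 - s) * (x ^ 2 + y ^ 2)
      + s * (x' ^ 2 + y' ^ 2) - s * (1 - s) * ((x - x') ^ 2 + (y - y') ^ 2) := by ring
  rw [h4]
  have h5 := mul_le_mul_of_nonneg_left h (by linarith [hs.2] : 0 ≤ 1 - s)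
  have h6 := mul_le_mul_of_nonneg_left h' hs.1
  have h7 : 0 ≤ s * (1 - s) * ((x - x') ^ 2 + (y - y') ^ 2) := by positivity
  linarith

lemma continuousOn_interpolation {f g : ℝ → ℝ} {a b : ℝ} (hf : ContinuousOn f (Icc a b))
    (hg : ContinuousOn g (Icc a b)) :
    ContinuousOn (fun q : ℝ × ℝ => (1 - q.1) * f q.2 + q.1 * g q.2)
      (Icc (0 : ℝ) 1 ×ˢ Icc a b) := by
  have hsnd : ∀ f : ℝ → ℝ, ContinuousOn f (Icc a b) →
      ContinuousOn (fun q : ℝ × ℝ => f q.2) (Icc (0 : ℝ) 1 ×ˢ Icc a b) := fun f hf =>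
    hf.comp continuousOn_snd fun q hq => hq.2
  exact ((continuousOn_const.sub continuousOn_fst).mul (hsnd f hf)).add
    (continuousOn_fst.mul (hsnd g hg))

/-- The parameters `(ψ, x, y)` range over the convex set `ℝ × disc`, so linear interpolation is a
homotopy. -/
lemma lagHomotopic_planeMatrix (c : UnitaryCoordinates ω V 2) {Λ : ℝ → Submodule ℝ E} {a b : ℝ}
    (hab : a ≤ b) (hΛ : ∀ t ∈ Icc a b, IsLagrangian ω (Λ t)) {ψ x y ψ' x' y' : ℝ → ℝ}
    (hψ : ContinuousOn ψ (Icc a b)) (hx : ContinuousOn x (Icc a b)) (hy : ContinuousOn y (Icc a b))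
    (hψ' : ContinuousOn ψ' (Icc a b)) (hx' : ContinuousOn x' (Icc a b))
    (hy' : ContinuousOn y' (Icc a b))
    (hxy : ∀ t ∈ Icc a b, x t ^ 2 + y t ^ 2 ≤ 1) (hxy' : ∀ t ∈ Icc a b, x' t ^ 2 + y' t ^ 2 ≤ 1)
    (hw : ∀ t ∈ Icc a b, c.souriau (Λ t) = planeMatrix (ψ t) (x t) (y t))
    (ha : ψ a = ψ' a ∧ x a = x' a ∧ y a = y' a) (hb : ψ b = ψ' b ∧ x b = x' b ∧ y b = y' b)
    {w : ℝ → Fin 2 → Fin 2 → ℂ} (hw' : ∀ t ∈ Icc a b, w t = planeMatrix (ψ' t) (x' t) (y' t)) :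
    LagHomotopic ω Λ (fun t => c.ofSouriau (w t)) a b := by
  have hmix : ∀ s u : ℝ, (1 - s) * u + s * u = u := fun s u => by ring
  refine c.lagHomotopic_ofSouriau hΛ (W := fun s t => planeMatrix ((1 - s) * ψ t + s * ψ' t)
    ((1 - s) * x t + s * x' t) ((1 - s) * y t + s * y' t)) (fun s hs t ht =>
    isSymmUnitary_planeMatrix (sq_add_sq_le_one_of_convex hs (hxy t ht) (hxy' t ht)))
    ?_ ?_ ?_ ?_ ?_ hab
  · exact Continuous.comp_continuousOn (g := fun v : ℝ × ℝ × ℝ => planeMatrix v.1 v.2.1 v.2.2)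
      (f := fun q : ℝ × ℝ => ((1 - q.1) * ψ q.2 + q.1 * ψ' q.2,
        (1 - q.1) * x q.2 + q.1 * x' q.2, (1 - q.1) * y q.2 + q.1 * y' q.2))
      continuous_planeMatrix ((continuousOn_interpolation hψ hψ').prodMk
        ((continuousOn_interpolation hx hx').prodMk (continuousOn_interpolation hy hy')))
  · intro t ht
    rw [hw t ht]
    simp only [sub_zero, one_mul, zero_mul, add_zero]
  · intro t ht
    rw [hw' t ht]
    simp only [sub_self, one_mul, zero_mul, zero_add]
  · intro s _
    simp only [ha.1, ha.2.1, ha.2.2, hmix]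
  · intro s _
    simp only [hb.1, hb.2.1, hb.2.2, hmix]

lemma exists_polar {x y s : ℝ} (h : s ^ 2 = x ^ 2 + y ^ 2) :
    ∃ k l : ℝ, k ^ 2 + l ^ 2 = 1 ∧ x = s * k ∧ y = s * l := by
  by_cases hs : s = 0
  · rw [hs] at h
    refine ⟨1, 0, by norm_num, ?_, ?_⟩
    · rw [hs]
      nlinarith [sq_nonneg x, sq_nonneg y]
    · rw [hs]
      nlinarith [sq_nonneg x, sq_nonneg y]
  · refine ⟨x / s, y / s, ?_, ?_, ?_⟩
    · field_simp
      linarith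
    · field_simp
    · field_simp

/-- The index of a path of Lagrangian planes that is given by points `(ψ, x, y)` with
`x² + y² < 1`. -/
theorem rsIndex_two (c : UnitaryCoordinates ω V 2) {Λ : ℝ → Submodule ℝ E} {b : ℝ} (hb : 0 < b)
    (hΛ : ∀ t ∈ Icc 0 b, IsLagrangian ω (Λ t)) {ψ x y : ℝ → ℝ} (hψ : ContinuousOn ψ (Icc 0 b))
    (hx : ContinuousOn x (Icc 0 b)) (hy : ContinuousOn y (Icc 0 b))
    (hxy : ∀ t ∈ Icc 0 b, x t ^ 2 + y t ^ 2 ≤ 1)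
    (hw : ∀ t ∈ Icc 0 b, c.souriau (Λ t) = planeMatrix (ψ t) (x t) (y t))
    (hψ0 : ψ 0 = 0) (hx0 : x 0 = 0) (hy0 : y 0 = 0) {β : ℝ}
    (hβ : β = Real.arccos (Real.sqrt (1 - x b ^ 2 - y b ^ 2))) (hne : ψ b ^ 2 ≠ β ^ 2) :
    rsIndex ω Λ V 0 b = halfFloor (ψ b + β) + halfFloor (ψ b - β) := by
  have h0m : (0 : ℝ) ∈ Icc 0 b := left_mem_Icc.2 hb.le
  have hbm : b ∈ Icc 0 b := right_mem_Icc.2 hb.le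
  set r := Real.sqrt (1 - x b ^ 2 - y b ^ 2) with hr
  have hr0 : 0 ≤ r := Real.sqrt_nonneg _
  have hr1 : r ≤ 1 := Real.sqrt_le_one.2 (by nlinarith [sq_nonneg (x b), sq_nonneg (y b)])
  have hr2 : r ^ 2 = 1 - x b ^ 2 - y b ^ 2 := Real.sq_sqrt (by linarith [hxy b hbm])
  have hβ0 : 0 ≤ β := hβ ▸ Real.arccos_nonneg r
  have hβ1 : β ≤ Real.pi / 2 := by
    rw [hβ, Real.arccos_le_pi_div_two]
    exact hr0
  have hcos : Real.cos β = r := by rw [hβ, Real.cos_arccos (by linarith) hr1]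
  have hsin : Real.sin β ^ 2 = x b ^ 2 + y b ^ 2 := by
    have := Real.sin_sq_add_cos_sq β
    rw [hcos, hr2] at this
    linarith
  -- Polar coordinates of the end point, with radius `sin β`. Running the phase to `ψ b` and the
  -- radius angle to `β` at constant speeds `p`, `q` ends at the prescribed matrix; `hne` makes this
  -- path regular.
  obtain ⟨k, l, hkl, hxk, hyl⟩ := exists_polar hsin
  set p := ψ b / b with hp
  set q := β / b with hq
  have hpb : p * b = ψ b := div_mul_cancel₀ _ hb.ne'
  have hqb : q * b = β := div_mul_cancel₀ _ hb.ne'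
  have hqt : ∀ t ∈ Icc 0 b, q * t ∈ Icc 0 (Real.pi / 2) := fun t ht => by
    have hq0 : 0 ≤ q := div_nonneg hβ0 hb.le
    refine ⟨mul_nonneg hq0 ht.1, ?_⟩
    calc q * t ≤ q * b := mul_le_mul_of_nonneg_left ht.2 hq0
      _ ≤ _ := by rw [hqb]; exact hβ1
  have hpq : p ^ 2 ≠ q ^ 2 := by
    rw [hp, hq, div_pow, div_pow]
    intro h
    exact hne ((div_left_inj' (pow_ne_zero 2 hb.ne')).1 h)
  have hhom : LagHomotopic ω Λ (fun t => c.ofSouriau (expMatrix p q k l t)) 0 b := by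
    refine lagHomotopic_planeMatrix c hb.le hΛ hψ hx hy (ψ' := fun t => p * t)
      (x' := fun t => Real.sin (q * t) * k) (y' := fun t => Real.sin (q * t) * l)
      (by fun_prop) (by fun_prop) (by fun_prop) hxy (fun t _ => ?_) hw ?_ ?_
      (fun t ht => (planeMatrix_eq_expMatrix hkl (hqt t ht)).symm)
    · have : (Real.sin (q * t) * k) ^ 2 + (Real.sin (q * t) * l) ^ 2 = Real.sin (q * t) ^ 2 := by
        linear_combination Real.sin (q * t) ^ 2 * hkl
      rw [this]
      exact Real.sin_sq_le_one _
    · simp [hψ0, hx0, hy0]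
    · simp only [hpb, hqb]
      exact ⟨trivial, hxk, hyl⟩
  rw [rsIndex_eq_angleIndex (c := c) (jumpProperty_two c) (liftProperty_two c) hb hhom
    (isRegularPath_expMatrix c hb hkl hpq)
    (α := fun t => ![ψ t + Real.arccos (Real.sqrt (1 - x t ^ 2 - y t ^ 2)),
      ψ t - Real.arccos (Real.sqrt (1 - x t ^ 2 - y t ^ 2))]) ?_ ?_]
  · simp only [angleIndex, Fin.sum_univ_two, Matrix.cons_val_zero, Matrix.cons_val_one, hψ0, hx0,
      hy0]
    rw [← hr, ← hβ]
    have : Real.arccos (Real.sqrt (1 - 0 ^ 2 - 0 ^ 2)) = 0 := by simp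
    rw [this, add_zero, sub_zero, halfFloor_of_eq (x := 0) 0 (by simp)]
    simp
  · have h1 : ContinuousOn (fun t => Real.arccos (Real.sqrt (1 - x t ^ 2 - y t ^ 2)))
        (Icc 0 b) :=
      Real.continuous_arccos.comp_continuousOn (Real.continuous_sqrt.comp_continuousOn
        ((continuousOn_const.sub (hx.pow 2)).sub (hy.pow 2)))
    refine continuousOn_pi.2 fun j => ?_
    fin_cases j
    · exact hψ.add h1
    · exact hψ.sub h1
  · intro t ht
    rw [hw t ht]
    exact isEigenangles_planeMatrix (hxy t ht)

end

/-! ### The two concrete symplectic spaces and their Souriau matrices -/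

noncomputable section

/-- The standard coordinates `x + iy`. -/
def stdCoordinates (n : ℕ) : UnitaryCoordinates (stdForm n) (realSubspace n) n where
  toEquiv :=
    { toFun := fun v j => (v (Sum.inl j) : ℂ) + (v (Sum.inr j) : ℂ) * Complex.I
      map_add' := fun v w => by
        ext j
        simp
        ring
      map_smul' := fun r v => by
        ext j
        simp
        ring
      invFun := fun z => WithLp.toLp 2 (Sum.elim (fun j => (z j).re) (fun j => (z j).im))
      left_inv := fun v => by
        ext j
        rcases j with j | j <;> simp
      right_inv := fun z => by
        ext j
        simp }
  inner_eq v w := by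
    rw [Complex.re_sum, PiLp.inner_apply, Fintype.sum_sum_type, ← Finset.sum_add_distrib]
    refine Finset.sum_congr rfl fun j _ => ?_
    simp
    ring
  form_eq v w := by
    change ∑ j, (v (Sum.inl j) * w (Sum.inr j) - v (Sum.inr j) * w (Sum.inl j)) = _
    rw [Complex.im_sum]
    refine Finset.sum_congr rfl fun j _ => ?_
    simp
    ring
  mem_iff v := by
    have h : ∀ j, ((v (Sum.inl j) : ℂ) + (v (Sum.inr j) : ℂ) * Complex.I).im = v (Sum.inr j) :=
      fun j => by simp
    change v ∈ realSubspace n ↔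
      ∀ j, ((v (Sum.inl j) : ℂ) + (v (Sum.inr j) : ℂ) * Complex.I).im = 0
    simp only [h]
    rw [realSubspace, LinearMap.mem_eqLocus, LinearMap.id_apply]
    constructor
    · intro h1 j
      have h2 := congrArg (fun u : R2 n => u (Sum.inr j)) h1
      simp [conj, Matrix.toEuclideanLin, Matrix.fromBlocks, Matrix.mulVec, dotProduct,
        Matrix.one_apply] at h2
      linarith
    · intro h1
      ext j
      rcases j with j | j <;>
        simp [conj, Matrix.toEuclideanLin, Matrix.fromBlocks, Matrix.mulVec, dotProduct,
          Matrix.one_apply, h1]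

lemma stdCoordinates_apply {n : ℕ} (v : R2 n) (j : Fin n) : (stdCoordinates n).toEquiv v j
    = (v (Sum.inl j) : ℂ) + (v (Sum.inr j) : ℂ) * Complex.I := rfl

/-- Maximality of `L` and isotropy of `L'` suffice, so no dimension count is needed. -/
lemma isLagrangian_eq_of_le {E : Type*} [NormedAddCommGroup E] [InnerProductSpace ℝ E]
    {ω : LinearMap.BilinForm ℝ E} {L L' : Submodule ℝ E}
    (hL : ∀ x, (∀ y ∈ L, ω x y = 0) → x ∈ L) (hL' : IsLagrangian ω L') (h : L ≤ L') : L = L' :=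
  le_antisymm h fun x hx => hL x fun y hy => (hL' x).1 hx y (h hy)

section PlaneEntries

/-- The four entries of a symplectic `2 × 2` matrix. -/
def ea (A : Sp 1) : ℝ := A.1 (Sum.inl 0) (Sum.inl 0)

/-- The upper right entry. -/
def eb (A : Sp 1) : ℝ := A.1 (Sum.inl 0) (Sum.inr 0)

/-- The lower left entry. -/
def ec (A : Sp 1) : ℝ := A.1 (Sum.inr 0) (Sum.inl 0)

/-- The lower right entry. -/
def ed (A : Sp 1) : ℝ := A.1 (Sum.inr 0) (Sum.inr 0)

lemma continuous_entry (i j : Fin 1 ⊕ Fin 1) : Continuous fun A : Sp 1 => A.1 i j :=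
  continuous_subtype_val.matrix_elem i j

lemma continuous_ea : Continuous ea := continuous_entry _ _

lemma continuous_eb : Continuous eb := continuous_entry _ _

lemma continuous_ec : Continuous ec := continuous_entry _ _

lemma continuous_ed : Continuous ed := continuous_entry _ _

lemma det_entries (A : Sp 1) : ea A * ed A - eb A * ec A = 1 := by
  have h := congrFun (congrFun A.2 (Sum.inr 0)) (Sum.inl 0)
  simp [Matrix.mul_apply, Matrix.J, Matrix.fromBlocks, Fintype.sum_sum_type] at h
  simp only [ea, eb, ec, ed]
  linarith

lemma act_inl (A : Sp 1) (v : R2 1) :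
    act A v (Sum.inl 0) = ea A * v (Sum.inl 0) + eb A * v (Sum.inr 0) := by
  simp [act, Matrix.toEuclideanLin, Matrix.mulVec, dotProduct, Fintype.sum_sum_type, ea, eb]

lemma act_inr (A : Sp 1) (v : R2 1) :
    act A v (Sum.inr 0) = ec A * v (Sum.inl 0) + ed A * v (Sum.inr 0) := by
  simp [act, Matrix.toEuclideanLin, Matrix.mulVec, dotProduct, Fintype.sum_sum_type, ec, ed]

/-- The vector with coordinates `x` and `y`. -/
def vec2 (x y : ℝ) : R2 1 := WithLp.toLp 2 (Sum.elim (fun _ => x) (fun _ => y))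

lemma vec2_inl (x y : ℝ) : vec2 x y (Sum.inl 0) = x := rfl

lemma vec2_inr (x y : ℝ) : vec2 x y (Sum.inr 0) = y := rfl

lemma r2_ext {v w : R2 1} (h0 : v (Sum.inl 0) = w (Sum.inl 0)) (h1 : v (Sum.inr 0) = w (Sum.inr 0)) :
    v = w := by
  ext j
  rcases j with j | j <;> rw [Subsingleton.elim j 0]
  · exact h0
  · exact h1

end PlaneEntries

/-- The line `A ℝ` in terms of the argument of its first column. -/
lemma map_realSubspace_eq (A : Sp 1) {r θ : ℝ}
    (h : (ea A : ℂ) + ec A * Complex.I = r * Complex.exp (θ * Complex.I)) :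
    (realSubspace 1).map (act A)
      = (stdCoordinates 1).ofSouriau (fun _ _ => Complex.exp ((2 * θ : ℝ) * Complex.I)) := by
  have hdet := det_entries A
  set U := Complex.exp (θ * Complex.I) with hU
  have hU0 : U ≠ 0 := Complex.exp_ne_zero _
  have h2 : Complex.exp ((2 * θ : ℝ) * Complex.I) = U ^ 2 := by
    rw [hU, ← Complex.exp_nat_mul]
    push_cast
    ring_nf
  have hstar : (ea A : ℂ) - ec A * Complex.I = r * U⁻¹ := by
    have := congrArg star h
    rw [star_add, star_mul', star_mul', hU, star_cexp] at this
    simp only [Complex.star_def, Complex.conj_ofReal, Complex.conj_I] at this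
    rw [← this]
    ring
  -- The line of direction `exp (iθ)` consists of the `z` with `z = exp (2iθ) z̄`; this is why the
  -- angle doubles.
  have hmem : ∀ v : R2 1, v ∈ (stdCoordinates 1).ofSouriau (fun _ _ => U ^ 2) ↔
      (v (Sum.inl 0) : ℂ) + v (Sum.inr 0) * Complex.I
        = U ^ 2 * (v (Sum.inl 0) - v (Sum.inr 0) * Complex.I) := fun v => by
    rw [UnitaryCoordinates.mem_ofSouriau, ← (stdCoordinates 1).toEquiv.injective.eq_iff,
      UnitaryCoordinates.toEquiv_reflection_apply, eq_comm, funext_iff]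
    simp [stdCoordinates_apply, Matrix.mulVec, dotProduct, ← sub_eq_add_neg]
  rw [h2]
  ext v
  rw [hmem, Submodule.mem_map]
  constructor
  · rintro ⟨w, hw, rfl⟩
    have hw0 : w (Sum.inr 0) = 0 := by
      have := ((stdCoordinates 1).mem_iff w).1 hw 0
      simpa [stdCoordinates_apply] using this
    rw [act_inl, act_inr, hw0]
    push_cast
    have e1 : ((ea A : ℂ) * w (Sum.inl 0) + eb A * 0) + (ec A * w (Sum.inl 0) + ed A * 0) * Complex.I
      = w (Sum.inl 0) * (ea A + ec A * Complex.I) := by ring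
    have e2 : ((ea A : ℂ) * w (Sum.inl 0) + eb A * 0) - (ec A * w (Sum.inl 0) + ed A * 0) * Complex.I
      = w (Sum.inl 0) * (ea A - ec A * Complex.I) := by ring
    rw [e1, e2, h, hstar]
    field_simp
  · intro hv
    -- `z U⁻¹` is real, hence `ω (v, A e₁) = 0`
    have hreal : (ea A : ℝ) * v (Sum.inr 0) - ec A * v (Sum.inl 0) = 0 := by
      have h3 : ((v (Sum.inl 0) : ℂ) + v (Sum.inr 0) * Complex.I) * (ea A - ec A * Complex.I)
          = (v (Sum.inl 0) - v (Sum.inr 0) * Complex.I) * (ea A + ec A * Complex.I) := by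
        rw [hv, hstar, h]
        field_simp
      have h4 := congrArg Complex.im h3
      simp at h4
      linarith
    have hn : 0 < ea A ^ 2 + ec A ^ 2 := by
      by_contra hn
      have h5 : ea A = 0 := by nlinarith [sq_nonneg (ea A), sq_nonneg (ec A)]
      have h6 : ec A = 0 := by nlinarith [sq_nonneg (ea A), sq_nonneg (ec A)]
      rw [h5, h6] at hdet
      simp at hdet
    refine ⟨vec2 ((ea A * v (Sum.inl 0) + ec A * v (Sum.inr 0)) / (ea A ^ 2 + ec A ^ 2)) 0, ?_, ?_⟩
    · rw [(stdCoordinates 1).mem_iff]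
      intro j
      rw [Subsingleton.elim j 0, stdCoordinates_apply, vec2_inl, vec2_inr,
        Complex.ofReal_zero, zero_mul, add_zero, Complex.ofReal_im]
    · apply r2_ext
      · rw [act_inl, vec2_inl, vec2_inr]
        field_simp
        linear_combination (ec A) * hreal
      · rw [act_inr, vec2_inl, vec2_inr]
        field_simp
        linear_combination (-ea A) * hreal

lemma isSymmUnitary_cexp (x : ℝ) :
    IsSymmUnitary (fun _ _ : Fin 1 => Complex.exp (x * Complex.I)) := by
  refine ⟨fun _ _ => rfl, fun i j => ?_⟩
  rw [Subsingleton.elim i j, if_pos rfl, Fin.sum_univ_one, star_cexp,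
    mul_inv_cancel₀ (Complex.exp_ne_zero _)]

/-- The index of `Ψ ℝ` in terms of the argument of the first column. -/
theorem rsIndexSp_eq {Ψ : ℝ → Sp 1} {b : ℝ} (hb : 0 < b) {θ : ℝ → ℝ} (hθ : Continuous θ)
    (h : ∀ t, (ea (Ψ t) : ℂ) + ec (Ψ t) * Complex.I
      = ‖(ea (Ψ t) : ℂ) + ec (Ψ t) * Complex.I‖ * Complex.exp (θ t * Complex.I))
    (h0 : θ 0 = 0) (hne : θ b ≠ 0) :
    rsIndexSp Ψ (realSubspace 1) 0 b = halfFloor (2 * θ b) := by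
  rw [rsIndexSp]
  have hsu := isSymmUnitary_cexp
  refine rsIndex_one (stdCoordinates 1) hb (φ := fun t => 2 * θ t) (fun t _ => ?_)
    (by fun_prop) (fun t _ => ?_) (by simp [h0]) (by simpa using hne)
  · rw [map_realSubspace_eq _ (h t)]
    exact (stdCoordinates 1).isLagrangian_ofSouriau (hsu _).symm (hsu _).unitary
  · rw [map_realSubspace_eq _ (h t), (stdCoordinates 1).souriau_ofSouriau (hsu _).symm
      (hsu _).unitary]

/-- The number `1 / √2`. -/
def invSqrtTwo : ℝ := (Real.sqrt 2)⁻¹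

lemma invSqrtTwo_mul_self : invSqrtTwo * invSqrtTwo = 1 / 2 := by
  rw [invSqrtTwo, ← mul_inv, Real.mul_self_sqrt zero_le_two, one_div]

lemma invSqrtTwo_ne_zero : invSqrtTwo ≠ 0 := by
  rw [invSqrtTwo]
  positivity

/-- Unitary coordinates on `ℝ² × ℝ²` in which the antidiagonal is real. -/
def prodCoordinates : UnitaryCoordinates (prodForm 1) (antidiag 1) 2 where
  toEquiv :=
    -- The real parts come from the difference of the two components, the imaginary parts from their
    -- sum turned by a right angle; the latter vanish exactly on the antidiagonal.
    { toFun := fun v =>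
        ![invSqrtTwo * (((v.fst (Sum.inl 0) - v.snd (Sum.inl 0) : ℝ) : ℂ)
            - ((v.fst (Sum.inr 0) + v.snd (Sum.inr 0) : ℝ) : ℂ) * Complex.I),
          invSqrtTwo * (((v.fst (Sum.inr 0) - v.snd (Sum.inr 0) : ℝ) : ℂ)
            + ((v.fst (Sum.inl 0) + v.snd (Sum.inl 0) : ℝ) : ℂ) * Complex.I)]
      map_add' := fun v w => by
        ext j
        fin_cases j <;> simp <;> ring
      map_smul' := fun r v => by
        ext j
        fin_cases j <;> simp <;> ring
      invFun := fun z => WithLp.toLp 2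
        (vec2 (invSqrtTwo * ((z 0).re + (z 1).im)) (invSqrtTwo * ((z 1).re - (z 0).im)),
          vec2 (invSqrtTwo * ((z 1).im - (z 0).re)) (invSqrtTwo * (-(z 0).im - (z 1).re)))
      left_inv := fun v => by
        have h := invSqrtTwo_mul_self
        apply WithLp.ofLp_injective
        refine Prod.ext (r2_ext ?_ ?_) (r2_ext ?_ ?_) <;> simp [vec2_inl, vec2_inr] <;>
          grind
      right_inv := fun z => by
        have h := invSqrtTwo_mul_self
        ext j
        fin_cases j <;> apply Complex.ext <;> simp [vec2_inl, vec2_inr] <;> grind }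
  inner_eq v w := by
    have h := invSqrtTwo_mul_self
    simp [WithLp.prod_inner_apply, PiLp.inner_apply, Fintype.sum_sum_type, Fin.sum_univ_two]
    grind
  form_eq v w := by
    have h := invSqrtTwo_mul_self
    simp [prodForm, stdForm, Fin.sum_univ_two]
    grind
  mem_iff v := by
    have h := invSqrtTwo_ne_zero
    rw [antidiag, LinearMap.mem_eqLocus, Fin.forall_fin_two]
    simp [h]
    constructor
    · intro h1
      rw [h1]
      simp
    · intro h1
      apply r2_ext
      · simp
        linarith [h1.2]
      · simp
        linarith [h1.1]

lemma prodCoordinates_zero (v : R2Prod 1) : prodCoordinates.toEquiv v 0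
    = invSqrtTwo * (((v.fst (Sum.inl 0) - v.snd (Sum.inl 0) : ℝ) : ℂ)
            - ((v.fst (Sum.inr 0) + v.snd (Sum.inr 0) : ℝ) : ℂ) * Complex.I) := rfl

lemma prodCoordinates_one (v : R2Prod 1) : prodCoordinates.toEquiv v 1
    = invSqrtTwo * (((v.fst (Sum.inr 0) - v.snd (Sum.inr 0) : ℝ) : ℂ)
            + ((v.fst (Sum.inl 0) + v.snd (Sum.inl 0) : ℝ) : ℂ) * Complex.I) := rfl

lemma mem_grBar {A : Sp 1} {v : R2Prod 1} : v ∈ grBar A ↔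
    v.snd (Sum.inl 0) = -(ea A * v.fst (Sum.inl 0) + eb A * v.fst (Sum.inr 0)) ∧
      v.snd (Sum.inr 0) = -(ec A * v.fst (Sum.inl 0) + ed A * v.fst (Sum.inr 0)) := by
  have h : v ∈ grBar A ↔ v.snd = -(act A v.fst) := Iff.rfl
  rw [h, ← act_inl, ← act_inr]
  constructor
  · intro h1
    rw [h1]
    exact ⟨rfl, rfl⟩
  · rintro ⟨h1, h2⟩
    exact r2_ext h1 h2

lemma grBar_maximal (A : Sp 1) (v : R2Prod 1) (h : ∀ w ∈ grBar A, prodForm 1 v w = 0) :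
    v ∈ grBar A := by
  have hdet := det_entries A
  have h1 := h (WithLp.toLp 2 (vec2 1 0, -act A (vec2 1 0))) rfl
  have h2 := h (WithLp.toLp 2 (vec2 0 1, -act A (vec2 0 1))) rfl
  simp [prodForm, stdForm, act_inl, act_inr, vec2_inl, vec2_inr] at h1 h2
  rw [mem_grBar]
  constructor <;> grind

/-- The complex linear part of a real `2 × 2` matrix. -/
def linearPart (A : Sp 1) : ℂ := (((ea A + ed A) / 2 : ℝ) : ℂ) + ((ec A - eb A) / 2 : ℝ) * Complex.I

lemma continuous_linearPart : Continuous linearPart := by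
  have h1 := continuous_ea
  have h2 := continuous_eb
  have h3 := continuous_ec
  have h4 := continuous_ed
  unfold linearPart
  fun_prop

/-- The squared norms of the complex linear and antilinear parts differ by the determinant, which is
`1`. In particular the linear part never vanishes and has a continuous argument. -/
lemma normSq_linearPart (A : Sp 1) :
    ‖linearPart A‖ ^ 2 = 1 + ((ea A - ed A) ^ 2 + (eb A + ec A) ^ 2) / 4 := by
  have hdet := det_entries A
  rw [← Complex.normSq_eq_norm_sq, linearPart, Complex.normSq_add_mul_I]
  linear_combination hdet

lemma one_le_norm_linearPart (A : Sp 1) : 1 ≤ ‖linearPart A‖ := by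
  have h := normSq_linearPart A
  by_contra! h1
  nlinarith [norm_nonneg (linearPart A), sq_nonneg (ea A - ed A), sq_nonneg (eb A + ec A)]

lemma norm_linearPart_pos (A : Sp 1) : 0 < ‖linearPart A‖ :=
  zero_lt_one.trans_le (one_le_norm_linearPart A)

/-- The first coordinate of the antilinear part. -/
def antiX (A : Sp 1) : ℝ := (eb A + ec A) / (2 * ‖linearPart A‖)

/-- The second coordinate of the antilinear part. -/
def antiY (A : Sp 1) : ℝ := (ed A - ea A) / (2 * ‖linearPart A‖)

lemma one_sub_antiX_antiY (A : Sp 1) : 1 - antiX A ^ 2 - antiY A ^ 2 = (1 / ‖linearPart A‖) ^ 2 := by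
  have h := normSq_linearPart A
  have h0 := (norm_linearPart_pos A).ne'
  rw [antiX, antiY]
  field_simp
  linear_combination 4 * h

lemma antiX_sq_add_le (A : Sp 1) : antiX A ^ 2 + antiY A ^ 2 ≤ 1 := by
  have h := one_sub_antiX_antiY A
  linarith [sq_nonneg (1 / ‖linearPart A‖)]

lemma sqrt_one_sub_anti (A : Sp 1) :
    Real.sqrt (1 - antiX A ^ 2 - antiY A ^ 2) = 1 / ‖linearPart A‖ := by
  rw [one_sub_antiX_antiY, Real.sqrt_sq (by positivity)]

lemma continuous_antiX : Continuous antiX :=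
  (continuous_eb.add continuous_ec).div (continuous_const.mul continuous_linearPart.norm)
    fun A => mul_ne_zero two_ne_zero (norm_linearPart_pos A).ne'

lemma continuous_antiY : Continuous antiY :=
  (continuous_ed.sub continuous_ea).div (continuous_const.mul continuous_linearPart.norm)
    fun A => mul_ne_zero two_ne_zero (norm_linearPart_pos A).ne'

/-- The twisted graph of `A` in unitary coordinates. -/
lemma grBar_eq (A : Sp 1) {ψ : ℝ}
    (h : linearPart A = ‖linearPart A‖ * Complex.exp (ψ * Complex.I)) :
    grBar A = prodCoordinates.ofSouriau (planeMatrix ψ (antiX A) (antiY A)) := by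
  have hsu := isSymmUnitary_planeMatrix (ψ := ψ) (antiX_sq_add_le A)
  refine isLagrangian_eq_of_le (grBar_maximal A)
    (prodCoordinates.isLagrangian_ofSouriau hsu.symm hsu.unitary) fun v hv => ?_
  obtain ⟨h1, h2⟩ := mem_grBar.1 hv
  have hdet := det_entries A
  have hN := norm_linearPart_pos A
  have hs := sqrt_one_sub_anti A
  set U := Complex.exp (ψ * Complex.I) with hU
  have hU0 : U ≠ 0 := Complex.exp_ne_zero _
  set N := ‖linearPart A‖ with hNdef
  have hNC : (N : ℂ) ≠ 0 := Complex.ofReal_ne_zero.2 hN.ne'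
  -- Multiplying the equation `z = W z̄` by the conjugate of the linear part cancels the phase `U`
  -- and makes it polynomial in the entries of `A`.
  have hbar : star (linearPart A) * U = N := by
    rw [h, star_mul', hU, star_cexp]
    simp
  have hbar0 : star (linearPart A) ≠ 0 := fun h0 => hNC (by rw [← hbar, h0, zero_mul])
  have hX : (antiX A : ℂ) = (eb A + ec A) / (2 * N) := by
    rw [antiX, ← hNdef]
    push_cast
    rfl
  have hY : (antiY A : ℂ) = (ed A - ea A) / (2 * N) := by
    rw [antiY, ← hNdef]
    push_cast
    rfl
  have hl : star (linearPart A) = (ea A + ed A) / 2 - (ec A - eb A) / 2 * Complex.I := by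
    rw [linearPart]
    simp
    ring
  have e00 : star (linearPart A) * (U * ((1 / N : ℝ) + antiX A * Complex.I))
      = 1 + (eb A + ec A) / 2 * Complex.I := by
    rw [← mul_assoc, hbar, hX]
    push_cast
    field_simp
  have e01 : star (linearPart A) * (U * (antiY A * Complex.I)) = (ed A - ea A) / 2 * Complex.I := by
    rw [← mul_assoc, hbar, hY]
    field_simp
  have e11 : star (linearPart A) * (U * ((1 / N : ℝ) - antiX A * Complex.I))
      = 1 - (eb A + ec A) / 2 * Complex.I := by
    rw [← mul_assoc, hbar, hX]
    push_cast
    field_simp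
  rw [UnitaryCoordinates.mem_ofSouriau, ← prodCoordinates.toEquiv.injective.eq_iff,
      UnitaryCoordinates.toEquiv_reflection_apply, eq_comm, funext_iff, Fin.forall_fin_two]
  constructor
  · apply mul_left_cancel₀ hbar0
    simp only [Matrix.mulVec, dotProduct, Fin.sum_univ_two, planeMatrix, hs, Matrix.of_apply,
      Pi.star_apply, Matrix.cons_val_zero, Matrix.cons_val_one, mul_add (star (linearPart A)), ← hU]
    rw [← mul_assoc _ (U * _), ← mul_assoc _ (U * _), e00, e01,
      prodCoordinates_zero, prodCoordinates_one, hl, h1, h2]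
    simp
    apply Complex.ext <;> simp <;> grind
  · apply mul_left_cancel₀ hbar0
    simp only [Matrix.mulVec, dotProduct, Fin.sum_univ_two, planeMatrix, hs, Matrix.of_apply,
      Pi.star_apply, Matrix.cons_val_zero, Matrix.cons_val_one, mul_add (star (linearPart A)), ← hU]
    rw [← mul_assoc _ (U * _), ← mul_assoc _ (U * _), e01, e11,
      prodCoordinates_zero, prodCoordinates_one, hl, h1, h2]
    simp
    apply Complex.ext <;> simp <;> grind

/-- For determinant one, `det (A - 1) = 2 - tr A`. At trace `2` the vector `(b, 1 - a)` is fixed, or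
`(0, 1)` if that one is zero. -/
lemma finrank_ker_act_sub_id {A : Sp 1}
    (h : Module.finrank ℝ (LinearMap.ker (act A - LinearMap.id)) = 0) : ea A + ed A ≠ 2 := by
  intro htr
  have hdet := det_entries A
  rw [Submodule.finrank_eq_zero, LinearMap.ker_eq_bot'] at h
  have key : ∀ x y, ea A * x + eb A * y = x → ec A * x + ed A * y = y → x = 0 ∧ y = 0 := by
    intro x y h1 h2
    have h3 := h (vec2 x y) (by
      rw [LinearMap.sub_apply, LinearMap.id_apply, sub_eq_zero]
      apply r2_ext
      · rw [act_inl, vec2_inl, vec2_inr, h1]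
      · rw [act_inr, vec2_inl, vec2_inr, h2])
    exact ⟨congrArg (fun v : R2 1 => v (Sum.inl 0)) h3,
      congrArg (fun v : R2 1 => v (Sum.inr 0)) h3⟩
  obtain ⟨h1, h2⟩ := key (eb A) (1 - ea A) (by ring) (by linear_combination -hdet + htr)
  have h3 := key 0 1 (by rw [h1]; ring) (by linarith)
  exact one_ne_zero h3.2

/-- The Conley–Zehnder index of a planar path in terms of the argument of its complex linear
part. -/
theorem czIndex_eq {Ψ : ℝ → Sp 1} (hΨ : Continuous Ψ) (h1 : Ψ 0 = 1) {T : ℝ} (hT : 0 < T)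
    {φ : ℝ → ℝ} (hφ : Continuous φ)
    (h : ∀ t, linearPart (Ψ t) = ‖linearPart (Ψ t)‖ * Complex.exp (φ t * Complex.I))
    (h0 : φ 0 = 0) {β : ℝ} (hβ : β = Real.arccos (1 / ‖linearPart (Ψ T)‖))
    (hne : φ T ^ 2 ≠ β ^ 2) :
    czIndex Ψ T = halfFloor (φ T + β) + halfFloor (φ T - β) := by
  have hsu := fun t => isSymmUnitary_planeMatrix (ψ := φ t) (antiX_sq_add_le (Ψ t))
  have e1 : ea 1 = 1 := by simp [ea]
  have e2 : eb 1 = 0 := by simp [eb]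
  have e3 : ec 1 = 0 := by simp [ec]
  have e4 : ed 1 = 1 := by simp [ed]
  refine rsIndex_two prodCoordinates hT (fun t _ => ?_) hφ.continuousOn
    (continuous_antiX.comp hΨ).continuousOn (continuous_antiY.comp hΨ).continuousOn
    (fun t _ => antiX_sq_add_le (Ψ t)) (fun t _ => ?_) h0 ?_ ?_ ?_ hne
  · rw [grBar_eq _ (h t)]
    exact prodCoordinates.isLagrangian_ofSouriau (hsu t).symm (hsu t).unitary
  · rw [grBar_eq _ (h t)]
    exact prodCoordinates.souriau_ofSouriau (hsu t).symm (hsu t).unitary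
  · simp [antiX, h1, e2, e3]
  · simp [antiY, h1, e1, e4]
  · rw [hβ, Function.comp_apply, Function.comp_apply, sqrt_one_sub_anti]

end

/-! ### Comparison of arguments in the plane -/

noncomputable section

lemma polar_form {x y r θ : ℝ} (h : (x : ℂ) + y * Complex.I = r * Complex.exp (θ * Complex.I)) :
    x = r * Real.cos θ ∧ y = r * Real.sin θ := by
  rw [Complex.exp_mul_I, ← Complex.ofReal_cos, ← Complex.ofReal_sin] at h
  have h1 := congrArg Complex.re h
  have h2 := congrArg Complex.im h
  simp at h1 h2
  exact ⟨h1, h2⟩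

lemma eq_of_cexp_eq {f g : ℝ → ℝ} (hf : Continuous f) (hg : Continuous g) (h0 : f 0 = g 0)
    (h : ∀ t, Complex.exp (f t * Complex.I) = Complex.exp (g t * Complex.I)) (t : ℝ) :
    f t = g t := by
  have h1 := IsPreconnected.eq_of_int_valued (S := univ) isPreconnected_univ
    (f := fun t => (f t - g t) / (2 * Real.pi)) (by fun_prop) (fun s _ => by
      obtain ⟨k, hk⟩ := Complex.exp_eq_exp_iff_exists_int.1 (h s)
      refine ⟨k, ?_⟩
      have h2 : (f s : ℂ) = g s + k * (2 * Real.pi) := by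
        apply mul_right_cancel₀ Complex.I_ne_zero
        rw [hk]
        ring
      have h3 : f s = g s + k * (2 * Real.pi) := by exact_mod_cast h2
      have := Real.pi_ne_zero
      rw [h3]
      field_simp
      ring) (mem_univ t) (mem_univ 0)
  simp only [h0, sub_self, zero_div, div_eq_zero_iff, Real.two_pi_pos.ne', or_false] at h1
  linarith

lemma cexp_eq_cexp_of_polar {z : ℂ} (hz : z ≠ 0) {x y : ℝ}
    (hx : z = ‖z‖ * Complex.exp (x * Complex.I)) (hy : z = ‖z‖ * Complex.exp (y * Complex.I)) :
    Complex.exp (x * Complex.I) = Complex.exp (y * Complex.I) := by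
  refine mul_left_cancel₀ (Complex.ofReal_ne_zero.2 (norm_ne_zero_iff.2 hz)) ?_
  rw [← hx, ← hy]

lemma abs_lt_pi_of_cos_ne {f : ℝ → ℝ} (hf : Continuous f) (h0 : f 0 = 0)
    (h : ∀ t, Real.cos (f t) ≠ -1) (t : ℝ) : |f t| < Real.pi := by
  by_contra! hn
  have h1 : Real.pi ∈ range fun t => |f t| := by
    refine mem_range_of_exists_le_of_exists_ge hf.abs ⟨0, ?_⟩ ⟨t, hn⟩
    rw [h0, abs_zero]
    exact Real.pi_nonneg
  obtain ⟨s, hs⟩ := h1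
  apply h s
  rw [← Real.cos_abs, show |f s| = Real.pi from hs, Real.cos_pi]

/-- The other intervals `(πm, π(m + 1))` on which the sine has the same sign are farther than `π`
from `x`. -/
lemma mem_Ioo_of_sin_mul_pos {x y : ℝ} {k : ℤ}
    (hx : x ∈ Ioo (Real.pi * k) (Real.pi * (k + 1))) (hxy : |x - y| < Real.pi)
    (h : 0 < Real.sin x * Real.sin y) : y ∈ Ioo (Real.pi * k) (Real.pi * (k + 1)) := by
  obtain ⟨hx1, hx2⟩ := hx
  obtain ⟨h1, h2⟩ := abs_lt.1 hxy
  have hsx := Real.sin_pos_of_pos_of_lt_pi (x := x - k * Real.pi) (by linarith) (by linarith)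
  have hs : 0 < Real.sin (x - k * Real.pi) * Real.sin (y - k * Real.pi) := by
    rw [Real.sin_sub_int_mul_pi, Real.sin_sub_int_mul_pi]
    rcases Int.even_or_odd k with hk | hk
    · rw [hk.neg_one_zpow]
      linarith
    · rw [hk.neg_one_zpow]
      linarith
  have hsy := pos_of_mul_pos_right hs hsx.le
  constructor
  · by_contra! hn
    have := Real.sin_nonneg_of_nonneg_of_le_pi (x := -(y - k * Real.pi)) (by linarith)
      (by linarith)
    rw [Real.sin_neg] at this
    linarith
  · by_contra! hn
    have := Real.sin_nonneg_of_nonneg_of_le_pi (x := y - k * Real.pi - Real.pi) (by linarith)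
      (by linarith)
    rw [Real.sin_sub_pi] at this
    linarith

/-- If `cos φ < cos β` the two half-integer contributions lie in the same window. -/
lemma halfFloor_add_sub_of_cos_lt {φ β : ℝ} {k : ℤ}
    (hφ : φ ∈ Ioo (2 * Real.pi * k) (2 * Real.pi * (k + 1))) (hβ0 : 0 ≤ β) (hβ1 : β ≤ Real.pi)
    (h : Real.cos φ < Real.cos β) : halfFloor (φ + β) + halfFloor (φ - β) = 2 * k + 1 := by
  obtain ⟨h1, h2⟩ := hφ
  have hc : Real.cos (φ - k * (2 * Real.pi)) = Real.cos φ := Real.cos_sub_int_mul_two_pi φ k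
  have hc' : Real.cos (2 * Real.pi - (φ - k * (2 * Real.pi))) = Real.cos φ := by
    rw [Real.cos_two_pi_sub, hc]
  have h3 : β < φ - k * (2 * Real.pi) := by
    by_contra! hn
    have := Real.cos_le_cos_of_nonneg_of_le_pi (by linarith) hβ1 hn
    linarith
  have h4 : β < 2 * Real.pi - (φ - k * (2 * Real.pi)) := by
    by_contra! hn
    have := Real.cos_le_cos_of_nonneg_of_le_pi (by linarith) hβ1 hn
    linarith
  rw [halfFloor_of_mem k ⟨by linarith, by linarith⟩, halfFloor_of_mem k ⟨by linarith, by linarith⟩]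
  ring

/-- If `cos φ > cos β` the two half-integer contributions lie in adjacent windows. -/
lemma halfFloor_add_sub_of_lt_cos {φ β : ℝ} {m : ℤ}
    (hφ : |φ - 2 * Real.pi * m| ≤ Real.pi) (hβ0 : 0 ≤ β) (hβ1 : β ≤ Real.pi)
    (h : Real.cos β < Real.cos φ) : halfFloor (φ + β) + halfFloor (φ - β) = 2 * m := by
  have hc : Real.cos |φ - 2 * Real.pi * m| = Real.cos φ := by
    rw [Real.cos_abs, mul_comm, Real.cos_sub_int_mul_two_pi φ m]
  have h1 : |φ - 2 * Real.pi * m| < β := by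
    by_contra! hn
    have := Real.cos_le_cos_of_nonneg_of_le_pi hβ0 hφ hn
    linarith
  obtain ⟨h2, h3⟩ := abs_lt.1 h1
  rw [halfFloor_of_mem m ⟨by linarith, by linarith⟩, halfFloor_of_mem (m - 1)
    ⟨by push_cast; linarith, by push_cast; linarith⟩]
  push_cast
  ring

/-- Comparison of the two angle counts for a matrix with entries `a, b, c, d`. -/
lemma halfFloor_comparison {a b c d r s u θ p q β : ℝ} (hdet : a * d - b * c = 1) (hbc : b * c ≠ 0)
    (hr : 0 < r) (hs : 0 < s) (hu : 0 < u) (hcθ : c = r * Real.sin θ)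
    (hdp : d = s * Real.cos p) (hcp : c = s * Real.sin p) (haq : a = u * Real.cos q)
    (hbq : -b = u * Real.sin q) (hθp : |θ - p| < Real.pi) (hpq : |p - q| < Real.pi)
    (hβ : β = Real.arccos (1 / (s * u))) :
    θ ≠ 0 ∧ (p + q) ^ 2 ≠ β ^ 2 ∧ ∃ k : ℤ, halfFloor (2 * θ) = k + 1 / 2 ∧
      |halfFloor (p + q + β) + halfFloor (p + q - β) - (2 * k + 1)| ≤ 1 := by
  have hb0 : b ≠ 0 := left_ne_zero_of_mul hbc
  have hc0 : c ≠ 0 := right_ne_zero_of_mul hbc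
  have hsu : 0 < s * u := mul_pos hs hu
  have hsθ : Real.sin θ ≠ 0 := fun h => hc0 (by rw [hcθ, h, mul_zero])
  have hθ0 : θ ≠ 0 := fun h => hsθ (by rw [h, Real.sin_zero])
  have hs2 : s ^ 2 = c ^ 2 + d ^ 2 := by
    rw [hcp, hdp]
    linear_combination (-s ^ 2) * Real.sin_sq_add_cos_sq p
  have hu2 : u ^ 2 = a ^ 2 + b ^ 2 := by
    rw [show b ^ 2 = (-b) ^ 2 by ring, haq, hbq]
    linear_combination (-u ^ 2) * Real.sin_sq_add_cos_sq q
  have hsu1 : 1 ≤ s * u := by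
    -- `(a² + b²)(c² + d²) = (ac + bd)² + (ad - bc)²`, and the last square is `1`.
    have : 1 ≤ (s * u) ^ 2 := by
      rw [mul_pow, hs2, hu2]
      nlinarith [sq_nonneg (a * c + b * d)]
    by_contra! hn
    nlinarith
  have hcβ : Real.cos β = 1 / (s * u) := by
    rw [hβ, Real.cos_arccos]
    · linarith [one_div_pos.2 hsu]
    · rw [div_le_one hsu]
      exact hsu1
  have hβ0 : 0 ≤ β := hβ ▸ Real.arccos_nonneg _
  have hβ1 : β ≤ Real.pi := hβ ▸ Real.arccos_le_pi _
  -- Against `cos β = 1 / (su)`, the sign of `bc` decides which cosine is larger.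
  have hcφ : Real.cos (p + q) = (1 + 2 * (b * c)) / (s * u) := by
    rw [eq_div_iff hsu.ne', Real.cos_add]
    have e1 : Real.cos p * Real.cos q * (s * u) = a * d := by
      rw [haq, hdp]
      ring
    have e2 : Real.sin p * Real.sin q * (s * u) = -(b * c) := by
      rw [show -(b * c) = (-b) * c by ring, hbq, hcp]
      ring
    linear_combination e1 - e2 + hdet
  have hdiff : Real.cos (p + q) - Real.cos β = 2 * (b * c) / (s * u) := by
    rw [hcφ, hcβ]
    ring
  refine ⟨hθ0, fun h => ?_, ?_⟩
  · have h1 : Real.cos (p + q) = Real.cos β := by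
      rw [← Real.cos_abs (p + q), ← Real.cos_abs β, (sq_eq_sq_iff_abs_eq_abs _ _).1 h]
    rw [h1, sub_self] at hdiff
    exact (div_ne_zero (mul_ne_zero two_ne_zero hbc) hsu.ne') hdiff.symm
  obtain ⟨k, hk⟩ := exists_mem_Ioo_two_pi (x := 2 * θ) (fun k hk => hsθ (by
    rw [show θ = k * Real.pi by linarith, Real.sin_int_mul_pi]))
  have hθk : θ ∈ Ioo (Real.pi * k) (Real.pi * (k + 1)) :=
    ⟨by linarith [hk.1], by linarith [hk.2]⟩
  have hpk := mem_Ioo_of_sin_mul_pos hθk hθp (by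
    have e : r * s * (Real.sin θ * Real.sin p) = c ^ 2 := by
      rw [sq]
      nth_rewrite 1 [hcθ]
      rw [hcp]
      ring
    exact pos_of_mul_pos_right (e ▸ sq_pos_of_ne_zero hc0) (mul_pos hr hs).le)
  refine ⟨k, halfFloor_of_mem k hk, ?_⟩
  -- If `bc < 0`, the sines of `p` and `q` agree in sign, so `p + q` lies between `2πk` and `2π(k +
  -- 1)` and the count is `2k + 1`. If `bc > 0`, then `p + q` is within `π` of one of these two
  -- multiples and the count is `2k` or `2k + 2`.
  rcases hbc.lt_or_gt with hneg | hpos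
  · have hqk := mem_Ioo_of_sin_mul_pos hpk hpq (by
      have e : s * u * (Real.sin p * Real.sin q) = -(b * c) := by
        rw [show -(b * c) = (-b) * c by ring, hbq, hcp]
        ring
      exact pos_of_mul_pos_right (e ▸ neg_pos.2 hneg) hsu.le)
    rw [halfFloor_add_sub_of_cos_lt (k := k) ⟨by linarith [hpk.1, hqk.1], by linarith [hpk.2, hqk.2]⟩
      hβ0 hβ1]
    · simp
    · rw [← sub_neg, hdiff]
      exact div_neg_of_neg_of_pos (by linarith) hsu
  · have hlt : Real.cos β < Real.cos (p + q) := by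
      rw [← sub_pos, hdiff]
      exact div_pos (by linarith) hsu
    obtain ⟨h1, h2⟩ := abs_lt.1 hpq
    obtain ⟨h3, h4⟩ := hpk
    rcases le_total (p + q) (Real.pi * (2 * k + 1)) with h5 | h5
    · rw [halfFloor_add_sub_of_lt_cos (m := k) (abs_le.2 ⟨by linarith, by linarith⟩) hβ0 hβ1 hlt]
      ring_nf
      norm_num
    · rw [halfFloor_add_sub_of_lt_cos (m := k + 1) (abs_le.2 ⟨by push_cast; linarith,
        by push_cast; linarith⟩) hβ0 hβ1 hlt]
      push_cast
      ring_nf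
      norm_num

/-! ### The symmetric path at half the period -/

section Entries

variable (A B : Sp 1)

lemma ea_one : ea 1 = 1 := by simp [ea]

lemma eb_one : eb 1 = 0 := by simp [eb]

lemma ec_one : ec 1 = 0 := by simp [ec]

lemma ed_one : ed 1 = 1 := by simp [ed]

lemma ea_mul : ea (A * B) = ea A * ea B + eb A * ec B := by
  simp [ea, eb, ec, Matrix.mul_apply, Fintype.sum_sum_type]

lemma eb_mul : eb (A * B) = ea A * eb B + eb A * ed B := by
  simp [ea, eb, ed, Matrix.mul_apply, Fintype.sum_sum_type]

lemma ec_mul : ec (A * B) = ec A * ea B + ed A * ec B := by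
  simp [ea, ec, ed, Matrix.mul_apply, Fintype.sum_sum_type]

lemma ed_mul : ed (A * B) = ec A * eb B + ed A * ed B := by
  simp [eb, ec, ed, Matrix.mul_apply, Fintype.sum_sum_type]

lemma entries_of_conj {A B : Sp 1} (h : B.1 = conj 1 * A.1 * conj 1) :
    ea B = ea A ∧ eb B = -eb A ∧ ec B = -ec A ∧ ed B = ed A := by
  simp [ea, eb, ec, ed, h, conj, Matrix.mul_apply, Fintype.sum_sum_type]

/-- The complex linear part of `A⁻¹ B`. -/
def relLinearPart : ℂ :=
  (((ed A * ea B - eb A * ec B - ec A * eb B + ea A * ed B) / 2 : ℝ) : ℂ)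
    + ((ea A * ec B - ec A * ea B - ed A * eb B + eb A * ed B) / 2 : ℝ) * Complex.I

/-- If it vanished, `A⁻¹ B` would be antilinear and its determinant at most zero instead of `1`. -/
lemma relLinearPart_ne_zero : relLinearPart A B ≠ 0 := by
  intro h
  have h1 := congrArg Complex.re h
  have h2 := congrArg Complex.im h
  simp [relLinearPart] at h1 h2
  have hA := det_entries A
  have hB := det_entries B
  have h3 : (ed A * ea B - eb A * ec B) * (ea A * ed B - ec A * eb B)
      - (ed A * eb B - eb A * ed B) * (ea A * ec B - ec A * ea B) = 1 := by
    linear_combination (ea B * ed B - eb B * ec B) * hA + hB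
  have h4 : ea A * ed B - ec A * eb B = -(ed A * ea B - eb A * ec B) := by linarith
  have h5 : ea A * ec B - ec A * ea B = ed A * eb B - eb A * ed B := by linarith
  rw [h4, h5] at h3
  nlinarith [sq_nonneg (ed A * ea B - eb A * ec B), sq_nonneg (ed A * eb B - eb A * ed B)]

lemma relLinearPart_one : relLinearPart 1 B = linearPart B := by
  simp [relLinearPart, linearPart, ea_one, eb_one, ec_one, ed_one]

lemma relLinearPart_mul : relLinearPart A (A * B) = linearPart B := by
  have h := det_entries A
  rw [relLinearPart, linearPart, ea_mul, eb_mul, ec_mul, ed_mul]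
  congr 2
  · congr 1
    linear_combination (ea B + ed B) * h
  · congr 1
    linear_combination ((ec B - eb B) / 2) * h

/-- This factorisation is where the symmetry of the path enters: it splits the argument for the full
period into two arguments at half the period. -/
lemma relLinearPart_of_conj {A B : Sp 1} (h : A.1 = conj 1 * B.1 * conj 1) :
    relLinearPart A B = (ed B + ec B * Complex.I) * (ea B + (-eb B : ℝ) * Complex.I) := by
  obtain ⟨h1, h2, h3, h4⟩ := entries_of_conj h
  rw [relLinearPart, h1, h2, h3, h4]
  push_cast
  linear_combination (ec B * eb B : ℂ) * Complex.I_sq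

lemma continuous_relLinearPart : Continuous fun x : Sp 1 × Sp 1 => relLinearPart x.1 x.2 := by
  have h1 := continuous_ea
  have h2 := continuous_eb
  have h3 := continuous_ec
  have h4 := continuous_ed
  unfold relLinearPart
  fun_prop

end Entries

/-- For a symmetric path, the argument of the linear part at the end of the period is the sum of
two arguments at half the period. -/
theorem exists_linearPart_arg {T : ℝ} {Ψ : ℝ → Sp 1} (hΨ : Continuous Ψ) (h0 : Ψ 0 = 1)
    (hper : ∀ t, Ψ (t + T) = Ψ t * Ψ T)
    (hsymm : ∀ t, (Ψ (-t)).1 = conj 1 * (Ψ t).1 * conj 1) {p q : ℝ → ℝ} (hp : Continuous p)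
    (hq : Continuous q) (hp0 : p 0 = 0) (hq0 : q 0 = 0)
    (hpe : ∀ t, (ed (Ψ t) : ℂ) + ec (Ψ t) * Complex.I
      = ‖(ed (Ψ t) : ℂ) + ec (Ψ t) * Complex.I‖ * Complex.exp (p t * Complex.I))
    (hqe : ∀ t, (ea (Ψ t) : ℂ) + (-eb (Ψ t) : ℝ) * Complex.I
      = ‖(ea (Ψ t) : ℂ) + (-eb (Ψ t) : ℝ) * Complex.I‖ * Complex.exp (q t * Complex.I)) :
    ∃ φ : ℝ → ℝ, Continuous φ ∧ φ 0 = 0 ∧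
      (∀ t, linearPart (Ψ t) = ‖linearPart (Ψ t)‖ * Complex.exp (φ t * Complex.I)) ∧
      φ T = p (T / 2) + q (T / 2) := by
  have hF : Continuous fun x : ℝ × ℝ => relLinearPart (Ψ x.1) (Ψ x.2) :=
    continuous_relLinearPart.comp (f := fun x : ℝ × ℝ => (Ψ x.1, Ψ x.2)) (by fun_prop)
  have hl1 : linearPart 1 = 1 := by simp [linearPart, ea_one, eb_one, ec_one, ed_one]
  -- One argument `f` over the whole plane of pairs `(x, y)`, for the linear part of `(Ψ x)⁻¹ Ψ y`.
  -- The restriction to `x = 0` is `φ`.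
  obtain ⟨f, hf, hf0, hfe⟩ := exists_continuous_arg hF (fun _ => relLinearPart_ne_zero _ _) (0, 0) 0
    (by simp [h0, relLinearPart_one, hl1])
  refine ⟨fun t => f (0, t), by fun_prop, hf0, fun t => ?_, ?_⟩
  · have := hfe (0, t)
    simpa only [h0, relLinearPart_one] using this
  · have hshift : ∀ t, relLinearPart (Ψ (-t)) (Ψ (T - t)) = linearPart (Ψ T) := fun t => by
      rw [show T - t = -t + T by ring, hper, relLinearPart_mul]
    -- Along `(-t, T - t)` the relative matrix is always `Ψ T`, so `f` is constant; along `(-t, t)`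
    -- it is `p + q` by the factorisation. The two lines meet at `t = T/2`.
    have e1 := eq_of_cexp_eq (f := fun t => f (-t, T - t)) (g := fun _ => f (0, T)) (by fun_prop)
      continuous_const (by simp) (fun t => by
        have h1 := hfe (-t, T - t)
        have h2 := hfe (0, T)
        simp only [hshift] at h1
        simp only [h0, relLinearPart_one] at h2
        exact cexp_eq_cexp_of_polar (norm_pos_iff.1 (norm_linearPart_pos _)) h1 h2) (T / 2)
    have e2 := eq_of_cexp_eq (f := fun t => f (-t, t)) (g := fun t => p t + q t) (by fun_prop)
      (by fun_prop) (by simp [hf0, hp0, hq0]) (fun t => by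
        refine cexp_eq_cexp_of_polar (relLinearPart_ne_zero _ _) (hfe (-t, t)) ?_
        rw [relLinearPart_of_conj (hsymm t), norm_mul]
        nth_rewrite 1 [hpe t, hqe t]
        push_cast
        rw [add_mul, Complex.exp_add]
        ring) (T / 2)
    change f (0, T) = _
    rw [← e1, ← e2, sub_half]

/-- The comparison of the two indices, in explicit form. -/
theorem index_comparison {T : ℝ} (hT : 0 < T) {Ψ : ℝ → Sp 1} (hΨ : Continuous Ψ) (h0 : Ψ 0 = 1)
    (hper : ∀ t, Ψ (t + T) = Ψ t * Ψ T)
    (hsymm : ∀ t, (Ψ (-t)).1 = conj 1 * (Ψ t).1 * conj 1) (hnd : NondegeneratePath Ψ T) :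
    ∃ k : ℤ, rsIndexSp Ψ (realSubspace 1) 0 (T / 2) = k + 1 / 2 ∧
      |czIndex Ψ T - (2 * k + 1)| ≤ 1 := by
  have hcont : ∀ {f g : Sp 1 → ℝ}, Continuous f → Continuous g →
      Continuous fun t => (f (Ψ t) : ℂ) + g (Ψ t) * Complex.I := fun hf hg => by fun_prop
  have hne : ∀ {x y : ℝ}, (x : ℂ) + y * Complex.I = 0 → x = 0 ∧ y = 0 := fun {x y} h => by
    simpa using polar_form (r := 0) (θ := 0) (by simpa using h)
  obtain ⟨θ, hθ, hθ0, hθe⟩ := exists_continuous_arg (hcont continuous_ea continuous_ec)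
    (fun t h => by
      have h1 := det_entries (Ψ t)
      rw [(hne h).1, (hne h).2] at h1
      simp at h1) 0 0 (by simp [h0, ea_one, ec_one])
  obtain ⟨p, hp, hp0, hpe⟩ := exists_continuous_arg (hcont continuous_ed continuous_ec)
    (fun t h => by
      have h1 := det_entries (Ψ t)
      rw [(hne h).1, (hne h).2] at h1
      simp at h1) 0 0 (by simp [h0, ed_one, ec_one])
  obtain ⟨q, hq, hq0, hqe⟩ := exists_continuous_arg
    (hcont (g := fun A => -eb A) continuous_ea continuous_eb.neg)
    (fun t h => by
      have h1 := det_entries (Ψ t)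
      rw [(hne h).1, neg_eq_zero.1 (hne h).2] at h1
      simp at h1) 0 0 (by simp [h0, ea_one, eb_one])
  obtain ⟨φ, hφ, hφ0, hφe, hφT⟩ := exists_linearPart_arg hΨ h0 hper hsymm hp hq hp0 hq0 hpe hqe
  -- `a + ic` and `d + ic` share their imaginary part, so being opposite forces `c = 0` and `ad <
  -- 0`, against `ad - bc = 1`.
  have hθp := abs_lt_pi_of_cos_ne (f := fun t => θ t - p t) (hθ.sub hp) (by simp [hθ0, hp0]) (fun t h => by
    obtain ⟨h1, h2⟩ := polar_form (hθe t)
    obtain ⟨h3, h4⟩ := polar_form (hpe t)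
    have hdet := det_entries (Ψ t)
    have hs : Real.sin (θ t - p t) = 0 := by
      rw [← sq_eq_zero_iff, Real.sin_sq, h]
      ring
    rw [Real.cos_sub] at h
    rw [Real.sin_sub] at hs
    set r := ‖(ea (Ψ t) : ℂ) + ec (Ψ t) * Complex.I‖
    set s := ‖(ed (Ψ t) : ℂ) + ec (Ψ t) * Complex.I‖
    have hr0 : 0 ≤ r := norm_nonneg _
    have hs0 : 0 ≤ s := norm_nonneg _
    have e1 : ea (Ψ t) * ed (Ψ t) + ec (Ψ t) * ec (Ψ t) = -(r * s) := by
      nth_rewrite 1 [h2]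
      rw [h1, h3, h4]
      linear_combination r * s * h
    have e2 : ec (Ψ t) * ed (Ψ t) - ea (Ψ t) * ec (Ψ t) = 0 := by
      nth_rewrite 1 [h2]
      rw [h1, h3, h4]
      linear_combination r * s * hs
    have hrs := mul_nonneg hr0 hs0
    have e3 : ec (Ψ t) * (ed (Ψ t) - ea (Ψ t)) = 0 := by linarith
    rcases mul_eq_zero.1 e3 with h5 | h5
    · rw [h5] at e1 hdet
      linarith
    · have h6 : ed (Ψ t) = ea (Ψ t) := by linarith
      rw [h6] at e1 hdet
      have h7 : ea (Ψ t) = 0 := by nlinarith [mul_self_nonneg (ea (Ψ t)), mul_self_nonneg (ec (Ψ t))]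
      have h8 : ec (Ψ t) = 0 := by nlinarith [mul_self_nonneg (ea (Ψ t)), mul_self_nonneg (ec (Ψ t))]
      rw [h7, h8] at hdet
      linarith) (T / 2)
  -- The real scalar product of `d + ic` and `a - ib` is `ad - bc = 1 > 0`, so they are never
  -- opposite.
  have hpq := abs_lt_pi_of_cos_ne (f := fun t => p t - q t) (hp.sub hq) (by simp [hp0, hq0]) (fun t h => by
    obtain ⟨h1, h2⟩ := polar_form (hpe t)
    obtain ⟨h3, h4⟩ := polar_form (hqe t)
    have hdet := det_entries (Ψ t)
    rw [Real.cos_sub] at h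
    set r := ‖(ed (Ψ t) : ℂ) + ec (Ψ t) * Complex.I‖
    set s := ‖(ea (Ψ t) : ℂ) + (-eb (Ψ t) : ℝ) * Complex.I‖
    have hrs : 0 ≤ r * s := mul_nonneg (norm_nonneg _) (norm_nonneg _)
    have e1 : ed (Ψ t) * ea (Ψ t) + ec (Ψ t) * (-eb (Ψ t)) = -(r * s) := by
      rw [h1, h2, h3, h4]
      linear_combination r * s * h
    linarith) (T / 2)
  set A := Ψ (T / 2) with hA
  have hdet := det_entries A
  obtain ⟨i1, i2, i3, i4⟩ := entries_of_conj (hsymm (T / 2))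
  -- Hence `Ψ T = (I A I)⁻¹ A`, with both diagonal entries equal to `ad + bc = 1 + 2bc`;
  -- nondegeneracy excludes trace `2`, that is `bc = 0`.
  have hmul : A = Ψ (-(T / 2)) * Ψ T := by
    rw [← hper, hA]
    ring_nf
  have m1 := congrArg ea hmul
  have m2 := congrArg eb hmul
  have m3 := congrArg ec hmul
  have m4 := congrArg ed hmul
  rw [ea_mul, i1, i2] at m1
  rw [eb_mul, i1, i2] at m2
  rw [ec_mul, i3, i4] at m3
  rw [ed_mul, i3, i4] at m4
  have t1 : ea (Ψ T) = ea A * ed A + eb A * ec A := by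
    linear_combination (-ea (Ψ T)) * hdet - ed A * m1 - eb A * m3
  have t4 : ed (Ψ T) = ea A * ed A + eb A * ec A := by
    linear_combination (-ed (Ψ T)) * hdet - ec A * m2 - ea A * m4
  have hbc : eb A * ec A ≠ 0 := fun h => finrank_ker_act_sub_id hnd (by
    rw [t1, t4]
    linarith)
  have hb0 : eb A ≠ 0 := left_ne_zero_of_mul hbc
  have hc0 : ec A ≠ 0 := right_ne_zero_of_mul hbc
  obtain ⟨h1, h2⟩ := polar_form (hθe (T / 2))
  obtain ⟨h3, h4⟩ := polar_form (hpe (T / 2))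
  obtain ⟨h5, h6⟩ := polar_form (hqe (T / 2))
  have hlin : ‖linearPart (Ψ T)‖ = ‖(ed A : ℂ) + ec A * Complex.I‖
      * ‖(ea A : ℂ) + (-eb A : ℝ) * Complex.I‖ := by
    rw [← norm_mul, ← relLinearPart_of_conj (hsymm (T / 2)), ← relLinearPart_mul (Ψ (-(T / 2))),
      ← hmul]
  obtain ⟨hθne, hsq, k, hk, hcz⟩ := halfFloor_comparison hdet hbc
    (norm_pos_iff.2 fun h => hc0 (hne h).2) (norm_pos_iff.2 fun h => hc0 (hne h).2)
    (norm_pos_iff.2 fun h => hb0 (neg_eq_zero.1 (hne h).2)) h2 h3 h4 h5 h6 hθp hpq rfl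
  rw [← hφT, ← hlin] at hsq hcz
  refine ⟨k, ?_, ?_⟩
  · rw [rsIndexSp_eq (half_pos hT) hθ hθe hθ0 hθne, hk]
  · rw [czIndex_eq hΨ h0 hT hφ hφe hφ0 rfl hsq]
    exact hcz

end

end RobbinSalamon

theorem mainTheorem7 (T : ℝ) (hT : 0 < T)
    (Ψ : ℝ → RobbinSalamon.Sp 1) (hcont : Continuous Ψ)
    (h0 : Ψ 0 = 1)
    (hper : ∀ t : ℝ, Ψ (t + T) = Ψ t * Ψ T)
    (hsymm : ∀ t : ℝ, (Ψ (-t)).1 = RobbinSalamon.conj 1 * (Ψ t).1 * RobbinSalamon.conj 1)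
    (hnd : RobbinSalamon.NondegeneratePath Ψ T) :
    |RobbinSalamon.czIndex Ψ T
        - 2 * RobbinSalamon.rsIndexSp Ψ (RobbinSalamon.realSubspace 1) 0 (T / 2)| ≤ 1 ∧
    (3 ≤ RobbinSalamon.czIndex Ψ T →
      3 / 2 ≤ RobbinSalamon.rsIndexSp Ψ (RobbinSalamon.realSubspace 1) 0 (T / 2)) := by
  obtain ⟨k, hk, hcz⟩ := RobbinSalamon.index_comparison hT hcont h0 hper hsymm hnd
  rw [hk, show 2 * ((k : ℚ) + 1 / 2) = 2 * k + 1 by ring]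
  refine ⟨hcz, fun h => ?_⟩
  have h1 := (abs_le.1 hcz).2
  -- `2k + 1 ≥ 3 - 1` only gives `k ≥ 1/2`; integrality raises this to `k ≥ 1`.
  have h2 : (0 : ℚ) < k := by linarith
  have h3 : (1 : ℚ) ≤ k := by exact_mod_cast Int.cast_pos.1 h2
  linarith
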